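/- **Setting.** Let $n>m\ge 0$ be even integers and $\alpha:=\frac{n-m}{2}$. Let $$Qu=\sum_{j=0}^n q_j(x)u^{(j)},\qquad Pu=u^{(m)}+\sum_{j=0}^{m-1}p_j(x)u^{(j)},$$ with complex-valued $q_j,p_j\in C^\infty(\mathbb R)$, where $q_n$ is real-valued and $|q_n(x)|\ge c>0$ for all $x\in\mathbb R$. Let $Q^*$ be the formal adjoint of $Q$. Assume that $Qu=0$ has $\frac n2$ linearly independent solutions in $L^2(-\infty,0)$ and $\frac n2$ linearly independent solutions in $L^2(0,\infty)$, and that its only solution in $L^2(\mathbb R)$ is $u=0$. Let $R(x,y)$ be a locally integrable kernel on $\mathbb R^2$ with $R(x,y)=\overline{R(y,x)}$, such that $R\varphi:=\int_{\mathbb R}R(\cdot,y)\varphi(y)\,dy\in L^2(\mathbb R)$ for all $\varphi\in C_0^\infty(\mathbb R)$. Write $(\cdot,\cdot)$ for the inner product of $L^2(\mathbb R)$ and $\|\cdot\|_s$ for the norm of the Sobolev space $H^s(\mathbb R)$. Assume that, in the sense of distributions, $$QR=P\delta(x-y)\qquad\text{(with } Q,P \text{ acting in } x),\tag{1.7}$$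 and that there are positive constants $c_3,\dots,c_6$ such that, for all $\varphi\in C_0^\infty(\mathbb R)$, $$c_3\|\varphi\|_{n-\alpha}\le\|Q^*\varphi\|_{-\alpha}\le c_4\|\varphi\|_{n-\alpha},\tag{1.10}$$ $$c_5\|\varphi\|^2_{\frac{n+m}2}\le (PQ^*\varphi,\varphi)\le c_6\|\varphi\|^2_{\frac{n+m}2}.\tag{1.11}$$ Let $0<L<\infty$, and let $\dot H^{-\alpha}(0,L)$ be the dual space of $H^\alpha(0,L)$ with respect to the $L^2(0,L)$ pairing; its elements are distributions on $\mathbb R$ supported in $[0,L]$. **Theorem 1.3.** There is a unique family of distributions $G(\cdot,y)$, $y\in\mathbb R$, with $PG(x,y)=\delta(x-y)$ and $G(x,y)=0$ for $x<y$, and it depends smoothly on $y$. For every $f\in H^n(0,L)$ the equation $$Rh:=\int_0^L R(x,y)h(y)\,dy=f(x),\qquad 0\le x\le L,$$ has exactly one solution $h\in\dot H^{-\alpha}(0,L)$, and there are constants $a_j^\pm$ such that $$h=\int_0^x G(x,y)\,Qf(y)\,dy+\sum_{j=0}^{n-\alpha-1}\Big[a_j^-(-1)^j\,\partial_y^jG(x,y)\big|_{y=0}+a_j^+(-1)^j\,\partial_y^jG(x,y)\big|_{y=L}\Big]\tag{1.12}$$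 in the sense of distributions on $\mathbb R$, where $Qf$ is extended by zero outside $(0,L)$. The constants $a_j^\pm$ in this representation of $h$ are unique. Moreover, call constants $a_j^\pm$ admissible if there is $F\in H^\alpha(\mathbb R)$ with $F=f$ on $(0,L)$ and $$QF=Qf+\sum_{j=0}^{n-\alpha-1}\big[a_j^-\delta^{(j)}(x)+a_j^+\delta^{(j)}(x-L)\big]$$ in the sense of distributions (so that $QF=0$ for $x<0$ and for $x>L$). Then the constants of the solution $h$ are admissible, and they are the only admissible constants for which the right-hand side of (1.12) vanishes for $x>L$. -/

import Mathlib

open MeasureTheory Set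
open scoped ContDiff Distributions FourierTransform

noncomputable section

/-- Complex test functions on the real line, i.e. `C₀^∞(ℝ)`. -/
abbrev TestFn : Type := 𝓓((⊤ : TopologicalSpace.Opens ℝ), ℂ)

/-- Complex distributions on the real line: continuous `ℂ`-linear functionals on `C₀^∞(ℝ)`.
A locally integrable function `u` is the distribution `φ ↦ ∫ u φ` (no conjugation). -/
abbrev Distr : Type := TestFn →L[ℂ] ℂ

/-- The differential expression `∑_{j ≤ k} a_j(x) u^{(j)}(x)`, for a smooth function `u`. -/
def diffOp (k : ℕ) (a : ℕ → ℝ → ℂ) (u : ℝ → ℂ) (x : ℝ) : ℂ :=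
  ∑ j ∈ Finset.range (k + 1), a j x * iteratedDeriv j u x

/-- The formal transpose `∑_{j ≤ k} (-1)^j (a_j u)^{(j)}` (with respect to `∫ u v`). -/
def transposeOp (k : ℕ) (a : ℕ → ℝ → ℂ) (u : ℝ → ℂ) (x : ℝ) : ℂ :=
  ∑ j ∈ Finset.range (k + 1), (-1) ^ j * iteratedDeriv j (fun t => a j t * u t) x

/-- The formal adjoint `∑_{j ≤ k} (-1)^j (conj a_j u)^{(j)}`
(with respect to the `L²` inner product `∫ u conj v`). -/
def adjointOp (k : ℕ) (a : ℕ → ℝ → ℂ) (u : ℝ → ℂ) : ℝ → ℂ :=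
  transposeOp k (fun j t => star (a j t)) u

theorem contDiff_iteratedDeriv_of_smooth {u : ℝ → ℂ} (hu : ContDiff ℝ ∞ u) (j : ℕ) :
    ContDiff ℝ ∞ (iteratedDeriv j u) := by
  induction j with
  | zero => simpa using hu
  | succ j ih =>
    rw [iteratedDeriv_succ]
    exact (contDiff_infty_iff_deriv.mp ih).2

theorem tsupport_iteratedDeriv_subset' (u : ℝ → ℂ) (j : ℕ) :
    tsupport (iteratedDeriv j u) ⊆ tsupport u := by
  induction j with
  | zero => simp
  | succ j ih =>
    rw [iteratedDeriv_succ]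
    exact (closure_minimal support_deriv_subset (isClosed_tsupport _)).trans ih

theorem contDiff_transposeOp (k : ℕ) {a : ℕ → ℝ → ℂ} (ha : ∀ j, ContDiff ℝ ∞ (a j))
    {u : ℝ → ℂ} (hu : ContDiff ℝ ∞ u) : ContDiff ℝ ∞ (transposeOp k a u) := by
  unfold transposeOp
  refine ContDiff.sum fun j _ => ?_
  exact contDiff_const.mul (contDiff_iteratedDeriv_of_smooth ((ha j).mul hu) j)

theorem support_transposeOp_subset (k : ℕ) (a : ℕ → ℝ → ℂ) (u : ℝ → ℂ) :
    Function.support (transposeOp k a u) ⊆ tsupport u := by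
  intro x hx
  by_contra hxu
  refine hx (Finset.sum_eq_zero fun j _ => ?_)
  have h1 : x ∉ tsupport (iteratedDeriv j (fun t => a j t * u t)) := fun h =>
    hxu (tsupport_mul_subset_right (f := a j) (g := u)
      (tsupport_iteratedDeriv_subset' _ j h))
  rw [image_eq_zero_of_notMem_tsupport h1, mul_zero]

/-- The formal transpose of a differential expression with smooth coefficients, as a map of
test functions. For a distribution `T`, `(A T)(φ) = T (Aᵗ φ)`. -/
def transposeTest (k : ℕ) (a : ℕ → ℝ → ℂ) (ha : ∀ j, ContDiff ℝ ∞ (a j)) (φ : TestFn) :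
    TestFn where
  toFun := transposeOp k a φ
  contDiff' := contDiff_transposeOp k ha φ.contDiff
  hasCompactSupport' := HasCompactSupport.intro φ.hasCompactSupport (fun x hx => by
    by_contra h
    exact hx (support_transposeOp_subset k a φ h))
  tsupport_subset' := by simp

/-- A smooth classical solution of `∑_{j ≤ k} a_j u^{(j)} = 0` on the real line. -/
def IsODESolution (k : ℕ) (a : ℕ → ℝ → ℂ) (u : ℝ → ℂ) : Prop :=
  ContDiff ℝ ∞ u ∧ ∀ x, diffOp k a u x = 0

/-- The norm `(∫ (1 + ξ²)^s |û(ξ)|² dξ)^{1/2}` of the Sobolev space `H^s(ℝ)`, `s` real; it is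
applied to functions of class `C₀^∞(ℝ)` only. -/
def sobolevNorm (s : ℝ) (u : ℝ → ℂ) : ℝ :=
  √(∫ ξ : ℝ, (1 + ξ ^ 2) ^ s * ‖𝓕 u ξ‖ ^ 2)

/-- `v` is the weak derivative of order `j` of `u` on the set `Ω`. -/
def IsWeakDeriv (Ω : Set ℝ) (j : ℕ) (u v : ℝ → ℂ) : Prop :=
  ∀ φ : TestFn, tsupport φ ⊆ Ω →
    ∫ x in Ω, u x * iteratedDeriv j φ x = (-1) ^ j * ∫ x in Ω, v x * φ x

/-- `u ∈ H^k(Ω)`: `u` and its weak derivatives up to order `k` are in `L²(Ω)`. -/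
def MemH (k : ℕ) (Ω : Set ℝ) (u : ℝ → ℂ) : Prop :=
  MemLp u 2 (volume.restrict Ω) ∧
    ∀ j ≤ k, ∃ v : ℝ → ℂ, MemLp v 2 (volume.restrict Ω) ∧ IsWeakDeriv Ω j u v

open Classical in
/-- The weak derivative of order `j` of `u` on `Ω`, if there is one in `L²(Ω)`; it is then unique
almost everywhere on `Ω`. -/
def weakDeriv (Ω : Set ℝ) (j : ℕ) (u : ℝ → ℂ) : ℝ → ℂ :=
  if h : ∃ v : ℝ → ℂ, MemLp v 2 (volume.restrict Ω) ∧ IsWeakDeriv Ω j u v then h.choose else 0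

/-- `∑_{j ≤ k} a_j u^{(j)}` on `Ω` for `u ∈ H^k(Ω)`. -/
def weakDiffOp (k : ℕ) (a : ℕ → ℝ → ℂ) (Ω : Set ℝ) (u : ℝ → ℂ) (x : ℝ) : ℂ :=
  ∑ j ∈ Finset.range (k + 1), a j x * weakDeriv Ω j u x

/-- `h ∈ Ḣ^{-k}(0, L)`, the dual space of `H^k(0, L)` with respect to the `L²(0, L)` pairing:
`h` is a distribution which is a bounded functional for the norm
`‖φ‖² = ∑_{j ≤ k} ∫₀^L |φ^{(j)}|²` of `H^k(0, L)`. As the restrictions to `(0, L)` of functions of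
class `C₀^∞(ℝ)` are dense in `H^k(0, L)`, such an `h` is the same as an element of the dual. -/
def MemDualH (k : ℕ) (L : ℝ) (h : Distr) : Prop :=
  ∃ C : ℝ, ∀ φ : TestFn,
    ‖h φ‖ ≤ C * √(∑ j ∈ Finset.range (k + 1), ∫ x in Ioo 0 L, ‖iteratedDeriv j φ x‖ ^ 2)

/-- `R φ (x) = ∫ R(x, y) φ(y) dy` over the real line. -/
def kernelOp (R : ℝ → ℝ → ℂ) (φ : ℝ → ℂ) (x : ℝ) : ℂ := ∫ y, R x y * φ y

/-- `Q_x R(x, y) = P_x δ(x - y)` in the sense of distributions: `Q (R ψ) = P ψ` in the sense of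
distributions for every test function `ψ`. -/
def KernelEq (n m : ℕ) (q p : ℕ → ℝ → ℂ) (R : ℝ → ℝ → ℂ) : Prop :=
  ∀ φ ψ : TestFn, ∫ x, kernelOp R ψ x * transposeOp n q φ x = ∫ x, diffOp m p ψ x * φ x

/-- `∫₀^L R(x, y) h(y) dy = f(x)` on `(0, L)`, for a distribution `h` in a space `Ḣ^{-k}(0, L)`:
for each test function `φ` supported in `(0, L)`, the value of `h` on `y ↦ ∫ R(x, y) φ(x) dx`
equals `∫₀^L f φ`. The function `y ↦ ∫ R(x, y) φ(x) dx` is represented by a test function `ψ`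
which agrees with it almost everywhere on `(0, L)`; for `h ∈ Ḣ^{-k}(0, L)` the value `h ψ` depends
on `ψ` only through its restriction to `(0, L)`. -/
def SolvesOn (R : ℝ → ℝ → ℂ) (L : ℝ) (f : ℝ → ℂ) (h : Distr) : Prop :=
  ∀ φ : TestFn, tsupport φ ⊆ Ioo 0 L →
    ∃ ψ : TestFn, (∀ᵐ y ∂(volume.restrict (Ioo 0 L)), ψ y = ∫ x, R x y * φ x) ∧
      h ψ = ∫ x in Ioo 0 L, f x * φ x

/-- `G(·, y)`, a distribution in `x` for each `y`, satisfies `P G(·, y) = δ(x - y)` and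
`G(x, y) = 0` for `x < y`. -/
def IsCausalFundamental (m : ℕ) (p : ℕ → ℝ → ℂ) (hp : ∀ j, ContDiff ℝ ∞ (p j))
    (G : ℝ → Distr) : Prop :=
  (∀ (y : ℝ) (φ : TestFn), G y (transposeTest m p hp φ) = φ y) ∧
    ∀ (y : ℝ) (φ : TestFn), tsupport φ ⊆ Iio y → G y φ = 0

/-- The distribution in `x`, evaluated at the test function `φ`,
`∫₀^x G(x, y) g(y) dy + ∑_{j < N} [a⁻_j (-1)^j ∂_y^j G(x, 0) + a⁺_j (-1)^j ∂_y^j G(x, L)]`,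
where `g` is a function on `(0, L)`, extended by zero, and `a = (a⁻, a⁺)`. As `G(x, y) = 0` for
`x < y`, the integral may be taken over all `y` in `(0, L)`. -/
def representation (G : ℝ → Distr) (L : ℝ) (g : ℝ → ℂ) {N : ℕ}
    (a : (Fin N → ℂ) × (Fin N → ℂ)) (φ : TestFn) : ℂ :=
  (∫ y in Ioo 0 L, g y * G y φ) +
    ∑ j : Fin N, (a.1 j * (-1) ^ (j : ℕ) * iteratedDeriv j (fun y => G y φ) 0 +
      a.2 j * (-1) ^ (j : ℕ) * iteratedDeriv j (fun y => G y φ) L)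

/-- The constants `a = (a⁻, a⁺)` arise from an extension `F ∈ H^k(ℝ)` of `f` with `Q F = 0` outside
`[0, L]`, through
`Q F = Q f + ∑_{j < N} [a⁻_j δ^{(j)}(x) + a⁺_j δ^{(j)}(x - L)]` in the sense of distributions
(with `Q f` extended by zero from `(0, L)`; the equation contains `Q F = 0` on `x < 0` and on
`x > L`). -/
def IsAdmissible (n k : ℕ) (q : ℕ → ℝ → ℂ) (L : ℝ) (f : ℝ → ℂ) {N : ℕ}
    (a : (Fin N → ℂ) × (Fin N → ℂ)) : Prop :=
  ∃ F : ℝ → ℂ, MemH k univ F ∧ (∀ᵐ x ∂(volume.restrict (Ioo 0 L)), F x = f x) ∧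
    ∀ φ : TestFn, ∫ x, F x * transposeOp n q φ x =
      (∫ x in Ioo 0 L, weakDiffOp n q (Ioo 0 L) f x * φ x) +
        ∑ j : Fin N, (a.1 j * (-1) ^ (j : ℕ) * iteratedDeriv j φ 0 +
          a.2 j * (-1) ^ (j : ℕ) * iteratedDeriv j φ L)

end

noncomputable section

/-! ### Test functions -/

/-! Conjugation turns `Q*` into the transpose `Qᵗ`, and `QR = Pδ` gives `⟨R ψ, Qᵗζ⟩ = ∫ conj ψ ·
Pᵗζ`. So on the range of `Qᵗ` the kernel form is the quadratic form of `PQ*`. Since `n - α = (n + m)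
/ 2`, the two-sided estimates say that this form is equivalent to the squared norm of `H^{-α}`. The
range of `Qᵗ` is dense in `H^{-α}`: a functional that kills it is a function `F ∈ H^α` with `QF =
0`, smooth by regularity and zero because `Q` has no solutions in `L²(ℝ)`. Cauchy-Schwarz, duality
and the same uniqueness in `L²` make `R` a bounded, Hermitian, coercive form on all of `H^{-α}`
(`norm_kernelForm_transpose_le`).

For test functions supported in `(0, L)` the norm of `H^{-α}(ℝ)` is equivalent to the norm of the
dual of `H^α(0, L)` (`norm_pairing_le`, `norm_sob_le_norm_pairing`). The Lax-Milgram lemma in that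
dual then gives the solution `h` and its uniqueness (`exists_solution`).

For the formula, Hermitian symmetry transposes `QR = P` to `R Qᵗ = Pᵗ` on the interval. Hence `ζ ↦
h(Pᵗζ) - ∫ Qf ζ` vanishes on `C₀^∞(0, L)`; it is bounded for the norm of `H^{m+α}(0, L)`, so it is a
sum of derivatives of order below `m + α = n - α` at `0` and `L` (`exists_eq_boundarySum`).
Inverting `Pᵗ` by the solution that vanishes to the right, `y ↦ G y φ`, turns this into the
representation. Its constants are unique because `Pᵗζ` gives back `ζ` and the boundary functionals
are independent.

The function `F = Rh` on the whole line shows that these constants are admissible. If other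
admissible constants also give zero for `x > L`, the difference of the two right-hand sides is
supported in `[0, L]`. Solving `Pᵗu = χ` with data at `L / 2` shows that it is bounded on `H^α(0,
L)`, hence an element `z` of the dual (`norm_boundarySum_causal_le`). Now `Rz` and the difference of
the two extensions have the same image under `Q`, so they agree; thus `Rz = 0` on `(0, L)`, `z = 0`,
and the constants coincide (`eq_of_isAdmissible`). -/

theorem contDiff_ofReal_comp {g : ℝ → ℝ} (hg : ContDiff ℝ ∞ g) :
    ContDiff ℝ ∞ (fun x => (g x : ℂ)) := Complex.ofRealCLM.contDiff.comp hg

namespace TestFn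

/-- A smooth compactly supported function as a test function. -/
def mkSmooth (u : ℝ → ℂ) (hu : ContDiff ℝ ∞ u) (hc : HasCompactSupport u) : TestFn :=
  ⟨u, hu, hc, by simp⟩

@[simp] theorem mkSmooth_apply (u : ℝ → ℂ) (hu hc) (x : ℝ) : mkSmooth u hu hc x = u x := rfl

theorem smooth (φ : TestFn) : ContDiff ℝ ∞ φ := φ.contDiff

protected theorem integrable (φ : TestFn) (μ : Measure ℝ) [IsFiniteMeasureOnCompacts μ] :
    Integrable φ μ :=
  φ.continuous.integrable_of_hasCompactSupport φ.hasCompactSupport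

theorem memLp (φ : TestFn) (p : ENNReal) (μ : Measure ℝ) [IsFiniteMeasureOnCompacts μ] :
    MemLp φ p μ :=
  φ.continuous.memLp_of_hasCompactSupport φ.hasCompactSupport

/-- The derivative of order `j` of a test function. -/
def iterDeriv (j : ℕ) (φ : TestFn) : TestFn :=
  mkSmooth (iteratedDeriv j φ) (contDiff_iteratedDeriv_of_smooth φ.smooth j)
    (φ.hasCompactSupport.of_isClosed_subset (isClosed_tsupport _)
      (tsupport_iteratedDeriv_subset' φ j))

theorem coe_iterDeriv (j : ℕ) (φ : TestFn) : ⇑(iterDeriv j φ) = iteratedDeriv j φ := rfl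

theorem tsupport_iterDeriv (j : ℕ) (φ : TestFn) : tsupport (iterDeriv j φ) ⊆ tsupport φ :=
  tsupport_iteratedDeriv_subset' φ j

/-- The product of a smooth function and a test function. -/
def smoothMul (u : ℝ → ℂ) (hu : ContDiff ℝ ∞ u) (φ : TestFn) : TestFn :=
  mkSmooth (fun x => u x * φ x) (hu.mul φ.smooth) φ.hasCompactSupport.mul_left

theorem coe_smoothMul (u : ℝ → ℂ) (hu) (φ : TestFn) :
    ⇑(smoothMul u hu φ) = fun x => u x * φ x := rfl

theorem tsupport_smoothMul (u : ℝ → ℂ) (hu) (φ : TestFn) :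
    tsupport (smoothMul u hu φ) ⊆ tsupport φ := tsupport_mul_subset_right

/-- The complex conjugate of a test function. -/
def conj (φ : TestFn) : TestFn :=
  mkSmooth (fun x => star (φ x)) (Complex.conjCLE.contDiff.comp φ.smooth)
    (φ.hasCompactSupport.comp_left (g := fun z : ℂ => star z) (star_zero _))

@[simp] theorem conj_apply (φ : TestFn) (x : ℝ) : conj φ x = star (φ x) := rfl

theorem tsupport_conj (φ : TestFn) : tsupport (conj φ) ⊆ tsupport φ :=
  tsupport_comp_subset (g := fun z : ℂ => star z) (star_zero _) φ

/-- A smooth compactly supported function equal to `1` on a neighbourhood of `[a, b]` and to `0`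
outside `(a', b')`. -/
theorem exists_cutoff {a b a' b' : ℝ} (ha : a' < a) (hb : b < b') :
    ∃ χ : TestFn, tsupport χ ⊆ Ioo a' b' ∧ (∀ x ∈ Icc a b, ∀ᶠ y in nhds x, χ y = 1) := by
  obtain ⟨f, hf0, hf1, -⟩ := exists_contMDiffMap_zero_one_nhds_of_isClosed (n := (⊤ : ℕ∞))
    (modelWithCornersSelf ℝ ℝ) (s := (Ioo ((a' + a) / 2) ((b + b') / 2))ᶜ) (t := Icc a b)
    isOpen_Ioo.isClosed_compl
    isClosed_Icc (by
      rw [Set.disjoint_left]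
      intro x hx hx'
      exact hx ⟨by linarith [hx'.1], by linarith [hx'.2]⟩)
  -- The transition ends at the midpoints: the topological support is a closure and still has to lie
  -- in the open interval.
  have hsupp : tsupport (fun x => (f x : ℂ)) ⊆ Icc ((a' + a) / 2) ((b + b') / 2) := by
    refine closure_minimal (fun x hx => ?_) isClosed_Icc
    by_contra h
    refine hx ?_
    have : x ∈ (Ioo ((a' + a) / 2) ((b + b') / 2))ᶜ := fun h' => h (Ioo_subset_Icc_self h')
    simpa using (hf0.filter_mono (nhds_le_nhdsSet this)).self_of_nhds
  refine ⟨mkSmooth (fun x => (f x : ℂ)) (contDiff_ofReal_comp f.contMDiff.contDiff)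
    (isCompact_Icc.of_isClosed_subset (isClosed_tsupport _) hsupp), ?_, ?_⟩
  · refine hsupp.trans fun x hx => ⟨by linarith [hx.1], by linarith [hx.2]⟩
  · intro x hx
    filter_upwards [hf1.filter_mono (nhds_le_nhdsSet hx)] with y hy
    exact (congrArg Complex.ofReal hy).trans Complex.ofReal_one

end TestFn

/-! ### Integration by parts against test functions. -/

theorem LocInt.integrable_mul {f : ℝ → ℂ} (hf : LocallyIntegrable f) (φ : TestFn) :
    Integrable (fun x => f x * φ x) :=
  hf.integrable_smul_right_of_hasCompactSupport φ.continuous φ.hasCompactSupport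

theorem LocInt.integrable_mul_iteratedDeriv {f : ℝ → ℂ} (hf : LocallyIntegrable f) (φ : TestFn)
    (j : ℕ) : Integrable (fun x => f x * iteratedDeriv j φ x) :=
  LocInt.integrable_mul hf (TestFn.iterDeriv j φ)

theorem TestFn.differentiable (φ : TestFn) : Differentiable ℝ φ :=
  φ.smooth.differentiable (by simp)

/-- Integration by parts against a test function. -/
theorem integral_mul_deriv_testFn {u u' : ℝ → ℂ} (hu : ∀ x, HasDerivAt u (u' x) x)
    (hu' : LocallyIntegrable u') (φ : TestFn) :
    ∫ x, u x * deriv φ x = -∫ x, u' x * φ x := by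
  have hc : Continuous u := continuous_iff_continuousAt.2 fun x => (hu x).continuousAt
  have h1 := LocInt.integrable_mul hc.locallyIntegrable (TestFn.iterDeriv 1 φ)
  rw [TestFn.coe_iterDeriv, iteratedDeriv_one] at h1
  exact integral_mul_deriv_eq_deriv_mul_of_integrable (fun x _ => hu x)
    (fun x _ => (φ.differentiable x).hasDerivAt) h1
    (LocInt.integrable_mul hu' φ) (LocInt.integrable_mul hc.locallyIntegrable φ)

theorem hasDerivAt_iteratedDeriv {u : ℝ → ℂ} (hu : ContDiff ℝ ∞ u) (j : ℕ) (x : ℝ) :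
    HasDerivAt (iteratedDeriv j u) (iteratedDeriv (j + 1) u x) x := by
  rw [iteratedDeriv_succ]
  exact ((contDiff_iteratedDeriv_of_smooth hu j).differentiable (by simp) x).hasDerivAt

theorem continuous_iteratedDeriv_of_smooth {u : ℝ → ℂ} (hu : ContDiff ℝ ∞ u) (j : ℕ) :
    Continuous (iteratedDeriv j u) := (contDiff_iteratedDeriv_of_smooth hu j).continuous

theorem integral_mul_iteratedDeriv_testFn {u : ℝ → ℂ} (hu : ContDiff ℝ ∞ u) (j : ℕ) :
    ∀ φ : TestFn, ∫ x, u x * iteratedDeriv j φ x = (-1) ^ j * ∫ x, iteratedDeriv j u x * φ x := by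
  induction j generalizing u with
  | zero => simp
  | succ j ih =>
    intro φ
    have h1 := integral_mul_deriv_testFn (fun x => (hu.differentiable (by simp) x).hasDerivAt)
      ((contDiff_infty_iff_deriv.1 hu).2.continuous.locallyIntegrable) (TestFn.iterDeriv j φ)
    rw [TestFn.coe_iterDeriv, ← iteratedDeriv_succ] at h1
    rw [h1, ih (contDiff_infty_iff_deriv.1 hu).2, ← iteratedDeriv_succ']
    ring

/-! ### Differential expressions -/

theorem contDiff_diffOp (k : ℕ) {a : ℕ → ℝ → ℂ} (ha : ∀ j, ContDiff ℝ ∞ (a j))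
    {u : ℝ → ℂ} (hu : ContDiff ℝ ∞ u) : ContDiff ℝ ∞ (diffOp k a u) := by
  unfold diffOp
  exact ContDiff.sum fun j _ => (ha j).mul (contDiff_iteratedDeriv_of_smooth hu j)

/-- The formal transpose is again a differential expression with smooth coefficients. -/
theorem exists_transposeOp_eq_diffOp (k : ℕ) {a : ℕ → ℝ → ℂ} (ha : ∀ j, ContDiff ℝ ∞ (a j)) :
    ∃ b : ℕ → ℝ → ℂ, (∀ j, ContDiff ℝ ∞ (b j)) ∧ (∀ x, b k x = (-1) ^ k * a k x) ∧
      ∀ u : ℝ → ℂ, ContDiff ℝ ∞ u → transposeOp k a u = diffOp k b u := by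
  -- By Leibniz, `(a_j u)^{(j)}` contributes `choose j i * a_j^{(j-i)}` to the coefficient of
  -- `u^{(i)}`; for `i = k` only `j = k` contributes.
  refine ⟨fun i x => ∑ j ∈ Finset.range (k + 1), if i ≤ j then
      (-1) ^ j * ((j.choose i : ℂ) * iteratedDeriv (j - i) (a j) x) else 0, ?_, ?_, ?_⟩
  · intro i
    refine ContDiff.sum fun j _ => ?_
    split_ifs
    · exact contDiff_const.mul (contDiff_const.mul (contDiff_iteratedDeriv_of_smooth (ha j) _))
    · exact contDiff_const
  · intro x
    change ∑ j ∈ Finset.range (k + 1), _ = _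
    rw [Finset.sum_eq_single k]
    · simp
    · intro j hj hjk
      rw [if_neg]
      have := Finset.mem_range.1 hj
      omega
    · simp
  · intro u hu
    ext x
    unfold transposeOp diffOp
    have h1 : ∀ j ∈ Finset.range (k + 1), (-1) ^ j * iteratedDeriv j (fun t => a j t * u t) x =
        ∑ i ∈ Finset.range (k + 1), (if i ≤ j then
          (-1) ^ j * ((j.choose i : ℂ) * iteratedDeriv (j - i) (a j) x) else 0) *
            iteratedDeriv i u x := by
      intro j hj
      have hj' := Finset.mem_range.1 hj
      have h2 := iteratedDeriv_fun_mul (n := j) (x := x)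
        ((hu.of_le (by exact_mod_cast le_top)).contDiffAt)
        (((ha j).of_le (by exact_mod_cast le_top)).contDiffAt)
      simp_rw [mul_comm (a j _)]
      rw [h2, Finset.mul_sum]
      have hsub : Finset.range (j + 1) ⊆ Finset.range (k + 1) :=
        Finset.range_subset_range.2 (by omega)
      rw [← Finset.sum_subset hsub]
      · refine Finset.sum_congr rfl fun i hi => ?_
        have := Finset.mem_range.1 hi
        rw [if_pos (by omega)]
        ring
      · intro i _ hi
        rw [if_neg (by simpa using hi), zero_mul]
    rw [Finset.sum_congr rfl h1, Finset.sum_comm]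
    exact Finset.sum_congr rfl fun i _ => by rw [Finset.sum_mul]

theorem coe_transposeTest (k : ℕ) (a : ℕ → ℝ → ℂ) (ha) (φ : TestFn) :
    ⇑(transposeTest k a ha φ) = transposeOp k a φ := rfl

theorem tsupport_transposeTest (k : ℕ) (a : ℕ → ℝ → ℂ) (ha) (φ : TestFn) :
    tsupport (transposeTest k a ha φ) ⊆ tsupport φ :=
  closure_minimal (support_transposeOp_subset k a φ) (isClosed_tsupport _)

theorem transposeOp_add (k : ℕ) {a : ℕ → ℝ → ℂ} (ha : ∀ j, ContDiff ℝ ∞ (a j)) {u v : ℝ → ℂ}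
    (hu : ContDiff ℝ ∞ u) (hv : ContDiff ℝ ∞ v) :
    transposeOp k a (u + v) = transposeOp k a u + transposeOp k a v := by
  ext x
  simp only [transposeOp, Pi.add_apply, ← Finset.sum_add_distrib, ← mul_add]
  simp only [mul_add (a _ _)]
  refine Finset.sum_congr rfl fun j _ => ?_
  rw [iteratedDeriv_fun_add ((((ha j).mul hu).of_le (by exact_mod_cast le_top)).contDiffAt)
    ((((ha j).mul hv).of_le (by exact_mod_cast le_top)).contDiffAt)]

theorem transposeOp_smul (k : ℕ) (a : ℕ → ℝ → ℂ) (c : ℂ) (u : ℝ → ℂ) :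
    transposeOp k a (c • u) = c • transposeOp k a u := by
  ext x
  simp only [transposeOp, Pi.smul_apply, smul_eq_mul, Finset.mul_sum]
  refine Finset.sum_congr rfl fun j _ => ?_
  have h : (fun t => a j t * (c * u t)) = fun t => c * (a j t * u t) :=
    funext fun t => mul_left_comm _ _ _
  rw [h, iteratedDeriv_const_mul_field]
  ring

/-- The formal transpose as a linear map of test functions. -/
def transposeLin (k : ℕ) (a : ℕ → ℝ → ℂ) (ha : ∀ j, ContDiff ℝ ∞ (a j)) : TestFn →ₗ[ℂ] TestFn where
  toFun := transposeTest k a ha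
  map_add' φ ψ := by
    ext x
    exact congrFun (transposeOp_add k ha φ.smooth ψ.smooth) x
  map_smul' c φ := by
    ext x
    exact congrFun (transposeOp_smul k a c φ) x

theorem transposeLin_apply (k : ℕ) (a : ℕ → ℝ → ℂ) (ha) (φ : TestFn) :
    transposeLin k a ha φ = transposeTest k a ha φ := rfl

theorem coe_transposeLin (k : ℕ) (a : ℕ → ℝ → ℂ) (ha) (φ : TestFn) :
    ⇑(transposeLin k a ha φ) = transposeOp k a φ := rfl

theorem integral_mul_transposeOp (k : ℕ) {a : ℕ → ℝ → ℂ} (ha : ∀ j, ContDiff ℝ ∞ (a j))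
    {u : ℝ → ℂ} (hu : ContDiff ℝ ∞ u) (φ : TestFn) :
    ∫ x, u x * transposeOp k a φ x = ∫ x, diffOp k a u x * φ x := by
  simp only [transposeOp, diffOp, Finset.mul_sum, Finset.sum_mul]
  have h : ∀ j, ⇑(TestFn.smoothMul (a j) (ha j) φ) = fun t => a j t * φ t := fun j => rfl
  rw [integral_finsetSum, integral_finsetSum]
  · refine Finset.sum_congr rfl fun j _ => ?_
    simp_rw [mul_left_comm (u _) ((-1 : ℂ) ^ j)]
    rw [integral_const_mul, ← h, integral_mul_iteratedDeriv_testFn hu, ← mul_assoc, ← mul_pow]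
    simp only [mul_neg, mul_one, neg_neg, one_pow, one_mul, h]
    exact integral_congr_ae (.of_forall fun x => by simp only; ring)
  · intro j _
    exact LocInt.integrable_mul ((ha j).continuous.mul
      (continuous_iteratedDeriv_of_smooth hu j)).locallyIntegrable φ
  · intro j _
    have := LocInt.integrable_mul hu.continuous.locallyIntegrable
      (TestFn.iterDeriv j (TestFn.smoothMul (a j) (ha j) φ))
    rw [TestFn.coe_iterDeriv, h] at this
    refine (this.const_mul ((-1) ^ j)).congr (.of_forall fun x => by simp only; ring)

/-! ### Primitives and the lemma of du Bois-Reymond -/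

/-- Integration by parts for the primitive of an integrable function. -/
theorem integral_mul_eq_sub_primitive {a b : ℝ} (hab : a ≤ b) {f F g g' : ℝ → ℂ}
    (hf : IntegrableOn f (Ioc a b)) (hF : ∀ x ∈ Icc a b, F x = F a + ∫ t in a..x, f t)
    (hg : ∀ x, HasDerivAt g (g' x) x) (hg' : Continuous g') :
    ∫ x in Ioc a b, f x * g x =
      F b * g b - F a * g a - ∫ x in Ioc a b, F x * g' x := by
  have hgc : Continuous g := continuous_iff_continuousAt.2 fun x => (hg x).continuousAt
  have hg'i : IntegrableOn g' (Ioc a b) :=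
    (hg'.integrableOn_Icc (a := a) (b := b)).mono_set Ioc_subset_Icc_self
  set μ : Measure ℝ := volume.restrict (Ioc a b)
  -- `f` is only integrable, so its primitive need not be differentiable everywhere. The identity
  -- comes from Fubini for `f(t) g'(x)` on the triangle `t ≤ x`.
  have hprod : Integrable (fun z : ℝ × ℝ => (Iic z.1).indicator (fun t => f t * g' z.1) z.2)
      (μ.prod μ) := by
    have h1 : Integrable (fun z : ℝ × ℝ => g' z.1 * f z.2) (μ.prod μ) := hg'i.mul_prod hf
    have h2 := h1.indicator (s := {z : ℝ × ℝ | z.2 ≤ z.1})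
      (measurableSet_le measurable_snd measurable_fst)
    refine h2.congr (.of_forall fun z => ?_)
    simp only [indicator, mem_Iic, mem_ofPred_eq, mul_comm]
  have hswap := integral_integral_swap
    (f := fun x t => (Iic x).indicator (fun t => f t * g' x) t) hprod
  have e1 : ∀ x ∈ Ioc a b, ∫ t, (Iic x).indicator (fun t => f t * g' x) t ∂μ =
      (F x - F a) * g' x := by
    intro x hx
    rw [integral_indicator measurableSet_Iic, Measure.restrict_restrict measurableSet_Iic,
      hF x ⟨hx.1.le, hx.2⟩, add_sub_cancel_left, intervalIntegral.integral_of_le hx.1.le,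
      ← integral_mul_const]
    congr 2
    ext t
    simp only [mem_inter_iff, mem_Iic, mem_Ioc]
    exact ⟨fun h => ⟨h.2.1, h.1⟩, fun h => ⟨h.2, h.1, h.2.trans hx.2⟩⟩
  have e2 : ∀ t ∈ Ioc a b, ∫ x, (Iic x).indicator (fun t => f t * g' x) t ∂μ =
      f t * (g b - g t) := by
    intro t ht
    have : ∀ x, (Iic x).indicator (fun t => f t * g' x) t =
        (Ici t).indicator (fun x => f t * g' x) x := fun x => by
      simp [indicator, mem_Iic, mem_Ici]
    simp_rw [this]
    rw [integral_indicator measurableSet_Ici, Measure.restrict_restrict measurableSet_Ici,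
      integral_const_mul]
    congr 1
    have hs : Ici t ∩ Ioc a b = Icc t b := by
      ext x
      simp only [mem_inter_iff, mem_Ici, mem_Ioc, mem_Icc]
      exact ⟨fun h => ⟨h.1, h.2.2⟩, fun h => ⟨h.1, ht.1.trans_le h.1, h.2⟩⟩
    rw [hs, integral_Icc_eq_integral_Ioc, ← intervalIntegral.integral_of_le ht.2]
    exact intervalIntegral.integral_eq_sub_of_hasDerivAt (fun x _ => hg x)
      (hg'.intervalIntegrable _ _)
  rw [setIntegral_congr_fun measurableSet_Ioc e1, setIntegral_congr_fun measurableSet_Ioc e2]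
    at hswap
  have hFc : ContinuousOn F (Icc a b) := by
    have h0 : IntegrableOn f (uIcc a b) := by
      rw [uIcc_of_le hab, integrableOn_Icc_iff_integrableOn_Ioc]
      exact hf
    have h := intervalIntegral.continuousOn_primitive_interval (a := a) (b := b) h0
    rw [uIcc_of_le hab] at h
    exact (continuousOn_const.add h).congr hF
  have i1 : IntegrableOn (fun x => F x * g' x) (Ioc a b) :=
    ((hFc.mul hg'.continuousOn).integrableOn_Icc).mono_set Ioc_subset_Icc_self
  have i2 : IntegrableOn (fun x => f x * g x) (Ioc a b) := by
    obtain ⟨C, hC⟩ := isCompact_Icc.exists_bound_of_continuousOn (s := Icc a b) hgc.continuousOn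
    exact hf.mul_bdd (c := C) hgc.aestronglyMeasurable
      ((ae_restrict_iff' measurableSet_Ioc).2 (.of_forall fun x hx => hC x ⟨hx.1.le, hx.2⟩))
  simp_rw [sub_mul, mul_sub] at hswap
  rw [integral_sub i1 (hg'i.const_mul _), integral_sub (hf.mul_const _) i2, integral_const_mul,
    integral_mul_const, ← intervalIntegral.integral_of_le hab (f := g'),
    intervalIntegral.integral_eq_sub_of_hasDerivAt (fun x _ => hg x)
      (hg'.intervalIntegrable _ _), ← intervalIntegral.integral_of_le hab (f := f)] at hswap
  have hFb := hF b ⟨hab, le_rfl⟩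
  rw [hFb]
  linear_combination hswap

/-- An interval containing the support of a test function. -/
theorem TestFn.exists_Ioo (φ : TestFn) : ∃ M > 0, tsupport φ ⊆ Ioo (-M) M := by
  obtain ⟨M, hM⟩ := φ.hasCompactSupport.isBounded.subset_ball 0
  refine ⟨max M 1, by positivity, fun x hx => ?_⟩
  have h1 := hM hx
  rw [Real.ball_eq_Ioo] at h1
  have := le_max_left M 1
  exact ⟨by linarith [h1.1], by linarith [h1.2]⟩

theorem TestFn.integral_eq {φ : TestFn} {s : Set ℝ} (h : tsupport φ ⊆ s) (u : ℝ → ℂ) :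
    ∫ x in s, u x * φ x = ∫ x, u x * φ x :=
  setIntegral_eq_integral_of_forall_compl_eq_zero fun x hx => by
    rw [image_eq_zero_of_notMem_tsupport fun h' => hx (h h'), mul_zero]

theorem TestFn.deriv_eq (φ : TestFn) : deriv φ = ⇑(iterDeriv 1 φ) := by
  rw [coe_iterDeriv, iteratedDeriv_one]

/-- The primitive of a function that vanishes at `a`. -/
def prim (a : ℝ) (f : ℝ → ℂ) (x : ℝ) : ℂ := ∫ t in a..x, f t

theorem LocInt.intervalIntegrable {f : ℝ → ℂ} (hf : LocallyIntegrable f) (a b : ℝ) :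
    IntervalIntegrable f volume a b :=
  ((locallyIntegrable_iff.1 hf) _ isCompact_uIcc).intervalIntegrable

theorem continuous_prim (a : ℝ) {f : ℝ → ℂ} (hf : LocallyIntegrable f) : Continuous (prim a f) :=
  intervalIntegral.continuous_primitive (LocInt.intervalIntegrable hf) a

theorem integral_mul_testFn_eq_prim (a : ℝ) {f : ℝ → ℂ} (hf : LocallyIntegrable f) (c : ℂ)
    (φ : TestFn) :
    ∫ x, (c + prim a f x) * deriv φ x = -∫ x, f x * φ x := by
  obtain ⟨M, hM, hs⟩ := φ.exists_Ioo
  have hs' : tsupport φ ⊆ Ioc (-M) M := hs.trans Ioo_subset_Ioc_self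
  have hd : Continuous (deriv φ) := by rw [φ.deriv_eq]; exact (TestFn.iterDeriv 1 φ).continuous
  have h := integral_mul_eq_sub_primitive (a := -M) (b := M) (by linarith) (f := f)
    (F := fun x => c + prim a f x) (g := φ) (g' := deriv φ)
    ((LocInt.intervalIntegrable hf _ _).1)
    (fun x _ => by
      simp only [prim]
      rw [add_assoc, intervalIntegral.integral_add_adjacent_intervals
        (LocInt.intervalIntegrable hf _ _) (LocInt.intervalIntegrable hf _ _)])
    (fun x => (φ.differentiable x).hasDerivAt) hd
  have z1 : φ M = 0 := image_eq_zero_of_notMem_tsupport fun h' => by simpa using hs h'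
  have z2 : φ (-M) = 0 := image_eq_zero_of_notMem_tsupport fun h' => by simpa using hs h'
  rw [φ.deriv_eq] at h ⊢
  rw [TestFn.integral_eq hs', z1, z2,
    TestFn.integral_eq ((TestFn.tsupport_iterDeriv 1 φ).trans hs')] at h
  rw [h]
  ring

/-- A test function of vanishing integral has a primitive that is a test function. -/
theorem TestFn.exists_primitive {Ω : Set ℝ} (hΩ : Ω.OrdConnected) (g : TestFn)
    (hg : tsupport g ⊆ Ω) (h0 : ∫ x, g x = 0) :
    ∃ ζ : TestFn, tsupport ζ ⊆ Ω ∧ deriv ζ = g := by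
  rcases (tsupport g).eq_empty_or_nonempty with he | hne
  · have : (g : ℝ → ℂ) = 0 := tsupport_eq_empty_iff.1 he
    refine ⟨0, by simp, ?_⟩
    ext x
    simp [this]
  have hK : IsCompact (tsupport g) := g.hasCompactSupport
  -- With the end points of the support as base points, the primitive lives on `[a, b]`, which lies
  -- in `Ω` by order connectedness.
  set a := sInf (tsupport g)
  set b := sSup (tsupport g)
  have ha : a ∈ tsupport g := hK.sInf_mem hne
  have hb : b ∈ tsupport g := hK.sSup_mem hne
  have hab : tsupport g ⊆ Icc a b := fun x hx =>
    ⟨csInf_le hK.bddBelow hx, le_csSup hK.bddAbove hx⟩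
  have hgz : ∀ x, x ∉ Icc a b → g x = 0 := fun x hx =>
    image_eq_zero_of_notMem_tsupport fun h => hx (hab h)
  set F : ℝ → ℂ := fun x => ∫ t in a..x, g t
  have hF : ∀ x, HasDerivAt F (g x) x := fun x => g.continuous.integral_hasStrictDerivAt a x
    |>.hasDerivAt
  have hdF : deriv F = g := funext fun x => (hF x).deriv
  have hsm : ContDiff ℝ ∞ F := contDiff_infty_iff_deriv.2
    ⟨fun x => (hF x).differentiableAt, by rw [hdF]; exact g.smooth⟩
  have hsupp : tsupport F ⊆ Icc a b := by
    refine closure_minimal (fun x hx => ?_) isClosed_Icc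
    by_contra hxx
    refine hx ?_
    rcases lt_or_ge x a with h | h
    · refine intervalIntegral.integral_zero_ae ?_
      have : ∀ᵐ t : ℝ, t ≠ a := by simp [ae_iff]
      filter_upwards [this] with t ht hmem
      rw [uIoc_of_ge h.le] at hmem
      exact hgz t fun h' => ht (le_antisymm hmem.2 h'.1)
    -- To the right of the support the primitive equals the total integral, which is zero.
    · have hbx : b < x := by
        by_contra h'
        exact hxx ⟨h, not_lt.1 h'⟩
      change ∫ t in a..x, g t = 0
      rw [intervalIntegral.integral_of_le h, ← integral_Icc_eq_integral_Ioc, ← h0]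
      exact setIntegral_eq_integral_of_forall_compl_eq_zero fun t ht =>
        hgz t fun h' => ht ⟨h'.1, h'.2.trans hbx.le⟩
  refine ⟨mkSmooth F hsm (isCompact_Icc.of_isClosed_subset (isClosed_tsupport _) hsupp),
    hsupp.trans (hΩ.out (hg ha) (hg hb)), hdF⟩

theorem TestFn.exists_integral_eq_one {Ω : Set ℝ} (hΩ : IsOpen Ω) (hne : Ω.Nonempty) :
    ∃ θ : TestFn, tsupport θ ⊆ Ω ∧ ∫ x, θ x = 1 := by
  obtain ⟨x, hx⟩ := hne
  obtain ⟨r, hr, hball⟩ := Metric.isOpen_iff.1 hΩ x hx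
  let b : ContDiffBump x := ⟨r / 3, r / 2, by linarith, by linarith⟩
  have hs : tsupport (fun y => ((b.normed volume y : ℝ) : ℂ)) ⊆ Metric.closedBall x (r / 2) := by
    refine (tsupport_comp_subset (g := fun z : ℝ => (z : ℂ)) Complex.ofReal_zero _).trans ?_
    rw [b.tsupport_normed_eq]
  refine ⟨mkSmooth (fun y => ((b.normed volume y : ℝ) : ℂ))
    (contDiff_ofReal_comp b.contDiff_normed)
    ((isCompact_closedBall _ _).of_isClosed_subset (isClosed_tsupport _) hs),
    hs.trans ((Metric.closedBall_subset_ball (by linarith)).trans hball), ?_⟩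
  change ∫ y, ((b.normed volume y : ℝ) : ℂ) = 1
  exact (integral_ofReal (𝕜 := ℂ) (f := b.normed volume)).trans
    ((congrArg Complex.ofReal b.integral_normed).trans Complex.ofReal_one)

theorem LocInt.sub {f g : ℝ → ℂ} (hf : LocallyIntegrable f) (hg : LocallyIntegrable g) :
    LocallyIntegrable (fun x => f x - g x) := LocallyIntegrable.sub hf hg

theorem contDiff_ofReal_pow (c : ℂ) (j : ℕ) : ContDiff ℝ ∞ (fun x : ℝ => c * (x : ℂ) ^ j) :=
  contDiff_const.mul (Complex.ofRealCLM.contDiff.pow j)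

theorem iteratedDeriv_ofReal_pow_self (j : ℕ) (x : ℝ) :
    iteratedDeriv j (fun x : ℝ => (x : ℂ) ^ j) x = (j.factorial : ℂ) := by
  induction j generalizing x with
  | zero => simp
  | succ j ih =>
    have hd : deriv (fun x : ℝ => (x : ℂ) ^ (j + 1)) = fun x : ℝ => ((j : ℂ) + 1) * (x : ℂ) ^ j := by
      ext y
      have := (Complex.ofRealCLM.hasDerivAt (x := y)).pow (j + 1)
      simp only [Complex.ofRealCLM_apply] at this
      rw [show (fun x : ℝ => (x : ℂ) ^ (j + 1)) = (⇑Complex.ofRealCLM) ^ (j + 1) from rfl,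
        this.deriv]
      push_cast
      ring
    rw [iteratedDeriv_succ', hd, iteratedDeriv_const_mul_field, ih, Nat.factorial_succ]
    push_cast
    ring

theorem ae_eq_zero_of_integral_testFn {Ω : Set ℝ} (hΩ : IsOpen Ω) {w : ℝ → ℂ}
    (hw : LocallyIntegrable w) (h : ∀ φ : TestFn, tsupport φ ⊆ Ω → ∫ x, w x * φ x = 0) :
    ∀ᵐ x, x ∈ Ω → w x = 0 := by
  refine hΩ.ae_eq_zero_of_integral_contDiff_smul_eq_zero (hw.locallyIntegrableOn _) ?_
  intro g hg hgc hgs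
  have := h (TestFn.mkSmooth (fun x => (g x : ℂ)) (contDiff_ofReal_comp hg)
    (hgc.comp_left (g := fun z : ℝ => (z : ℂ)) Complex.ofReal_zero))
    ((tsupport_comp_subset (g := fun z : ℝ => (z : ℂ)) Complex.ofReal_zero _).trans hgs)
  rw [← this]
  exact integral_congr_ae (.of_forall fun x => by simp [mul_comm])

/-- The lemma of du Bois-Reymond: a function whose weak derivative of order `N` vanishes on an
open interval is a polynomial of degree less than `N` there. -/
theorem ae_eq_polynomial_of_iteratedDeriv {Ω : Set ℝ} (hΩ : IsOpen Ω) (hΩ' : Ω.OrdConnected)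
    (hne : Ω.Nonempty) (N : ℕ) {w : ℝ → ℂ} (hw : LocallyIntegrable w)
    (h : ∀ φ : TestFn, tsupport φ ⊆ Ω → ∫ x, w x * iteratedDeriv N φ x = 0) :
    ∃ c : ℕ → ℂ, ∀ᵐ x : ℝ, x ∈ Ω → w x = ∑ j ∈ Finset.range N, c j * (x : ℂ) ^ j := by
  induction N generalizing w with
  | zero =>
    refine ⟨0, ?_⟩
    simpa using ae_eq_zero_of_integral_testFn hΩ hw (by simpa using h)
  | succ N ih =>
    obtain ⟨θ, hθ, hθ1⟩ := TestFn.exists_integral_eq_one hΩ hne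
    set c := ∫ x, w x * iteratedDeriv N θ x
    -- `ψ - (∫ ψ) θ` has integral zero, so it is the derivative of a test function in `Ω`; therefore
    -- the weak derivative of order `N` of `w` acts as the constant `c`.
    have key : ∀ ψ : TestFn, tsupport ψ ⊆ Ω →
        ∫ x, w x * iteratedDeriv N ψ x = c * ∫ x, ψ x := by
      intro ψ hψ
      set I := ∫ x, ψ x
      obtain ⟨ζ, hζ, hζ'⟩ := TestFn.exists_primitive hΩ' (ψ - I • θ)
        ((tsupport_sub _ _).trans (union_subset hψ
          ((tsupport_smul_subset_right (fun _ => I) θ).trans hθ)))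
        (by
          have : ∀ x, (ψ - I • θ) x = ψ x - I * θ x := fun x => by simp
          simp_rw [this]
          rw [integral_sub (ψ.integrable _) ((θ.integrable _).const_mul _), integral_const_mul,
            hθ1]
          simp [I])
      have h1 := h ζ hζ
      rw [iteratedDeriv_succ', hζ'] at h1
      have h2 : ∀ x, iteratedDeriv N (ψ - I • θ : TestFn) x =
          iteratedDeriv N ψ x - I * iteratedDeriv N θ x := by
        intro x
        have : ((ψ - I • θ : TestFn) : ℝ → ℂ) = (ψ : ℝ → ℂ) - I • (θ : ℝ → ℂ) := by ext; simp
        rw [this, iteratedDeriv_sub (g := I • (θ : ℝ → ℂ))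
          (ψ.smooth.of_le (by exact_mod_cast le_top)).contDiffAt
          ((θ.smooth.const_smul I).of_le (by exact_mod_cast le_top)).contDiffAt,
          iteratedDeriv_const_smul_field, smul_eq_mul]
      simp_rw [h2, mul_sub, mul_left_comm _ I] at h1
      rw [integral_sub (LocInt.integrable_mul_iteratedDeriv hw ψ N)
        ((LocInt.integrable_mul_iteratedDeriv hw θ N).const_mul I), integral_const_mul,
        sub_eq_zero] at h1
      rw [h1, mul_comm]
    -- Chosen so that the derivative of order `N` of `d x^N` is `(-1)^N c`; subtracting it leaves a
    -- function for the induction hypothesis.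
    set d : ℂ := (-1) ^ N * c / N.factorial
    have hp : LocallyIntegrable (fun x : ℝ => d * (x : ℂ) ^ N) :=
      (contDiff_ofReal_pow d N).continuous.locallyIntegrable
    obtain ⟨c', hc'⟩ := ih (w := fun x => w x - d * (x : ℂ) ^ N) (LocInt.sub hw hp) (by
      intro φ hφ
      simp_rw [sub_mul]
      rw [integral_sub (LocInt.integrable_mul_iteratedDeriv hw φ N)
        (LocInt.integrable_mul_iteratedDeriv hp φ N), key φ hφ,
        integral_mul_iteratedDeriv_testFn (contDiff_ofReal_pow d N)]
      have : ∀ x, iteratedDeriv N (fun x : ℝ => d * (x : ℂ) ^ N) x = (-1) ^ N * c := by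
        intro x
        rw [iteratedDeriv_const_mul_field, iteratedDeriv_ofReal_pow_self]
        have : (N.factorial : ℂ) ≠ 0 := by exact_mod_cast N.factorial_ne_zero
        simp only [d]
        field_simp
      simp_rw [this]
      rw [integral_const_mul, ← mul_assoc, ← mul_assoc, ← mul_pow]
      simp)
    refine ⟨Function.update c' N d, ?_⟩
    filter_upwards [hc'] with x hx hxΩ
    rw [Finset.sum_range_succ, Function.update_self,
      Finset.sum_congr rfl (g := fun j => c' j * (x : ℂ) ^ j),
      ← hx hxΩ]
    · ring
    · intro j hj
      rw [Function.update_of_ne (Finset.mem_range.1 hj).ne]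

theorem contDiff_polynomial (c : ℕ → ℂ) (N : ℕ) :
    ContDiff ℝ ∞ (fun x : ℝ => ∑ j ∈ Finset.range N, c j * (x : ℂ) ^ j) :=
  ContDiff.sum fun j _ => contDiff_ofReal_pow (c j) j

/-! ### Iterated primitives and regularity of weak solutions -/

theorem hasDerivAt_prim (a : ℝ) {f : ℝ → ℂ} (hf : Continuous f) (x : ℝ) :
    HasDerivAt (prim a f) (f x) x := (hf.integral_hasStrictDerivAt a x).hasDerivAt

theorem deriv_prim (a : ℝ) {f : ℝ → ℂ} (hf : Continuous f) : deriv (prim a f) = f :=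
  funext fun x => (hasDerivAt_prim a hf x).deriv

theorem contDiff_prim (a : ℝ) {f : ℝ → ℂ} {k : ℕ} (hf : ContDiff ℝ k f) :
    ContDiff ℝ (k + 1 : ℕ) (prim a f) := by
  rw [Nat.cast_add, Nat.cast_one, contDiff_succ_iff_deriv]
  refine ⟨fun x => (hasDerivAt_prim a hf.continuous x).differentiableAt, by simp, ?_⟩
  rwa [deriv_prim a hf.continuous]

theorem contDiff_iterate_prim (a : ℝ) {f : ℝ → ℂ} {k : ℕ} (hf : ContDiff ℝ k f) (i : ℕ) :
    ContDiff ℝ k ((prim a)^[i] f) := by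
  induction i with
  | zero => exact hf
  | succ i ih =>
    rw [Function.iterate_succ_apply']
    exact (contDiff_prim a ih).of_le (by exact_mod_cast k.le_succ)

theorem contDiff_iterate_succ_prim (a : ℝ) {f : ℝ → ℂ} {k : ℕ} (hf : ContDiff ℝ k f) (i : ℕ) :
    ContDiff ℝ (k + 1 : ℕ) ((prim a)^[i + 1] f) := by
  rw [Function.iterate_succ_apply]
  exact contDiff_iterate_prim a (contDiff_prim a hf) i

theorem contDiff_infty_iterate_prim (a : ℝ) {f : ℝ → ℂ} (hf : ContDiff ℝ ∞ f) (i : ℕ) :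
    ContDiff ℝ ∞ ((prim a)^[i] f) :=
  contDiff_infty.2 fun k => contDiff_iterate_prim a (contDiff_infty.1 hf k) i

theorem LocInt.iterate_prim (a : ℝ) {f : ℝ → ℂ} (hf : LocallyIntegrable f) (i : ℕ) :
    LocallyIntegrable ((prim a)^[i] f) := by
  induction i with
  | zero => exact hf
  | succ i ih =>
    rw [Function.iterate_succ_apply']
    exact (continuous_prim a ih).locallyIntegrable

/-- Each primitive taken of `f` costs one more derivative of the test function. This brings terms of
different orders to one common order, where the lemma of du Bois-Reymond applies. -/
theorem integral_mul_iteratedDeriv_eq_iterate_prim (a : ℝ) {f : ℝ → ℂ}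
    (hf : LocallyIntegrable f) (φ : TestFn) (i j : ℕ) :
    ∫ x, f x * iteratedDeriv j φ x =
      (-1) ^ i * ∫ x, (prim a)^[i] f x * iteratedDeriv (j + i) φ x := by
  induction i with
  | zero => simp
  | succ i ih =>
    have h := integral_mul_testFn_eq_prim a (LocInt.iterate_prim a hf i) 0
      (TestFn.iterDeriv (j + i) φ)
    simp only [zero_add] at h
    rw [ih, Function.iterate_succ_apply', ← add_assoc, iteratedDeriv_succ, ← TestFn.coe_iterDeriv,
      h]
    ring

theorem LocInt.mul_continuous {f g : ℝ → ℂ} (hf : LocallyIntegrable f) (hg : Continuous g) :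
    LocallyIntegrable (fun x => f x * g x) := by
  simpa only [smul_eq_mul, mul_comm, locallyIntegrableOn_univ] using
    (hf.locallyIntegrableOn univ).continuousOn_smul isOpen_univ.isLocallyClosed hg.continuousOn

theorem prim_congr_ae (a : ℝ) {f g : ℝ → ℂ} (h : f =ᵐ[volume] g) : prim a f = prim a g :=
  funext fun _ => intervalIntegral.integral_congr_ae (h.mono fun _ hx _ => hx)

theorem contDiff_infty_of_succ {v : ℝ → ℂ} (h0 : Continuous v)
    (h : ∀ k : ℕ, ContDiff ℝ k v → ContDiff ℝ (k + 1 : ℕ) v) : ContDiff ℝ ∞ v := by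
  refine contDiff_infty.2 fun k => ?_
  induction k with
  | zero => exact contDiff_zero.2 h0
  | succ k ih => exact h k ih

theorem smooth_of_nat {v : ℝ → ℂ} (h : ContDiff ℝ ∞ v) (k : ℕ) : ContDiff ℝ k v :=
  contDiff_infty.1 h k

theorem transposeOp_mul (k : ℕ) (a : ℕ → ℝ → ℂ) (r u : ℝ → ℂ) :
    transposeOp k a (fun x => r x * u x) = transposeOp k (fun j x => a j x * r x) u := by
  ext x
  simp only [transposeOp, mul_assoc]

theorem eq_of_integral_testFn {f g : ℝ → ℂ} (hf : Continuous f) (hg : Continuous g)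
    (h : ∀ φ : TestFn, ∫ x, f x * φ x = ∫ x, g x * φ x) : f = g := by
  have h0 := ae_eq_zero_of_integral_testFn (Ω := univ) isOpen_univ (w := fun x => f x - g x)
    (hf.sub hg).locallyIntegrable (fun φ _ => by
      simp_rw [sub_mul]
      rw [integral_sub (LocInt.integrable_mul hf.locallyIntegrable φ)
        (LocInt.integrable_mul hg.locallyIntegrable φ), h φ, sub_self])
  refine Continuous.ae_eq_iff_eq (μ := volume) hf hg |>.1 ?_
  filter_upwards [h0] with x hx
  exact sub_eq_zero.1 (hx (mem_univ x))

/-- A weak solution of an ordinary differential equation with smooth coefficients, nonvanishing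
leading coefficient and smooth right-hand side is smooth. -/
theorem exists_smooth_of_weak_solution (n : ℕ) {q : ℕ → ℝ → ℂ} (hq : ∀ j, ContDiff ℝ ∞ (q j))
    (hqn : ∀ x, q n x ≠ 0) {v g : ℝ → ℂ} (hv : LocallyIntegrable v) (hg : ContDiff ℝ ∞ g)
    (h : ∀ ζ : TestFn, ∫ x, v x * transposeOp n q ζ x = ∫ x, g x * ζ x) :
    ∃ u : ℝ → ℂ, ContDiff ℝ ∞ u ∧ v =ᵐ[volume] u ∧ ∀ x, diffOp n q u x = g x := by
  -- Testing with `r θ` instead of `θ` normalises the leading coefficient of the transpose to `1`.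
  set r : ℝ → ℂ := fun x => (-1) ^ n * (q n x)⁻¹
  have hr : ContDiff ℝ ∞ r := contDiff_const.mul ((hq n).inv hqn)
  obtain ⟨b, hb, hbn, hbt⟩ := exists_transposeOp_eq_diffOp n (a := fun j x => q j x * r x)
    (fun j => (hq j).mul hr)
  replace hbn : ∀ x, b n x = 1 := fun x => by
    rw [hbn]
    simp only [r]
    have := hqn x
    field_simp
    rw [← pow_mul, mul_comm, pow_mul]
    simp
  have hvb : ∀ j, LocallyIntegrable (fun x => v x * b j x) := fun j =>
    LocInt.mul_continuous hv (hb j).continuous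
  have hgr : ContDiff ℝ ∞ (fun x => g x * r x) := hg.mul hr
  have heq : ∀ θ : TestFn, ∑ j ∈ Finset.range (n + 1), ∫ x, (v x * b j x) * iteratedDeriv j θ x =
      ∫ x, (g x * r x) * θ x := by
    intro θ
    have h1 := h (TestFn.smoothMul r hr θ)
    rw [TestFn.coe_smoothMul, transposeOp_mul, hbt θ θ.smooth] at h1
    simp only [diffOp, Finset.mul_sum, ← mul_assoc] at h1
    rwa [integral_finsetSum _ fun j _ =>
      LocInt.integrable_mul_iteratedDeriv (hvb j) θ j] at h1
  set A : ℕ → ℝ → ℂ := fun j => (prim 0)^[n - j] (fun x => v x * b j x)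
  set B : ℝ → ℂ := (prim 0)^[n] (fun x => g x * r x)
  have hA : ∀ j, LocallyIntegrable (A j) := fun j => LocInt.iterate_prim 0 (hvb j) _
  have hBs : ContDiff ℝ ∞ B := contDiff_infty_iterate_prim 0 hgr n
  have hB : LocallyIntegrable B := hBs.continuous.locallyIntegrable
  -- Integrating the term of order `j` another `n - j` times puts `θ^{(n)}` on every term, so `w` is
  -- a polynomial. Its summand `j = n` is `v` itself; solving for it gives the candidate `u`.
  set w : ℝ → ℂ := fun x => (∑ j ∈ Finset.range (n + 1), (-1) ^ (n - j) * A j x) - (-1) ^ n * B x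
  have hwA : LocallyIntegrable (fun x => ∑ j ∈ Finset.range (n + 1), (-1) ^ (n - j) * A j x) :=
    locallyIntegrable_finsetSum _ fun j _ => (hA j).smul ((-1 : ℂ) ^ (n - j))
  have hwB : LocallyIntegrable (fun x => (-1) ^ n * B x) := hB.smul ((-1 : ℂ) ^ n)
  obtain ⟨c, hc⟩ := ae_eq_polynomial_of_iteratedDeriv isOpen_univ ordConnected_univ
    univ_nonempty n (w := w) (LocInt.sub hwA hwB) (by
      intro θ _
      simp only [w, sub_mul]
      rw [integral_sub (LocInt.integrable_mul_iteratedDeriv hwA θ n)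
        (LocInt.integrable_mul_iteratedDeriv hwB θ n)]
      simp only [Finset.sum_mul, mul_assoc]
      rw [integral_finsetSum _ fun j _ =>
        (LocInt.integrable_mul_iteratedDeriv (hA j) θ n).const_mul _, integral_const_mul]
      have h2 := integral_mul_iteratedDeriv_eq_iterate_prim 0 hgr.continuous.locallyIntegrable θ n 0
      rw [zero_add, iteratedDeriv_zero, ← heq θ] at h2
      rw [← h2, sub_eq_zero]
      refine Finset.sum_congr rfl fun j hj => ?_
      have hj' : j + (n - j) = n := by
        have := Finset.mem_range.1 hj
        omega
      rw [integral_const_mul, integral_mul_iteratedDeriv_eq_iterate_prim 0 (hvb j) θ (n - j) j, hj'])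
  set u : ℝ → ℂ := fun x => (∑ j ∈ Finset.range n, c j * (x : ℂ) ^ j) + (-1) ^ n * B x -
    ∑ j ∈ Finset.range n, (-1) ^ (n - j) * A j x
  have huv : v =ᵐ[volume] u := by
    filter_upwards [hc] with x hx
    have := hx (mem_univ x)
    simp only [w, Finset.sum_range_succ, Nat.sub_self, pow_zero, one_mul] at this
    have hAn : A n x = v x := by simp [A, hbn]
    rw [hAn] at this
    simp only [u, ← this]
    ring
  have hu0 : Continuous u := by
    refine ((contDiff_polynomial c n).continuous.add (continuous_const.mul hBs.continuous)).sub
      (continuous_finsetSum _ fun j hj => continuous_const.mul ?_)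
    have : n - j = (n - j - 1) + 1 := by
      have := Finset.mem_range.1 hj
      omega
    simp only [A]
    rw [this, Function.iterate_succ_apply']
    exact continuous_prim 0 (LocInt.iterate_prim 0 (hvb j) _)
  -- Primitives ignore null sets, so `v` may be replaced by `u` under them. Then `u` is expressed
  -- through primitives of itself and gains one derivative per round.
  have hAu : ∀ j ∈ Finset.range n, A j = (prim 0)^[n - j] (fun x => u x * b j x) := by
    intro j hj
    have : n - j = (n - j - 1) + 1 := by
      have := Finset.mem_range.1 hj
      omega
    simp only [A]
    rw [this, Function.iterate_succ_apply, Function.iterate_succ_apply,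
      prim_congr_ae 0 (huv.mono fun x hx => by rw [hx])]
  have hus : ContDiff ℝ ∞ u := by
    refine contDiff_infty_of_succ hu0 fun k hk => ?_
    refine ((smooth_of_nat (contDiff_polynomial c n) _).add
      (contDiff_const.mul (smooth_of_nat hBs _))).sub (ContDiff.sum fun j hj => contDiff_const.mul ?_)
    have : n - j = (n - j - 1) + 1 := by
      have := Finset.mem_range.1 hj
      omega
    rw [hAu j hj, this]
    exact contDiff_iterate_succ_prim 0 (hk.mul (smooth_of_nat (hb j) k)) _
  refine ⟨u, hus, huv, congrFun (eq_of_integral_testFn (contDiff_diffOp n hq hus).continuous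
    hg.continuous fun φ => ?_)⟩
  rw [← integral_mul_transposeOp n hq hus, ← h φ]
  exact integral_congr_ae (huv.mono fun x hx => by simp only [hx])

/-! ### Linear Volterra equations and the Cauchy problem -/

/-- A linear Volterra operator with base point `x₀` on continuous functions, with a constant that
is uniform on bounded intervals. -/
structure IsVolterra (x₀ : ℝ) (K : (ℝ → ℂ) → ℝ → ℂ) : Prop where
  cont : ∀ v, Continuous v → Continuous (K v)
  add : ∀ v w, Continuous v → Continuous w → K (v + w) = K v + K w
  bound : ∀ T : ℝ, ∃ C, 0 ≤ C ∧ ∀ v, Continuous v → ∀ x, |x - x₀| ≤ T →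
    ‖K v x‖ ≤ C * ∫ t in uIoc x₀ x, ‖v t‖

theorem abs_sub_le_of_mem_uIoc {x₀ x t : ℝ} (h : t ∈ uIoc x₀ x) : |t - x₀| ≤ |x - x₀| := by
  have h' := uIoc_subset_uIcc h
  rw [abs_sub_comm t, abs_sub_comm x]
  rcases le_total x₀ x with hx | hx
  · rw [uIcc_of_le hx] at h'
    rw [abs_of_nonpos (by linarith [h'.1]), abs_of_nonpos (by linarith)]
    linarith [h'.2]
  · rw [uIcc_of_ge hx] at h'
    rw [abs_of_nonneg (by linarith [h'.2]), abs_of_nonneg (by linarith)]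
    linarith [h'.1]

theorem integrableOn_uIoc {f : ℝ → ℝ} (hf : Continuous f) (a b : ℝ) : IntegrableOn f (uIoc a b) :=
  (intervalIntegrable_iff.1 (hf.intervalIntegrable a b))

theorem IsVolterra.cont_iterate {x₀ : ℝ} {K : (ℝ → ℂ) → ℝ → ℂ} (hK : IsVolterra x₀ K)
    {v : ℝ → ℂ} (hv : Continuous v) (l : ℕ) : Continuous (K^[l] v) := by
  induction l with
  | zero => exact hv
  | succ l ih => rw [Function.iterate_succ_apply']; exact hK.cont _ ih

/-- The factorial estimate for the iterates of a Volterra operator. -/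
theorem IsVolterra.norm_iterate_le {x₀ : ℝ} {K : (ℝ → ℂ) → ℝ → ℂ} (hK : IsVolterra x₀ K)
    {T C : ℝ} (hC : 0 ≤ C) (hb : ∀ v, Continuous v → ∀ x, |x - x₀| ≤ T →
      ‖K v x‖ ≤ C * ∫ t in uIoc x₀ x, ‖v t‖) {v : ℝ → ℂ} (hv : Continuous v) {M : ℝ}
    (hM : ∀ x, |x - x₀| ≤ T → ‖v x‖ ≤ M) (l : ℕ) :
    ∀ x, |x - x₀| ≤ T → ‖K^[l] v x‖ ≤ M * ((C * |x - x₀|) ^ l / l.factorial) := by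
  induction l with
  | zero => intro x hx; simpa using hM x hx
  | succ l ih =>
    intro x hx
    rw [Function.iterate_succ_apply']
    refine (hb _ (hK.cont_iterate hv l) x hx).trans ?_
    have h1 : ∫ t in uIoc x₀ x, ‖K^[l] v t‖ ≤
        ∫ t in uIoc x₀ x, M * C ^ l / l.factorial * |t - x₀| ^ l := by
      refine setIntegral_mono_on (integrableOn_uIoc (hK.cont_iterate hv l).norm _ _)
        (integrableOn_uIoc (by fun_prop) _ _) measurableSet_uIoc fun t ht => ?_
      refine (ih t ((abs_sub_le_of_mem_uIoc ht).trans hx)).trans_eq ?_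
      rw [mul_pow]
      ring
    rw [integral_const_mul, integral_pow_abs_sub_uIoc] at h1
    refine (mul_le_mul_of_nonneg_left h1 hC).trans_eq ?_
    rw [Nat.factorial_succ]
    push_cast
    have : (l.factorial : ℝ) ≠ 0 := by exact_mod_cast l.factorial_ne_zero
    field_simp
    ring

theorem IsVolterra.map_zero {x₀ : ℝ} {K : (ℝ → ℂ) → ℝ → ℂ} (hK : IsVolterra x₀ K) : K 0 = 0 := by
  have := hK.add 0 0 continuous_zero continuous_zero
  rwa [add_zero, left_eq_add] at this

theorem IsVolterra.map_sub {x₀ : ℝ} {K : (ℝ → ℂ) → ℝ → ℂ} (hK : IsVolterra x₀ K)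
    {v w : ℝ → ℂ} (hv : Continuous v) (hw : Continuous w) : K (v - w) = K v - K w := by
  have := hK.add (v - w) w (hv.sub hw) hw
  rw [sub_add_cancel] at this
  rw [this, add_sub_cancel_right]

/-- Existence for a linear Volterra equation. -/
theorem IsVolterra.exists_eq {x₀ : ℝ} {K : (ℝ → ℂ) → ℝ → ℂ} (hK : IsVolterra x₀ K) {g : ℝ → ℂ}
    (hg : Continuous g) :
    ∃ v, Continuous v ∧ v = g + K v ∧ ∀ T C M : ℝ, 0 ≤ C → (∀ v, Continuous v → ∀ x,
      |x - x₀| ≤ T → ‖K v x‖ ≤ C * ∫ t in uIoc x₀ x, ‖v t‖) →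
      (∀ x, |x - x₀| ≤ T → ‖g x‖ ≤ M) →
      ∀ x, |x - x₀| ≤ T → ‖v x‖ ≤ M * Real.exp (C * T) := by
  -- The Neumann series; its terms are dominated on bounded intervals by those of an exponential
  -- series, which also yields the final bound.
  set v : ℝ → ℂ := fun x => ∑' l, K^[l] g x
  set S : ℕ → ℝ → ℂ := fun N x => ∑ l ∈ Finset.range N, K^[l] g x
  have hS : ∀ N, Continuous (S N) := fun N => continuous_finsetSum _ fun l _ =>
    hK.cont_iterate hg l
  have hSs : ∀ N, S (N + 1) = g + K (S N) := by
    intro N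
    induction N with
    | zero =>
      have h0 : S 0 = 0 := by ext x; simp [S]
      rw [h0, hK.map_zero]
      ext x
      simp [S]
    | succ N ih =>
      have h1 : S (N + 1) = S N + K^[N] g := by ext x; simp [S, Finset.sum_range_succ]
      have h2 : S (N + 2) = S (N + 1) + K^[N + 1] g := by
        ext x; simp [S, Finset.sum_range_succ]
      rw [h2, h1, hK.add _ _ (hS N) (hK.cont_iterate hg N), ← h1, ih,
        Function.iterate_succ_apply']
      ring
  have key : ∀ T C M : ℝ, 0 ≤ C → (∀ v, Continuous v → ∀ x,
      |x - x₀| ≤ T → ‖K v x‖ ≤ C * ∫ t in uIoc x₀ x, ‖v t‖) →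
      (∀ x, |x - x₀| ≤ T → ‖g x‖ ≤ M) → ∀ l x, |x - x₀| ≤ T →
      ‖K^[l] g x‖ ≤ M * ((C * T) ^ l / l.factorial) := by
    intro T C M hC hb hM l x hx
    refine (hK.norm_iterate_le hC hb hg hM l x hx).trans ?_
    have hM0 : 0 ≤ M := (norm_nonneg _).trans (hM x hx)
    gcongr
  have hunif : ∀ T, TendstoUniformlyOn S v Filter.atTop {x | |x - x₀| ≤ T} := by
    intro T
    obtain ⟨C, hC, hb⟩ := hK.bound T
    have hcpt : IsCompact {x | |x - x₀| ≤ T} := by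
      have : {x | |x - x₀| ≤ T} = Metric.closedBall x₀ T := by
        ext x; simp [Real.dist_eq]
      rw [this]
      exact isCompact_closedBall _ _
    obtain ⟨M, hM⟩ := hcpt.exists_bound_of_continuousOn hg.continuousOn
    exact tendstoUniformlyOn_tsum_nat ((Real.summable_pow_div_factorial (C * T)).mul_left M)
      fun l x hx => key T C M hC hb hM l x hx
  have hvc : Continuous v := by
    rw [continuous_iff_continuousAt]
    intro x
    refine ((hunif (|x - x₀| + 1)).continuousOn (.of_forall fun N =>
      (hS N).continuousOn)).continuousAt ?_
    have : Continuous fun y => |y - x₀| := by fun_prop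
    filter_upwards [this.continuousAt.eventually_lt (continuousAt_const (y := |x - x₀| + 1))
      (by linarith)] with y hy
    exact hy.le
  refine ⟨v, hvc, ?_, ?_⟩
  · ext x
    set T := |x - x₀|
    obtain ⟨C, hC, hb⟩ := hK.bound T
    have h1 : Filter.Tendsto (fun N => S (N + 1) x) Filter.atTop (nhds (v x)) :=
      ((hunif T).tendsto_at (x := x) (le_refl |x - x₀|)).comp (Filter.tendsto_add_atTop_nat 1)
    have h2 : Filter.Tendsto (fun N => S (N + 1) x) Filter.atTop (nhds ((g + K v) x)) := by
      simp_rw [hSs]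
      refine Filter.Tendsto.const_add _ ?_
      rw [Metric.tendsto_atTop]
      intro ε hε
      -- The `+ 1` covers the case `C * T = 0`.
      set δ := ε / (C * T + 1)
      have hT : 0 ≤ T := abs_nonneg _
      have hδ : 0 < δ := by positivity
      obtain ⟨N, hN⟩ := Filter.eventually_atTop.1
        (Metric.tendstoUniformlyOn_iff.1 (hunif T) δ hδ)
      refine ⟨N, fun k hk => ?_⟩
      rw [dist_eq_norm, ← Pi.sub_apply, ← hK.map_sub (hS k) hvc]
      refine (hb _ ((hS k).sub hvc) x le_rfl).trans_lt ?_
      have h3 : ∫ t in uIoc x₀ x, ‖(S k - v) t‖ ≤ ∫ t in uIoc x₀ x, δ := by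
        refine setIntegral_mono_on (integrableOn_uIoc ((hS k).sub hvc).norm _ _)
          (integrableOn_uIoc continuous_const _ _) measurableSet_uIoc fun t ht => ?_
        have := hN k hk t (abs_sub_le_of_mem_uIoc ht)
        rw [dist_comm, dist_eq_norm] at this
        exact this.le
      have h4 : ∫ t in uIoc x₀ x, δ = T * δ := by
        simp [T, Measure.real, uIoc, abs_sub_comm, max_sub_min_eq_abs]
      rw [h4] at h3
      calc C * _ ≤ C * (T * δ) := mul_le_mul_of_nonneg_left h3 hC
        _ = (C * T) * δ := by ring
        _ < (C * T + 1) * δ := by gcongr; linarith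
        _ = ε := by simp only [δ]; field_simp
    exact tendsto_nhds_unique h1 h2
  · intro T C M hC hb hM x hx
    have hs := (Real.summable_pow_div_factorial (C * T)).mul_left M
    refine (tsum_of_norm_bounded hs.hasSum fun l => key T C M hC hb hM l x hx).trans_eq ?_
    rw [tsum_mul_left, Real.exp_eq_exp_ℝ, NormedSpace.exp_eq_tsum_div]

/-- A continuous function dominated by its own primitive vanishes. -/
theorem eq_zero_of_norm_le_integral {x₀ : ℝ} {S : Set ℝ} (hS : ∀ x ∈ S, uIoc x₀ x ⊆ S)
    {v : ℝ → ℂ} (hv : Continuous v) (h : ∀ T : ℝ, ∃ C, 0 ≤ C ∧ ∀ x ∈ S, |x - x₀| ≤ T →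
      ‖v x‖ ≤ C * ∫ t in uIoc x₀ x, ‖v t‖) : ∀ x ∈ S, v x = 0 := by
  intro x hxS
  obtain ⟨C, hC, hb⟩ := h |x - x₀|
  obtain ⟨M, hM⟩ := (isCompact_closedBall x₀ |x - x₀|).exists_bound_of_continuousOn
    hv.continuousOn
  -- Iterating the hypothesis `l` times gains `l!` in the denominator, and the bound tends to zero.
  -- All points that occur stay in `S`.
  have h1 : ∀ l : ℕ, ∀ y ∈ S, |y - x₀| ≤ |x - x₀| →
      ‖v y‖ ≤ M * ((C * |y - x₀|) ^ l / l.factorial) := by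
    intro l
    induction l with
    | zero => intro y _ hy; simpa using hM y (by simpa [Real.dist_eq] using hy)
    | succ l ih =>
      intro y hyS hy
      refine (hb y hyS hy).trans ?_
      have h1 : ∫ t in uIoc x₀ y, ‖v t‖ ≤
          ∫ t in uIoc x₀ y, M * C ^ l / l.factorial * |t - x₀| ^ l := by
        refine setIntegral_mono_on (integrableOn_uIoc hv.norm _ _)
          (integrableOn_uIoc (by fun_prop) _ _) measurableSet_uIoc fun t ht => ?_
        refine (ih t (hS y hyS ht) ((abs_sub_le_of_mem_uIoc ht).trans hy)).trans_eq ?_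
        rw [mul_pow]
        ring
      rw [integral_const_mul, integral_pow_abs_sub_uIoc] at h1
      refine (mul_le_mul_of_nonneg_left h1 hC).trans_eq ?_
      rw [Nat.factorial_succ]
      push_cast
      have : (l.factorial : ℝ) ≠ 0 := by exact_mod_cast l.factorial_ne_zero
      field_simp
      ring
  have h2 := (FloorSemiring.tendsto_pow_div_factorial_atTop (C * |x - x₀|)).const_mul M
  rw [mul_zero] at h2
  exact norm_le_zero_iff.1 (ge_of_tendsto' h2 fun l => h1 l x hxS le_rfl)

/-- Uniqueness for a linear Volterra equation. -/
theorem IsVolterra.eq_zero {x₀ : ℝ} {K : (ℝ → ℂ) → ℝ → ℂ} (hK : IsVolterra x₀ K) {S : Set ℝ}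
    (hS : ∀ x ∈ S, uIoc x₀ x ⊆ S) {v : ℝ → ℂ} (hv : Continuous v) (h : ∀ x ∈ S, v x = K v x) :
    ∀ x ∈ S, v x = 0 := by
  refine eq_zero_of_norm_le_integral hS hv fun T => ?_
  obtain ⟨C, hC, hb⟩ := hK.bound T
  refine ⟨C, hC, fun x hx hxT => ?_⟩
  rw [h x hx]
  exact hb v hv x hxT

/-! ### The Cauchy problem as a Volterra equation. -/

theorem continuous_iterate_prim (a : ℝ) {v : ℝ → ℂ} (hv : Continuous v) (i : ℕ) :
    Continuous ((prim a)^[i] v) :=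
  contDiff_zero.1 (contDiff_iterate_prim a (k := 0) (contDiff_zero.2 hv) i)

theorem iterate_prim_add (a : ℝ) {v w : ℝ → ℂ} (hv : Continuous v) (hw : Continuous w) (i : ℕ) :
    (prim a)^[i] (v + w) = (prim a)^[i] v + (prim a)^[i] w := by
  induction i with
  | zero => rfl
  | succ i ih =>
    simp only [Function.iterate_succ_apply', ih]
    ext x
    exact intervalIntegral.integral_add ((continuous_iterate_prim a hv i).intervalIntegrable _ _)
      ((continuous_iterate_prim a hw i).intervalIntegrable _ _)

theorem norm_prim_le (a : ℝ) (v : ℝ → ℂ) (x : ℝ) : ‖prim a v x‖ ≤ ∫ t in uIoc a x, ‖v t‖ :=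
  intervalIntegral.norm_integral_le_integral_norm_uIoc

/-- The first integration uses the `L¹` norm of `v`, and each further one costs a factor `T`. -/
theorem norm_iterate_prim_le (a : ℝ) {v : ℝ → ℂ} (hv : Continuous v) {T : ℝ} (i : ℕ) :
    ∀ x, |x - a| ≤ T → ‖(prim a)^[i + 1] v x‖ ≤ T ^ i * ∫ t in uIoc a x, ‖v t‖ := by
  induction i with
  | zero => intro x _; simpa using norm_prim_le a v x
  | succ i ih =>
    intro x hx
    have hT : 0 ≤ T := (abs_nonneg _).trans hx
    rw [Function.iterate_succ_apply']
    have h := intervalIntegral.norm_integral_le_of_norm_le_const (a := a) (b := x)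
      (f := (prim a)^[i + 1] v) (C := T ^ i * ∫ t in uIoc a x, ‖v t‖) (fun t ht => by
        refine (ih t ((abs_sub_le_of_mem_uIoc ht).trans hx)).trans ?_
        refine mul_le_mul_of_nonneg_left ?_ (by positivity)
        refine setIntegral_mono_set (integrableOn_uIoc hv.norm _ _) (.of_forall fun _ =>
          norm_nonneg _) (LE.le.eventuallyLE ?_)
        exact uIoc_subset_uIoc_of_uIcc_subset_uIcc
          (uIcc_subset_uIcc_left (uIoc_subset_uIcc ht)))
    have h0 : 0 ≤ ∫ t in uIoc a x, ‖v t‖ := integral_nonneg fun _ => norm_nonneg _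
    refine h.trans ((mul_le_mul_of_nonneg_left hx (by positivity)).trans_eq ?_)
    ring

theorem iteratedDeriv_iterate_prim (a : ℝ) {v : ℝ → ℂ} (hv : Continuous v) (k j : ℕ) (hj : j ≤ k) :
    iteratedDeriv j ((prim a)^[k] v) = (prim a)^[k - j] v := by
  induction j with
  | zero => simp
  | succ j ih =>
    rw [iteratedDeriv_succ, ih (by omega), show k - j = (k - (j + 1)) + 1 by omega,
      Function.iterate_succ_apply', deriv_prim a (continuous_iterate_prim a hv _)]

theorem iterate_prim_apply_self (a : ℝ) (v : ℝ → ℂ) (i : ℕ) : (prim a)^[i + 1] v a = 0 := by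
  rw [Function.iterate_succ_apply', prim, intervalIntegral.integral_same]

/-- Vanishing data leave no constants of integration, so all lower derivatives are iterated
primitives of the top one. -/
theorem iteratedDeriv_eq_iterate_prim (a : ℝ) {u : ℝ → ℂ} (hu : ContDiff ℝ ∞ u) {k : ℕ}
    (h0 : ∀ j < k, iteratedDeriv j u a = 0) (i : ℕ) (hi : i ≤ k) :
    iteratedDeriv (k - i) u = (prim a)^[i] (iteratedDeriv k u) := by
  induction i with
  | zero => rfl
  | succ i ih =>
    rw [Function.iterate_succ_apply', ← ih (by omega)]
    ext x
    have h := intervalIntegral.integral_eq_sub_of_hasDerivAt (a := a) (b := x)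
      (fun x _ => hasDerivAt_iteratedDeriv hu (k - (i + 1)) x)
      ((continuous_iteratedDeriv_of_smooth hu _).intervalIntegrable _ _)
    rw [h0 _ (by omega), sub_zero] at h
    rw [← h, prim, show k - (i + 1) + 1 = k - i by omega]

/-- The Volterra operator of the Cauchy problem for `u^{(k)} + ∑_{j < k} b_j u^{(j)}`, in the
unknown `u^{(k)}`. -/
def cauchyOp (k : ℕ) (b : ℕ → ℝ → ℂ) (x₀ : ℝ) (v : ℝ → ℂ) (x : ℝ) : ℂ :=
  -∑ j ∈ Finset.range k, b j x * (prim x₀)^[k - j] v x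

theorem exists_norm_le_of_continuous {u : ℝ → ℂ} (hu : Continuous u) (x₀ T : ℝ) :
    ∃ M, 0 ≤ M ∧ ∀ x, |x - x₀| ≤ T → ‖u x‖ ≤ M := by
  obtain ⟨M, hM⟩ := (isCompact_closedBall x₀ T).exists_bound_of_continuousOn hu.continuousOn
  exact ⟨max M 0, le_max_right _ _, fun x hx =>
    (hM x (by simpa [Real.dist_eq] using hx)).trans (le_max_left _ _)⟩

theorem isVolterra_cauchyOp (k : ℕ) {b : ℕ → ℝ → ℂ} (hb : ∀ j, ContDiff ℝ ∞ (b j)) (x₀ : ℝ) :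
    IsVolterra x₀ (cauchyOp k b x₀) where
  cont v hv := (continuous_finsetSum _ fun j _ =>
    (hb j).continuous.mul (continuous_iterate_prim x₀ hv _)).neg
  add v w hv hw := by
    ext x
    simp only [cauchyOp, Pi.add_apply, iterate_prim_add x₀ hv hw, mul_add, Finset.sum_add_distrib]
    ring
  bound T := by
    choose B hB0 hB using fun j => exists_norm_le_of_continuous (hb j).continuous x₀ T
    refine ⟨∑ j ∈ Finset.range k, B j * |T| ^ (k - j - 1), Finset.sum_nonneg fun j _ =>
      mul_nonneg (hB0 j) (by positivity), fun v hv x hx => ?_⟩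
    have hT : 0 ≤ T := (abs_nonneg _).trans hx
    rw [cauchyOp, norm_neg, Finset.sum_mul]
    refine norm_sum_le_of_le _ fun j hj => ?_
    rw [norm_mul, mul_assoc, abs_of_nonneg hT]
    refine mul_le_mul (hB j x hx) ?_ (norm_nonneg _) (hB0 j)
    have h := norm_iterate_prim_le x₀ hv (k - j - 1) x hx
    rwa [show k - j - 1 + 1 = k - j by have := Finset.mem_range.1 hj; omega] at h

/-- The differential expression solved for its top derivative: a Volterra equation in `u^{(k)}`. -/
theorem diffOp_eq_of_iteratedDeriv (k : ℕ) {b : ℕ → ℝ → ℂ} (hbk : ∀ x, b k x = 1) (x₀ : ℝ)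
    {u : ℝ → ℂ} (hu : ContDiff ℝ ∞ u) (h0 : ∀ j < k, iteratedDeriv j u x₀ = 0) :
    iteratedDeriv k u = diffOp k b u + cauchyOp k b x₀ (iteratedDeriv k u) := by
  ext x
  simp only [diffOp, cauchyOp, Pi.add_apply, Finset.sum_range_succ, hbk, one_mul]
  have : ∀ j ∈ Finset.range k, b j x * (prim x₀)^[k - j] (iteratedDeriv k u) x =
      b j x * iteratedDeriv j u x := by
    intro j hj
    have hj' := Finset.mem_range.1 hj
    rw [← iteratedDeriv_eq_iterate_prim x₀ hu h0 (k - j) (by omega),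
      show k - (k - j) = j by omega]
  rw [Finset.sum_congr rfl this]
  ring

/-- `S` only has to contain the segments from `x₀` to its points, so that uniqueness is available on
half-lines as well as on the whole line. -/
theorem cauchy_unique (k : ℕ) {b : ℕ → ℝ → ℂ} (hb : ∀ j, ContDiff ℝ ∞ (b j))
    (hbk : ∀ x, b k x = 1) {x₀ : ℝ} {S : Set ℝ} (hS : ∀ x ∈ S, uIoc x₀ x ⊆ S) {u : ℝ → ℂ}
    (hu : ContDiff ℝ ∞ u) (h0 : ∀ j < k, iteratedDeriv j u x₀ = 0)
    (h : ∀ x ∈ S, diffOp k b u x = 0) : ∀ x ∈ S, u x = 0 := by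
  have h1 := diffOp_eq_of_iteratedDeriv k hbk x₀ hu h0
  have h2 := (isVolterra_cauchyOp k hb x₀).eq_zero hS (continuous_iteratedDeriv_of_smooth hu k)
    (fun x hx => by
      conv_lhs => rw [h1, Pi.add_apply, h x hx, zero_add])
  have h3 := iteratedDeriv_eq_iterate_prim x₀ hu h0 k le_rfl
  rw [Nat.sub_self, iteratedDeriv_zero] at h3
  have h4 : ∀ i, ∀ x ∈ S, (prim x₀)^[i] (iteratedDeriv k u) x = 0 := by
    intro i
    induction i with
    | zero => exact h2
    | succ i ih =>
      intro x hx
      rw [Function.iterate_succ_apply']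
      exact intervalIntegral.integral_zero_ae (.of_forall fun t ht => ih t (hS x hx ht))
  rw [h3]
  exact h4 k

/-- The Cauchy problem with vanishing data for a linear ordinary differential equation. -/
theorem cauchy_exists (k : ℕ) {b : ℕ → ℝ → ℂ} (hb : ∀ j, ContDiff ℝ ∞ (b j))
    (hbk : ∀ x, b k x = 1) (x₀ : ℝ) {g : ℝ → ℂ} (hg : ContDiff ℝ ∞ g) :
    ∃ u : ℝ → ℂ, ContDiff ℝ ∞ u ∧ diffOp k b u = g ∧ ∀ j < k, iteratedDeriv j u x₀ = 0 := by
  obtain ⟨v, hvc, hv, -⟩ := (isVolterra_cauchyOp k hb x₀).exists_eq hg.continuous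
  have hvs : ContDiff ℝ ∞ v := by
    refine contDiff_infty_of_succ hvc fun l hl => ?_
    rw [hv]
    refine (smooth_of_nat hg _).add (ContDiff.sum fun j hj =>
      (smooth_of_nat (hb j) _).mul ?_).neg
    rw [show k - j = (k - j - 1) + 1 by have := Finset.mem_range.1 hj; omega]
    exact contDiff_iterate_succ_prim x₀ hl _
  have hus := contDiff_infty_iterate_prim x₀ hvs k
  refine ⟨_, hus, ?_, ?_⟩
  · have h0 : iteratedDeriv k ((prim x₀)^[k] v) = v := by
      rw [iteratedDeriv_iterate_prim x₀ hvc k k le_rfl, Nat.sub_self]; rfl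
    have h1 : ∀ j < k, iteratedDeriv j ((prim x₀)^[k] v) x₀ = 0 := fun j hj => by
      rw [iteratedDeriv_iterate_prim x₀ hvc k j hj.le, show k - j = (k - j - 1) + 1 by omega,
        iterate_prim_apply_self]
    have h2 := diffOp_eq_of_iteratedDeriv k hbk x₀ hus h1
    rw [h0] at h2
    have h3 := hv.symm.trans h2
    exact (add_right_cancel h3).symm
  · intro j hj
    rw [iteratedDeriv_iterate_prim x₀ hvc k j hj.le, show k - j = (k - j - 1) + 1 by omega,
      iterate_prim_apply_self]

/-- The solution of the Cauchy problem and its derivatives are bounded by the right-hand side. -/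
theorem cauchy_bound (k : ℕ) {b : ℕ → ℝ → ℂ} (hb : ∀ j, ContDiff ℝ ∞ (b j))
    (hbk : ∀ x, b k x = 1) (x₀ T : ℝ) :
    ∃ C, 0 ≤ C ∧ ∀ u : ℝ → ℂ, ContDiff ℝ ∞ u → (∀ j < k, iteratedDeriv j u x₀ = 0) →
      ∀ M, (∀ x, |x - x₀| ≤ T → ‖diffOp k b u x‖ ≤ M) →
      ∀ j ≤ k, ∀ x, |x - x₀| ≤ T → ‖iteratedDeriv j u x‖ ≤ C * M := by
  have hK := isVolterra_cauchyOp k hb x₀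
  obtain ⟨C, hC, hCb⟩ := hK.bound T
  refine ⟨(1 + |T|) ^ k * Real.exp (C * T), by positivity, fun u hu h0 M hM j hj x hx => ?_⟩
  have hT : 0 ≤ T := (abs_nonneg _).trans hx
  have hM0 : 0 ≤ M := (norm_nonneg _).trans (hM x hx)
  have hdc := (contDiff_diffOp k hb hu).continuous
  have huc := continuous_iteratedDeriv_of_smooth hu k
  obtain ⟨v, hvc, hv, hvb⟩ := hK.exists_eq hdc
  have h1 := diffOp_eq_of_iteratedDeriv k hbk x₀ hu h0
  -- The bound is known for the Neumann series solution `v`; uniqueness identifies it with the top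
  -- derivative of `u`.
  have h2 : iteratedDeriv k u - v = 0 := funext fun x => hK.eq_zero (S := univ)
    (fun _ _ => subset_univ _) (huc.sub hvc) (fun x _ => by
      rw [hK.map_sub huc hvc]
      conv_lhs => rw [h1, hv]
      simp) x (mem_univ x)
  have h3 : ∀ x, |x - x₀| ≤ T → ‖iteratedDeriv k u x‖ ≤ M * Real.exp (C * T) := by
    rw [sub_eq_zero.1 h2]
    exact hvb T C M hC hCb hM
  have h4 : ∀ i, ∀ x, |x - x₀| ≤ T →
      ‖(prim x₀)^[i] (iteratedDeriv k u) x‖ ≤ T ^ i * (M * Real.exp (C * T)) := by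
    intro i
    induction i with
    | zero => simpa using h3
    | succ i ih =>
      intro x hx
      rw [Function.iterate_succ_apply']
      refine (intervalIntegral.norm_integral_le_of_norm_le_const fun t ht =>
        ih t ((abs_sub_le_of_mem_uIoc ht).trans hx)).trans ?_
      refine (mul_le_mul_of_nonneg_left hx (by positivity)).trans_eq ?_
      ring
  have h5 := h4 (k - j) x hx
  rw [← iteratedDeriv_eq_iterate_prim x₀ hu h0 (k - j) (by omega), show k - (k - j) = j by omega]
    at h5
  refine h5.trans ?_
  rw [abs_of_nonneg hT]
  -- One constant for all orders: `(1 + T)^k` dominates every power `T^(k - j)`.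
  have h6 : T ^ (k - j) ≤ (1 + T) ^ k :=
    (pow_le_pow_left₀ hT (by linarith) _).trans (pow_le_pow_right₀ (by linarith) (by omega))
  calc T ^ (k - j) * (M * Real.exp (C * T)) ≤ (1 + T) ^ k * (M * Real.exp (C * T)) := by gcongr
    _ = _ := by ring

/-! ### Distributions from bounded functionals; the causal fundamental solution -/

/-- A linear functional on test functions that is locally bounded by finitely many derivatives is
a distribution. -/
theorem exists_distr_of_bound (ℓ : TestFn →ₗ[ℂ] ℂ) (N : ℕ)
    (h : ∀ K : Set ℝ, IsCompact K → ∃ C : ℝ, ∀ φ : TestFn, tsupport φ ⊆ K →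
      ∀ B, (∀ j ≤ N, ∀ x, ‖iteratedDeriv j φ x‖ ≤ B) → ‖ℓ φ‖ ≤ C * B) :
    ∃ T : Distr, ∀ φ, T φ = ℓ φ := by
  refine ⟨TestFunction.mkCLM ℂ ℓ (map_add ℓ) (map_smul ℓ) fun K hK => ?_, fun φ => rfl⟩
  obtain ⟨C, hC⟩ := h K K.isCompact
  let f : 𝓓^{⊤}_{K}(ℝ, ℂ) →ₗ[ℂ] ℂ :=
    ℓ ∘ₗ (TestFunction.ofSupportedInCLM ℂ hK : 𝓓^{⊤}_{K}(ℝ, ℂ) →L[ℂ] TestFn).toLinearMap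
  let p : Seminorm ℂ 𝓓^{⊤}_{K}(ℝ, ℂ) :=
    ∑ i ∈ Finset.range (N + 1), ContDiffMapSupportedIn.seminorm ℂ ℝ ℂ ⊤ K i
  have hp : Continuous p := by
    have : (p : 𝓓^{⊤}_{K}(ℝ, ℂ) → ℝ) = fun φ => ∑ i ∈ Finset.range (N + 1),
        ContDiffMapSupportedIn.seminorm ℂ ℝ ℂ ⊤ K i φ := by
      ext φ
      simp only [p]
      induction Finset.range (N + 1) using Finset.induction with
      | empty => simp
      | insert a s ha ih => simp [Finset.sum_insert ha, ih]
    rw [this]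
    exact continuous_finsetSum _ fun i _ =>
      (ContDiffMapSupportedIn.withSeminorms ℂ ℝ ℂ ⊤ K).continuous_seminorm i
  have hb : ∀ φ, ‖f φ‖ ≤ C * p φ := by
    intro φ
    refine hC _ φ.tsupport_subset _ fun j hj x => ?_
    rw [← norm_iteratedFDeriv_eq_norm_iteratedDeriv]
    refine (ContDiffMapSupportedIn.norm_iteratedFDeriv_apply_le_seminorm_top ℂ).trans ?_
    have hle : ContDiffMapSupportedIn.seminorm ℂ ℝ ℂ ⊤ K j ≤ p := by
      simp only [p]
      exact Finset.single_le_sum (f := fun i => ContDiffMapSupportedIn.seminorm ℂ ℝ ℂ ⊤ K i)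
        (fun i _ => by intro x; exact apply_nonneg (ContDiffMapSupportedIn.seminorm ℂ ℝ ℂ ⊤ K i) x)
        (Finset.mem_range.2 (by omega))
    exact hle φ
  change Continuous f
  refine continuous_of_continuousAt_zero f ?_
  rw [ContinuousAt, map_zero]
  refine squeeze_zero_norm hb ?_
  have := (hp.tendsto 0).const_mul C
  rwa [map_zero, mul_zero] at this

/-! ### The causal fundamental solution. -/

theorem iteratedDeriv_eq_zero_of_eventuallyEq {u : ℝ → ℂ} {x : ℝ}
    (h : ∀ᶠ y in nhds x, u y = 0) (j : ℕ) : iteratedDeriv j u x = 0 := by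
  have h' : u =ᶠ[nhds x] fun _ => (0 : ℂ) := h
  rw [h'.iteratedDeriv_eq]
  simp

/-- The solution of the transposed equation that vanishes to the right. -/
theorem exists_backward_solution (m : ℕ) {b : ℕ → ℝ → ℂ} (hb : ∀ j, ContDiff ℝ ∞ (b j))
    (hbm : ∀ x, b m x = 1) (φ : TestFn) :
    ∃ u : ℝ → ℂ, ContDiff ℝ ∞ u ∧ diffOp m b u = φ ∧
      ∀ M, tsupport φ ⊆ Iio M → ∀ x ≥ M, u x = 0 := by
  obtain ⟨M₀, -, hM₀⟩ := φ.exists_Ioo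
  obtain ⟨u, hu, hud, hu0⟩ := cauchy_exists m hb hbm M₀ φ.smooth
  refine ⟨u, hu, hud, ?_⟩
  have hφ : ∀ M, tsupport φ ⊆ Iio M → ∀ x ∈ Ici M, diffOp m b u x = 0 := fun M hM x hx => by
    rw [hud]
    exact image_eq_zero_of_notMem_tsupport fun h => not_lt.2 (mem_Ici.1 hx) (mem_Iio.1 (hM h))
  have h1 : ∀ x ∈ Ici M₀, u x = 0 := cauchy_unique m hb hbm (x₀ := M₀)
    (fun x hx t ht => by
      rw [uIoc_of_le hx] at ht
      exact ht.1.le) hu hu0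
    (hφ M₀ (hM₀.trans fun x hx => hx.2))
  intro M hM
  -- The base point moves to a place where `u` vanishes nearby, so all data vanish there. Uniqueness
  -- on `[M, ∞)` then covers every `M`, also one smaller than `M₀`.
  refine cauchy_unique m hb hbm (x₀ := max M M₀ + 1) (S := Ici M) (fun x hx t ht => ?_) hu
    (fun j _ => iteratedDeriv_eq_zero_of_eventuallyEq ?_ j) (hφ M hM)
  · have h2 := uIoc_subset_uIcc ht
    have h3 : M ≤ max M M₀ + 1 := by linarith [le_max_left M M₀]
    exact (uIcc_subset_Icc (a₂ := M) (b₂ := max x (max M M₀ + 1)) ⟨h3, le_max_right _ _⟩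
      ⟨hx, le_max_left _ _⟩ h2).1
  · filter_upwards [Ioi_mem_nhds (lt_add_one (max M M₀))] with y hy
    exact h1 y ((le_max_right M M₀).trans (le_of_lt hy))

/-- The difference vanishes near `M + 1`, hence has zero Cauchy data there. -/
theorem backward_unique (m : ℕ) {b : ℕ → ℝ → ℂ} (hb : ∀ j, ContDiff ℝ ∞ (b j))
    (hbm : ∀ x, b m x = 1) {u v : ℝ → ℂ} (hu : ContDiff ℝ ∞ u) (hv : ContDiff ℝ ∞ v)
    (huv : diffOp m b u = diffOp m b v) {M : ℝ} (hM : ∀ x ≥ M, u x = v x) : u = v := by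
  have hd : diffOp m b (u - v) = 0 := by
    ext x
    have := congrFun huv x
    simp only [diffOp] at this ⊢
    rw [Pi.zero_apply, ← sub_eq_zero.2 this, ← Finset.sum_sub_distrib]
    refine Finset.sum_congr rfl fun j _ => ?_
    rw [iteratedDeriv_sub (smooth_of_nat hu j).contDiffAt (smooth_of_nat hv j).contDiffAt, mul_sub]
  have h := cauchy_unique m hb hbm (x₀ := M + 1) (S := univ) (fun _ _ => subset_univ _)
    (hu.sub hv) (fun j _ => iteratedDeriv_eq_zero_of_eventuallyEq (by
      filter_upwards [Ioi_mem_nhds (lt_add_one M)] with y hy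
      simp [hM y (le_of_lt hy)]) j) (fun x _ => congrFun hd x)
  ext x
  exact sub_eq_zero.1 (h x (mem_univ x))

/-- The leading coefficient of the transpose is `(-1)^m p_m`, and `m` is even. -/
theorem transposeOp_leading_eq_one {m : ℕ} (hm : Even m) {p : ℕ → ℝ → ℂ}
    (hp : ∀ j, ContDiff ℝ ∞ (p j)) (hpm : ∀ x, p m x = 1) :
    ∃ b : ℕ → ℝ → ℂ, (∀ j, ContDiff ℝ ∞ (b j)) ∧ (∀ x, b m x = 1) ∧
      ∀ u : ℝ → ℂ, ContDiff ℝ ∞ u → transposeOp m p u = diffOp m b u := by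
  obtain ⟨b, hb, hbm, hbt⟩ := exists_transposeOp_eq_diffOp m hp
  exact ⟨b, hb, fun x => by rw [hbm, hpm, hm.neg_one_pow, mul_one], hbt⟩

theorem TestFn.exists_Iio (φ : TestFn) : ∃ M, tsupport φ ⊆ Iio M := by
  obtain ⟨M, -, h⟩ := φ.exists_Ioo
  exact ⟨M, h.trans fun x hx => hx.2⟩

/-- The causal fundamental solution, as a family of distributions: `y ↦ G y φ` is the solution of
the transposed equation with right-hand side `φ` that vanishes to the right of the support. -/
theorem exists_causal_family {m : ℕ} (hm : Even m) {p : ℕ → ℝ → ℂ}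
    (hp : ∀ j, ContDiff ℝ ∞ (p j)) (hpm : ∀ x, p m x = 1) :
    ∃ G : ℝ → Distr, ∀ φ : TestFn, ContDiff ℝ ∞ (fun y => G y φ) ∧
      transposeOp m p (fun y => G y φ) = φ ∧
      ∀ M, tsupport φ ⊆ Iio M → ∀ y ≥ M, G y φ = 0 := by
  obtain ⟨b, hb, hbm, hbt⟩ := transposeOp_leading_eq_one hm hp hpm
  choose Φ hΦs hΦ hΦ0 using exists_backward_solution m hb hbm
  -- Linearity in `φ` comes from uniqueness, since sums and multiples of backward solutions again
  -- vanish far to the right.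
  have hadd : ∀ φ ψ, Φ (φ + ψ) = Φ φ + Φ ψ := by
    intro φ ψ
    obtain ⟨M, hM⟩ := φ.exists_Iio
    obtain ⟨M', hM'⟩ := ψ.exists_Iio
    obtain ⟨M'', hM''⟩ := (φ + ψ).exists_Iio
    refine backward_unique m hb hbm (hΦs _) ((hΦs _).add (hΦs _)) ?_ (M := max M (max M' M''))
      fun x hx => ?_
    · rw [hΦ, ← hbt (Φ φ + Φ ψ) ((hΦs _).add (hΦs _)), transposeOp_add m hp (hΦs _) (hΦs _),
        hbt _ (hΦs _), hbt _ (hΦs _), hΦ, hΦ]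
      ext; simp
    · simp only [ge_iff_le, max_le_iff] at hx
      rw [Pi.add_apply, hΦ0 _ M hM x hx.1, hΦ0 _ M' hM' x hx.2.1, hΦ0 _ M'' hM'' x hx.2.2, add_zero]
  have hsmul : ∀ (c : ℂ) φ, Φ (c • φ) = c • Φ φ := by
    intro c φ
    obtain ⟨M, hM⟩ := φ.exists_Iio
    obtain ⟨M', hM'⟩ := (c • φ).exists_Iio
    refine backward_unique m hb hbm (hΦs _) ((hΦs _).const_smul c) ?_ (M := max M M')
      fun x hx => ?_
    · rw [hΦ, ← hbt (c • Φ φ) ((hΦs _).const_smul c), transposeOp_smul, hbt _ (hΦs _), hΦ]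
      ext; simp
    · simp only [ge_iff_le, max_le_iff] at hx
      rw [Pi.smul_apply, hΦ0 _ M hM x hx.1, hΦ0 _ M' hM' x hx.2, smul_zero]
  have hex : ∀ y, ∃ T : Distr, ∀ φ, T φ = Φ φ y := by
    intro y
    refine exists_distr_of_bound
      { toFun := fun φ => Φ φ y
        map_add' := fun φ ψ => congrFun (hadd φ ψ) y
        map_smul' := fun c φ => congrFun (hsmul c φ) y } 0 fun K hK => ?_
    obtain ⟨M, hM⟩ := hK.isBounded.subset_ball 0
    -- The base point lies to the right of every support contained in `K`, and the radius is just
    -- large enough to reach `y`. Hence `C` depends on `K` and `y` only.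
    obtain ⟨C, hC, hCb⟩ := cauchy_bound m hb hbm (M + 1) |y - (M + 1)|
    refine ⟨C, fun φ hφ B hB => ?_⟩
    have hφM : tsupport φ ⊆ Iio M := hφ.trans (hM.trans (by
      rw [Real.ball_eq_Ioo]
      exact fun x hx => by simpa using hx.2))
    have h := hCb (Φ φ) (hΦs φ) (fun j _ => iteratedDeriv_eq_zero_of_eventuallyEq (by
      filter_upwards [Ioi_mem_nhds (lt_add_one M)] with z hz
      exact hΦ0 φ M hφM z (le_of_lt hz)) j) B (fun x _ => by
        rw [hΦ]
        simpa using hB 0 le_rfl x) 0 (Nat.zero_le _) y le_rfl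
    simpa using h
  choose G hG using hex
  have hGf : ∀ φ, (fun y => G y φ) = Φ φ := fun φ => funext fun y => hG y φ
  refine ⟨G, fun φ => ⟨?_, ?_, fun M hM y hy => ?_⟩⟩
  · rw [hGf]; exact hΦs φ
  · rw [hGf, hbt _ (hΦs φ), hΦ]
  · rw [hG]; exact hΦ0 φ M hM y hy

/-- Cutting off the solution of the transposed equation on the left. -/
theorem exists_transpose_cutoff {m : ℕ} {p : ℕ → ℝ → ℂ} (hp : ∀ j, ContDiff ℝ ∞ (p j))
    {Φ : ℝ → ℂ} (hΦ : ContDiff ℝ ∞ Φ) {M : ℝ} (hM : ∀ x ≥ M, Φ x = 0) (a : ℝ) :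
    ∃ ψ : TestFn, (∀ x ≥ a, ∀ᶠ y in nhds x, ψ y = Φ y) ∧
      ∀ x ≥ a, transposeTest m p hp ψ x = transposeOp m p Φ x := by
  -- Beyond `M` the function is already zero, so the cutoff is only felt to the left of `a`.
  obtain ⟨χ, hχ, hχ1⟩ := TestFn.exists_cutoff (a := a) (b := max a (M + 1)) (a' := a - 1)
    (b' := max a (M + 1) + 1) (by linarith) (by linarith)
  have h1 : ∀ x ≥ a, ∀ᶠ y in nhds x, χ y * Φ y = Φ y := by
    intro x hx
    rcases le_or_gt x (max a (M + 1)) with h | h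
    · filter_upwards [hχ1 x ⟨hx, h⟩] with y hy
      rw [hy, one_mul]
    · have : M < x := by
        have := le_max_right a (M + 1)
        linarith
      filter_upwards [Ioi_mem_nhds this] with y hy
      rw [hM y (le_of_lt hy), mul_zero]
  refine ⟨TestFn.mkSmooth (fun x => χ x * Φ x) (χ.smooth.mul hΦ) χ.hasCompactSupport.mul_right,
    h1, fun x hx => ?_⟩
  rw [coe_transposeTest]
  simp only [transposeOp]
  refine Finset.sum_congr rfl fun j _ => ?_
  congr 1
  refine Filter.EventuallyEq.iteratedDeriv_eq j ?_
  filter_upwards [h1 x hx] with y hy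
  rw [TestFn.mkSmooth_apply, hy]

/-- Let `ψ` be the backward solution `y ↦ G y φ`, cut off on the left. Then `φ` and `Pᵗψ` differ
only to the left of `y`, where every causal `G' y` vanishes; so `G' y φ = ψ y = G y φ`. -/
theorem causal_unique {m : ℕ} {p : ℕ → ℝ → ℂ} (hp : ∀ j, ContDiff ℝ ∞ (p j)) {G : ℝ → Distr}
    (hG : ∀ φ : TestFn, ContDiff ℝ ∞ (fun y => G y φ) ∧
      transposeOp m p (fun y => G y φ) = φ ∧
      ∀ M, tsupport φ ⊆ Iio M → ∀ y ≥ M, G y φ = 0)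
    {G' : ℝ → Distr} (hG' : IsCausalFundamental m p hp G') : G' = G := by
  funext y
  ext φ
  obtain ⟨M, hM⟩ := φ.exists_Iio
  obtain ⟨h1, h2, h3⟩ := hG φ
  obtain ⟨ψ, hψ, hψt⟩ := exists_transpose_cutoff (m := m) hp h1 (h3 M hM) (y - 1)
  have h4 : G' y (φ - transposeTest m p hp ψ) = 0 := by
    refine hG'.2 y _ ((closure_minimal (fun x hx => ?_) isClosed_Iic).trans
      (Iic_subset_Iio.2 (sub_one_lt y)))
    by_contra hxy
    refine hx ?_
    have := hψt x (le_of_lt (not_le.1 hxy))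
    rw [h2] at this
    simp [this]
  rw [map_sub, hG'.1, sub_eq_zero] at h4
  rw [h4]
  exact (hψ y (by linarith)).self_of_nhds

/-- `φ` itself is the backward solution with right-hand side `Pᵗφ`, so uniqueness identifies it with
`y ↦ G y (Pᵗφ)`. -/
theorem causal_isCausalFundamental {m : ℕ} (hm : Even m) {p : ℕ → ℝ → ℂ}
    (hp : ∀ j, ContDiff ℝ ∞ (p j)) (hpm : ∀ x, p m x = 1) {G : ℝ → Distr}
    (hG : ∀ φ : TestFn, ContDiff ℝ ∞ (fun y => G y φ) ∧
      transposeOp m p (fun y => G y φ) = φ ∧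
      ∀ M, tsupport φ ⊆ Iio M → ∀ y ≥ M, G y φ = 0) : IsCausalFundamental m p hp G := by
  obtain ⟨b, hb, hbm, hbt⟩ := transposeOp_leading_eq_one hm hp hpm
  refine ⟨fun y φ => ?_, fun y φ h => (hG φ).2.2 y h y le_rfl⟩
  obtain ⟨h1, h2, h3⟩ := hG (transposeTest m p hp φ)
  obtain ⟨M, hM⟩ := φ.exists_Iio
  refine congrFun (backward_unique m hb hbm h1 φ.smooth ?_ (M := M) fun x hx => ?_) y
  · rw [← hbt _ h1, h2, ← hbt _ φ.smooth]
    rfl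
  · rw [h3 M ((tsupport_transposeTest m p hp φ).trans hM) x hx]
    exact (image_eq_zero_of_notMem_tsupport fun h => not_lt.2 hx (mem_Iio.1 (hM h))).symm

/-! ### Fourier multipliers and the Sobolev norms of test functions -/

open SchwartzMap in
/-- Schwartz functions as elements of `L²(ℝ)`. -/
def toL2 : SchwartzMap ℝ ℂ →L[ℂ] Lp ℂ 2 (volume : Measure ℝ) := SchwartzMap.toLpCLM ℂ ℂ 2 volume

/-- The Fourier multiplier with symbol `g`, on Schwartz functions. -/
abbrev mult (g : ℝ → ℂ) : SchwartzMap ℝ ℂ →L[ℂ] SchwartzMap ℝ ℂ :=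
  SchwartzMap.fourierMultiplierCLM ℂ g

/-- The symbol `(1 + ξ²)^{s/2}`. -/
def weight (s : ℝ) (ξ : ℝ) : ℂ := (((1 + ‖ξ‖ ^ 2) ^ (s / 2) : ℝ) : ℂ)

/-- The Bessel potential of order `s`. -/
abbrev bessel (s : ℝ) : SchwartzMap ℝ ℂ →L[ℂ] SchwartzMap ℝ ℂ := mult (weight s)

theorem weight_hasTemperateGrowth (s : ℝ) : (weight s).HasTemperateGrowth := by
  unfold weight
  fun_prop

theorem norm_weight (s ξ : ℝ) : ‖weight s ξ‖ = (1 + ‖ξ‖ ^ 2) ^ (s / 2) := by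
  rw [weight, Complex.norm_real, Real.norm_of_nonneg (by positivity)]

theorem weight_mul (s t : ℝ) : weight s * weight t = weight (s + t) := by
  ext ξ
  simp only [weight, Pi.mul_apply]
  rw [← Complex.ofReal_mul, ← Real.rpow_add (by positivity), add_div]

theorem star_weight (s : ℝ) : (fun ξ => star (weight s ξ)) = weight s := by
  ext ξ
  simp [weight]

theorem toL2_eq (f : SchwartzMap ℝ ℂ) : toL2 f = f.toLp 2 := rfl

theorem fourier_mult (g : ℝ → ℂ) (f : SchwartzMap ℝ ℂ) :
    𝓕 (mult g f) = SchwartzMap.smulLeftCLM ℂ g (𝓕 f) := by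
  rw [SchwartzMap.fourierMultiplierCLM_apply, FourierTransform.fourier_fourierInv_eq]

theorem fourier_mult_apply {g : ℝ → ℂ} (hg : g.HasTemperateGrowth) (f : SchwartzMap ℝ ℂ) (ξ : ℝ) :
    𝓕 (mult g f) ξ = g ξ * 𝓕 f ξ := by
  rw [fourier_mult, SchwartzMap.smulLeftCLM_apply_apply hg, smul_eq_mul]

/-- Plancherel: a pointwise comparison of symbols is a comparison of norms. The inequalities between
Sobolev norms come from here. -/
theorem norm_toL2_mult_le {g k : ℝ → ℂ} (hg : g.HasTemperateGrowth) (hk : k.HasTemperateGrowth)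
    {C : ℝ} (h : ∀ ξ, ‖g ξ‖ ≤ C * ‖k ξ‖) (f : SchwartzMap ℝ ℂ) :
    ‖toL2 (mult g f)‖ ≤ C * ‖toL2 (mult k f)‖ := by
  rw [toL2_eq, toL2_eq, ← SchwartzMap.norm_fourier_toL2_eq (mult g f),
    ← SchwartzMap.norm_fourier_toL2_eq (mult k f)]
  refine Lp.norm_le_mul_norm_of_ae_le_mul ?_
  filter_upwards [(𝓕 (mult g f)).coeFn_toLp 2 volume, (𝓕 (mult k f)).coeFn_toLp 2 volume]
    with ξ h1 h2
  rw [h1, h2, fourier_mult_apply hg, fourier_mult_apply hk, norm_mul, norm_mul, ← mul_assoc]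
  exact mul_le_mul_of_nonneg_right (h ξ) (norm_nonneg _)

theorem inner_toL2 (f g : SchwartzMap ℝ ℂ) :
    inner ℂ (toL2 f) (toL2 g) = ∫ x, star (f x) * g x := by
  refine (SchwartzMap.inner_toL2_toL2_eq f g volume).trans ?_
  refine integral_congr_ae (.of_forall fun x => ?_)
  simp [mul_comm]

theorem inner_toL2_mult {g : ℝ → ℂ} (hg : g.HasTemperateGrowth)
    (hg' : (fun ξ => star (g ξ)).HasTemperateGrowth) (f h : SchwartzMap ℝ ℂ) :
    inner ℂ (toL2 (mult g f)) (toL2 h) = inner ℂ (toL2 f) (toL2 (mult (fun ξ => star (g ξ)) h)) := by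
  simp only [toL2_eq]
  rw [← SchwartzMap.inner_fourier_toL2_eq, ← SchwartzMap.inner_fourier_toL2_eq (f := f)]
  simp only [← toL2_eq, inner_toL2]
  refine integral_congr_ae (.of_forall fun ξ => ?_)
  simp only [fourier_mult_apply hg, fourier_mult_apply hg', star_mul']
  ring

theorem inner_toL2_bessel (s : ℝ) (f h : SchwartzMap ℝ ℂ) :
    inner ℂ (toL2 (bessel s f)) (toL2 h) = inner ℂ (toL2 f) (toL2 (bessel s h)) := by
  have := inner_toL2_mult (weight_hasTemperateGrowth s)
    (by rw [star_weight]; exact weight_hasTemperateGrowth s) f h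
  rwa [star_weight] at this

theorem bessel_bessel (s t : ℝ) (f : SchwartzMap ℝ ℂ) :
    bessel s (bessel t f) = bessel (s + t) f := by
  rw [SchwartzMap.fourierMultiplierCLM_fourierMultiplierCLM_apply (weight_hasTemperateGrowth s)
    (weight_hasTemperateGrowth t), weight_mul]

theorem bessel_zero (f : SchwartzMap ℝ ℂ) : bessel 0 f = f := by
  have : weight 0 = fun _ => 1 := by
    ext ξ
    simp [weight]
  rw [bessel, mult, this, SchwartzMap.fourierMultiplierCLM_const]
  simp

/-- The symbol `(2πiξ)^j` of the derivative of order `j`. -/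
def derivSymbol (j : ℕ) (ξ : ℝ) : ℂ := (2 * Real.pi * Complex.I * ξ) ^ j

theorem derivSymbol_hasTemperateGrowth (j : ℕ) : (derivSymbol j).HasTemperateGrowth := by
  unfold derivSymbol
  have h : (fun ξ : ℝ => (ξ : ℂ)).HasTemperateGrowth := by fun_prop
  fun_prop

theorem derivCLM_eq_mult (f : SchwartzMap ℝ ℂ) :
    SchwartzMap.derivCLM ℂ ℂ f = mult (derivSymbol 1) f := by
  apply (FourierTransform.fourierEquiv ℂ (SchwartzMap ℝ ℂ)).injective
  ext ξ
  change 𝓕 (SchwartzMap.derivCLM ℂ ℂ f) ξ = 𝓕 (mult (derivSymbol 1) f) ξ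
  rw [fourier_mult_apply (derivSymbol_hasTemperateGrowth 1), SchwartzMap.fourier_coe,
    SchwartzMap.fourier_coe]
  have := Real.fourier_deriv (f := f) f.integrable f.differentiable
    (SchwartzMap.derivCLM ℂ ℂ f).integrable
  change 𝓕 (deriv f) ξ = _
  rw [this]
  simp [derivSymbol]

theorem derivCLM_iterate_eq_mult (j : ℕ) (f : SchwartzMap ℝ ℂ) :
    (SchwartzMap.derivCLM ℂ ℂ)^[j] f = mult (derivSymbol j) f := by
  induction j with
  | zero =>
    have : derivSymbol 0 = fun _ => 1 := by
      ext
      simp [derivSymbol]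
    rw [mult, this, SchwartzMap.fourierMultiplierCLM_const]
    simp
  | succ j ih =>
    have : derivSymbol 1 * derivSymbol j = derivSymbol (j + 1) := by
      ext ξ
      simp only [derivSymbol, Pi.mul_apply]
      ring_nf
    rw [Function.iterate_succ_apply', ih, derivCLM_eq_mult,
      SchwartzMap.fourierMultiplierCLM_fourierMultiplierCLM_apply
        (derivSymbol_hasTemperateGrowth 1) (derivSymbol_hasTemperateGrowth j), this]

theorem coe_derivCLM_iterate (j : ℕ) (f : SchwartzMap ℝ ℂ) :
    ⇑((SchwartzMap.derivCLM ℂ ℂ)^[j] f) = iteratedDeriv j f := by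
  induction j with
  | zero => rw [iteratedDeriv_zero]; rfl
  | succ j ih =>
    rw [Function.iterate_succ_apply', iteratedDeriv_succ, ← ih]
    rfl

/-- The factor `(2π)^j` reflects the normalisation of the Fourier transform: the weight is `1 + ξ²`,
while a derivative has the symbol `2πiξ`. -/
theorem norm_derivSymbol_le {j : ℕ} {s : ℝ} (hj : (j : ℝ) ≤ s) (ξ : ℝ) :
    ‖derivSymbol j ξ‖ ≤ (2 * Real.pi) ^ j * ‖weight s ξ‖ := by
  rw [norm_weight, derivSymbol, norm_pow, norm_mul, mul_pow]
  have h0 : ‖(2 * Real.pi * Complex.I : ℂ)‖ = 2 * Real.pi := by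
    simp [abs_of_pos Real.pi_pos]
  rw [h0]
  refine mul_le_mul_of_nonneg_left ?_ (by positivity)
  have h1 : ‖(ξ : ℂ)‖ ^ j = (‖ξ‖ ^ 2) ^ ((j : ℝ) / 2) := by
    rw [Complex.norm_real, ← Real.rpow_natCast ‖ξ‖ 2, ← Real.rpow_mul (norm_nonneg _),
      ← Real.rpow_natCast]
    congr 1
    push_cast
    ring
  rw [h1]
  calc (‖ξ‖ ^ 2) ^ ((j : ℝ) / 2) ≤ (1 + ‖ξ‖ ^ 2) ^ ((j : ℝ) / 2) :=
        Real.rpow_le_rpow (by positivity) (by linarith) (by positivity)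
    _ ≤ (1 + ‖ξ‖ ^ 2) ^ (s / 2) :=
        Real.rpow_le_rpow_of_exponent_le (by nlinarith [sq_nonneg ‖ξ‖]) (by linarith)

/-- A test function as a Schwartz function. -/
def TestFn.toSchwartz : TestFn →ₗ[ℂ] SchwartzMap ℝ ℂ where
  toFun φ := φ.hasCompactSupport.toSchwartzMap φ.smooth
  map_add' _ _ := rfl
  map_smul' _ _ := rfl

@[simp] theorem TestFn.toSchwartz_apply (φ : TestFn) (x : ℝ) : TestFn.toSchwartz φ x = φ x := rfl

theorem TestFn.coe_toSchwartz (φ : TestFn) : ⇑(TestFn.toSchwartz φ) = φ := rfl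

/-- The element `(1 + ξ²)^{s/2} φ̂`, as a function of `x`, of `L²(ℝ)`, for a test function. -/
def sob (s : ℝ) : TestFn →ₗ[ℂ] Lp ℂ 2 (volume : Measure ℝ) :=
  (toL2 ∘L bessel s).toLinearMap ∘ₗ TestFn.toSchwartz

theorem sob_apply (s : ℝ) (φ : TestFn) : sob s φ = toL2 (bessel s (TestFn.toSchwartz φ)) := rfl

theorem norm_toL2_sq (f : SchwartzMap ℝ ℂ) : ‖toL2 f‖ ^ 2 = ∫ x, ‖f x‖ ^ 2 := by
  rw [toL2_eq, SchwartzMap.norm_toLp' (by norm_num) (by norm_num)]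
  simp only [ENNReal.toReal_ofNat, Real.rpow_ofNat]
  rw [← Real.rpow_natCast, ← Real.rpow_mul (integral_nonneg fun x => by positivity)]
  norm_num

theorem norm_sob (s : ℝ) (φ : TestFn) : ‖sob s φ‖ = sobolevNorm s φ := by
  rw [sobolevNorm, ← Real.sqrt_sq (norm_nonneg (sob s φ)), sob_apply, toL2_eq,
    ← SchwartzMap.norm_fourier_toL2_eq, ← toL2_eq, norm_toL2_sq]
  congr 1
  refine integral_congr_ae (.of_forall fun ξ => ?_)
  simp only
  rw [fourier_mult_apply (weight_hasTemperateGrowth s), norm_mul, mul_pow, norm_weight,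
    SchwartzMap.fourier_coe, TestFn.coe_toSchwartz, Real.norm_eq_abs, sq_abs,
    ← Real.rpow_natCast _ 2, ← Real.rpow_mul (by positivity)]
  norm_num

/-- Conjugation reflects and conjugates the Fourier transform, and the weight is even. This lets
estimates for the adjoint be read as estimates for the transpose. -/
theorem sobolevNorm_star (s : ℝ) (u : ℝ → ℂ) :
    sobolevNorm s (fun x => star (u x)) = sobolevNorm s u := by
  rw [sobolevNorm, sobolevNorm]
  have h : ∀ ξ, 𝓕 (fun x => star (u x)) ξ = star (𝓕 u (-ξ)) := by
    intro ξ
    simp only [Real.fourier_real_eq_integral_exp_smul]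
    rw [← starRingEnd_apply, ← integral_conj]
    refine integral_congr_ae (.of_forall fun x => ?_)
    simp only [smul_eq_mul]
    rw [← starRingEnd_apply, map_mul, ← Complex.exp_conj, map_mul, Complex.conj_I,
      Complex.conj_ofReal, starRingEnd_apply]
    congr 2
    push_cast
    ring
  simp only [h, norm_star]
  rw [← integral_neg_eq_self]
  simp

/-! ### Duality in `L²` -/

/-- A linear functional dominated by the norm of a linear map into a Hilbert space is an inner
product. -/
theorem exists_inner_of_norm_le {E H : Type*} [AddCommGroup E] [Module ℂ E]
    [NormedAddCommGroup H] [InnerProductSpace ℂ H] [CompleteSpace H] (T : E →ₗ[ℂ] H)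
    (ℓ : E →ₗ[ℂ] ℂ) {C : ℝ} (hC : 0 ≤ C) (h : ∀ x, ‖ℓ x‖ ≤ C * ‖T x‖) :
    ∃ y : H, ‖y‖ ≤ C ∧ ∀ x, ℓ x = inner ℂ y (T x) := by
  -- `T` need be neither injective nor of dense range; the bound lets `ℓ` factor through `T` and
  -- extend to the closure of the range, where the Riesz theorem applies.
  let K : Submodule ℂ H := (LinearMap.range T).topologicalClosure
  have : CompleteSpace K := (Submodule.isClosed_topologicalClosure _).completeSpace_coe
  let e : E →ₗ[ℂ] K := T.codRestrict K fun x =>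
    Submodule.le_topologicalClosure _ (LinearMap.mem_range_self T x)
  have he : DenseRange e := by
    intro y
    rw [closure_subtype]
    have h1 : (y : H) ∈ closure (LinearMap.range T : Set H) := y.2
    convert h1 using 2
    ext z
    simp only [mem_image, mem_range, exists_exists_eq_and, SetLike.mem_coe, LinearMap.mem_range]
    rfl
  let g : K →L[ℂ] ℂ := ℓ.extendOfNorm e
  have hg : ∀ x, g (e x) = ℓ x := LinearMap.extendOfNorm_eq he ⟨C, h⟩
  refine ⟨((InnerProductSpace.toDual ℂ K).symm g : K), ?_, fun x => ?_⟩
  · rw [← Submodule.coe_norm, LinearIsometryEquiv.norm_map]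
    exact LinearMap.opNorm_extendOfNorm_le he hC h
  · rw [← hg x, ← InnerProductSpace.toDual_symm_apply (y := g), Submodule.coe_inner]
    rfl

theorem denseRange_toL2 : DenseRange toL2 :=
  SchwartzMap.denseRange_toLpCLM (p := 2) ENNReal.ofNat_ne_top

theorem exists_bounded_multiplier {g : ℝ → ℂ} (hg : g.HasTemperateGrowth) {C : ℝ}
    (hC : ∀ ξ, ‖g ξ‖ ≤ C) :
    ∃ B : Lp ℂ 2 (volume : Measure ℝ) →L[ℂ] Lp ℂ 2 (volume : Measure ℝ),
      ∀ f, B (toL2 f) = toL2 (mult g f) := by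
  refine ⟨(toL2 ∘L mult g).toLinearMap.extendOfNorm toL2.toLinearMap, fun f =>
    LinearMap.extendOfNorm_eq (f := (toL2 ∘L mult g).toLinearMap) (e := toL2.toLinearMap)
      denseRange_toL2 ⟨C, fun f => ?_⟩ f⟩
  have := norm_toL2_mult_le hg (Function.HasTemperateGrowth.const (1 : ℂ)) (C := C)
    (fun ξ => by simpa using hC ξ) f
  rw [mult, mult, SchwartzMap.fourierMultiplierCLM_const] at this
  simpa using this

theorem inner_toL2_right (g : Lp ℂ 2 (volume : Measure ℝ)) (f : SchwartzMap ℝ ℂ) :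
    inner ℂ g (toL2 f) = ∫ x, star (g x) * f x := by
  rw [L2.inner_def]
  refine integral_congr_ae ?_
  filter_upwards [f.coeFn_toLp 2 volume] with x hx
  rw [toL2_eq, hx]
  simp [mul_comm]

theorem locallyIntegrable_of_memLp {u : ℝ → ℂ} (hu : MemLp u 2 volume) : LocallyIntegrable u volume :=
  hu.locallyIntegrable (by norm_num)

theorem memLp_star {μ : Measure ℝ} {u : ℝ → ℂ} (hu : MemLp u 2 μ) :
    MemLp (fun x => star (u x)) 2 μ := hu.star

theorem eq_zero_of_inner_testFn {g : Lp ℂ 2 (volume : Measure ℝ)}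
    (h : ∀ φ : TestFn, inner ℂ g (toL2 (TestFn.toSchwartz φ)) = 0) : g = 0 := by
  have h1 : ∀ᵐ x, x ∈ (univ : Set ℝ) → star (g x) = 0 :=
    ae_eq_zero_of_integral_testFn isOpen_univ (locallyIntegrable_of_memLp (memLp_star (Lp.memLp g)))
      fun φ _ => by
        rw [← h φ, inner_toL2_right]
        rfl
  rw [Lp.eq_zero_iff_ae_eq_zero]
  filter_upwards [h1] with x hx
  simpa using hx (mem_univ x)

/-- Density of the test functions in `H^s`. For `s ≤ 0` the Bessel potential is bounded on `L²`, and
its adjoint carries `g` to something orthogonal to all test functions, hence to zero. The potential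
maps onto the Schwartz functions, so `g` is orthogonal to these. -/
theorem dense_sob {s : ℝ} (hs : s ≤ 0) {g : Lp ℂ 2 (volume : Measure ℝ)}
    (h : ∀ φ : TestFn, inner ℂ g (sob s φ) = 0) : g = 0 := by
  obtain ⟨B, hB⟩ := exists_bounded_multiplier (weight_hasTemperateGrowth s) (C := 1) fun ξ => by
    rw [norm_weight]
    exact Real.rpow_le_one_of_one_le_of_nonpos (by nlinarith [sq_nonneg ‖ξ‖]) (by linarith)
  have h1 : B.adjoint g = 0 := eq_zero_of_inner_testFn fun φ => by
    rw [ContinuousLinearMap.adjoint_inner_left, hB]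
    exact h φ
  refine denseRange_toL2.eq_zero_of_inner_left (𝕜 := ℂ) fun f => ?_
  have h2 : f = bessel s (bessel (-s) f) := by
    rw [bessel_bessel, add_neg_cancel, bessel_zero]
  rw [h2, ← hB, ← ContinuousLinearMap.adjoint_inner_left, h1, inner_zero_left]

/-- Every bounded functional for the Sobolev norm of order `-α` is a function of class `H^α`. -/
theorem exists_memH_of_inner (α : ℕ) (g : Lp ℂ 2 (volume : Measure ℝ)) :
    ∃ F : ℝ → ℂ, MemH α univ F ∧ ∀ χ : TestFn, ∫ x, F x * χ x = inner ℂ g (sob (-(α : ℝ)) χ) := by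
  -- The symbol `(1 + ξ²)^{-α/2} (2πiξ)^j` is bounded for `j ≤ α`, so the functional composed with
  -- `j` derivatives is still given by a function in `L²`. That function is the weak derivative up
  -- to sign.
  have key : ∀ j ≤ α, ∃ v : ℝ → ℂ, MemLp v 2 volume ∧ ∀ φ : TestFn,
      ∫ x, v x * φ x =
        inner ℂ g (toL2 (bessel (-(α : ℝ)) (mult (derivSymbol j) (TestFn.toSchwartz φ)))) := by
    intro j hj
    obtain ⟨B, hB⟩ := exists_bounded_multiplier
      (g := weight (-(α : ℝ)) * derivSymbol j) ((weight_hasTemperateGrowth _).mul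
        (derivSymbol_hasTemperateGrowth j)) (C := (2 * Real.pi) ^ j) fun ξ => by
      rw [Pi.mul_apply, norm_mul, mul_comm]
      calc _ ≤ (2 * Real.pi) ^ j * ‖weight α ξ‖ * ‖weight (-(α : ℝ)) ξ‖ :=
            mul_le_mul_of_nonneg_right (norm_derivSymbol_le (by exact_mod_cast hj) ξ) (norm_nonneg _)
        _ = (2 * Real.pi) ^ j := by
            rw [mul_assoc, ← norm_mul, ← Pi.mul_apply, weight_mul]
            simp [weight]
    refine ⟨fun x => star (B.adjoint g x), memLp_star (Lp.memLp _), fun φ => ?_⟩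
    rw [SchwartzMap.fourierMultiplierCLM_fourierMultiplierCLM_apply (weight_hasTemperateGrowth _)
      (derivSymbol_hasTemperateGrowth j), ← hB, ← ContinuousLinearMap.adjoint_inner_left,
      inner_toL2_right]
    rfl
  have hD : ∀ (j : ℕ) (φ : TestFn), mult (derivSymbol j) (TestFn.toSchwartz φ) =
      TestFn.toSchwartz (TestFn.iterDeriv j φ) := by
    intro j φ
    ext x
    rw [← derivCLM_iterate_eq_mult, coe_derivCLM_iterate, TestFn.coe_toSchwartz,
      TestFn.toSchwartz_apply, TestFn.coe_iterDeriv]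
  obtain ⟨F, hF, hFi⟩ := key 0 (Nat.zero_le _)
  have hF' : ∀ χ : TestFn, ∫ x, F x * χ x = inner ℂ g (sob (-(α : ℝ)) χ) := by
    intro χ
    have h0 : TestFn.iterDeriv 0 χ = χ := by
      ext
      simp [TestFn.coe_iterDeriv]
    rw [hFi, hD, h0]
    rfl
  refine ⟨F, ⟨by simpa using hF, fun j hj => ?_⟩, hF'⟩
  obtain ⟨v, hv, hvi⟩ := key j hj
  refine ⟨fun x => (-1) ^ j * v x, by simpa using hv.const_mul ((-1) ^ j), fun φ _ => ?_⟩
  have h1 := hF' (TestFn.iterDeriv j φ)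
  rw [TestFn.coe_iterDeriv] at h1
  simp only [Measure.restrict_univ]
  rw [h1, sob_apply, ← hD, ← hvi]
  simp only [mul_assoc]
  rw [integral_const_mul, ← mul_assoc, ← mul_pow]
  norm_num

theorem norm_sob_conj (s : ℝ) (φ : TestFn) : ‖sob s φ.conj‖ = ‖sob s φ‖ := by
  rw [norm_sob, norm_sob, ← sobolevNorm_star]
  simp

/-- The pairing of `H^{-s}` and `H^s`. -/
theorem integral_mul_eq_inner_sob (s : ℝ) (φ ψ : TestFn) :
    ∫ x, star (φ x) * ψ x = inner ℂ (sob (-s) φ) (sob s ψ) := by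
  rw [sob_apply, sob_apply, inner_toL2_bessel, bessel_bessel, neg_add_cancel, bessel_zero,
    inner_toL2]
  rfl

theorem norm_toL2_iterate_deriv_le {j : ℕ} {s : ℝ} (hj : (j : ℝ) ≤ s) (f : SchwartzMap ℝ ℂ) :
    ‖toL2 ((SchwartzMap.derivCLM ℂ ℂ)^[j] f)‖ ≤ (2 * Real.pi) ^ j * ‖toL2 (bessel s f)‖ := by
  rw [derivCLM_iterate_eq_mult]
  exact norm_toL2_mult_le (derivSymbol_hasTemperateGrowth j) (weight_hasTemperateGrowth s)
    (norm_derivSymbol_le hj) f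

/-! ### Functions with weak derivatives in `L²(ℝ)`, as functionals on Schwartz functions -/

/-- `w` and its weak derivatives of order at most `k` are in `L²(ℝ)`, with Schwartz functions as
test functions. -/
def HasWeakDerivs : ℕ → (ℝ → ℂ) → Prop
  | 0, w => MemLp w 2 volume
  | k + 1, w => MemLp w 2 volume ∧ ∃ w' : ℝ → ℂ, HasWeakDerivs k w' ∧
      ∀ ψ : SchwartzMap ℝ ℂ, ∫ x, deriv ψ x * w x = -∫ x, ψ x * w' x

namespace HasWeakDerivs

theorem memLp {k : ℕ} {w : ℝ → ℂ} (h : HasWeakDerivs k w) : MemLp w 2 volume := by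
  cases k with
  | zero => exact h
  | succ k => exact h.1

theorem of_succ {k : ℕ} {w : ℝ → ℂ} (h : HasWeakDerivs (k + 1) w) : HasWeakDerivs k w := by
  induction k generalizing w with
  | zero => exact h.1
  | succ k ih =>
    obtain ⟨h0, w', hw', hi⟩ := h
    exact ⟨h0, w', ih hw', hi⟩

theorem integrable_mul {w : ℝ → ℂ} (h : MemLp w 2 volume) (ψ : SchwartzMap ℝ ℂ) :
    Integrable (fun x => ψ x * w x) :=
  (ψ.memLp 2 volume).integrable_mul h

theorem add {k : ℕ} {v w : ℝ → ℂ} (hv : HasWeakDerivs k v) (hw : HasWeakDerivs k w) :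
    HasWeakDerivs k (fun x => v x + w x) := by
  induction k generalizing v w with
  | zero => exact MemLp.add hv hw
  | succ k ih =>
    obtain ⟨h0, v', hv', hvi⟩ := hv
    obtain ⟨h1, w', hw', hwi⟩ := hw
    refine ⟨h0.add h1, _, ih hv' hw', fun ψ => ?_⟩
    simp only [mul_add]
    have h2 := integrable_mul h0 (SchwartzMap.derivCLM ℂ ℂ ψ)
    have h3 := integrable_mul h1 (SchwartzMap.derivCLM ℂ ℂ ψ)
    simp only [SchwartzMap.derivCLM_apply] at h2 h3
    rw [integral_add h2 h3, integral_add (integrable_mul hv'.memLp ψ) (integrable_mul hw'.memLp ψ),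
      hvi, hwi, neg_add]

theorem testFn (k : ℕ) (φ : TestFn) : HasWeakDerivs k φ := by
  induction k generalizing φ with
  | zero => exact φ.memLp 2 volume
  | succ k ih =>
    refine ⟨φ.memLp 2 volume, _, ih (TestFn.iterDeriv 1 φ), fun ψ => ?_⟩
    have := SchwartzMap.integral_mul_deriv_eq_neg_deriv_mul (TestFn.toSchwartz φ) ψ
    simp only [TestFn.coe_toSchwartz] at this
    rw [TestFn.coe_iterDeriv, iteratedDeriv_one]
    simp only [mul_comm (deriv ψ _), mul_comm (ψ _)]
    exact this

/-- On the Fourier side this is `1 = 1/(1 + ξ²) + ξ²/(1 + ξ²)` with `ξ² = -(2π)⁻² (2πiξ)²`. It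
writes `φ` through a potential two orders smoother and its second derivative. -/
theorem schwartz_eq_bessel (φ : SchwartzMap ℝ ℂ) :
    φ = bessel (-2) φ + (-(2 * Real.pi : ℂ)⁻¹ ^ 2) •
      SchwartzMap.derivCLM ℂ ℂ (SchwartzMap.derivCLM ℂ ℂ (bessel (-2) φ)) := by
  apply (FourierTransform.fourierEquiv ℂ (SchwartzMap ℝ ℂ)).injective
  ext ξ
  change 𝓕 φ ξ = 𝓕 (bessel (-2) φ + (-(2 * Real.pi : ℂ)⁻¹ ^ 2) •
      SchwartzMap.derivCLM ℂ ℂ (SchwartzMap.derivCLM ℂ ℂ (bessel (-2) φ))) ξ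
  rw [derivCLM_eq_mult, derivCLM_eq_mult, FourierTransform.fourier_add,
    FourierTransform.fourier_smul, add_apply, smul_apply,
    fourier_mult_apply (derivSymbol_hasTemperateGrowth 1),
    fourier_mult_apply (derivSymbol_hasTemperateGrowth 1),
    fourier_mult_apply (weight_hasTemperateGrowth _)]
  have h1 : weight (-2) ξ = ((1 + ξ ^ 2 : ℝ) : ℂ)⁻¹ := by
    rw [weight, Real.norm_eq_abs, sq_abs, ← Complex.ofReal_inv, ← Real.rpow_neg_one]
    norm_num
  have h2 : ((1 + ξ ^ 2 : ℝ) : ℂ) ≠ 0 := by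
    norm_cast
    positivity
  have h3 : (Real.pi : ℂ) ≠ 0 := by
    norm_cast
    exact Real.pi_ne_zero
  rw [h1, derivSymbol, pow_one, smul_eq_mul]
  field_simp
  push_cast
  linear_combination (ξ : ℂ) ^ 2 * 𝓕 φ ξ * Complex.I_sq

theorem norm_bessel_le {s t : ℝ} (h : s ≤ t) (φ : SchwartzMap ℝ ℂ) :
    ‖toL2 (bessel s φ)‖ ≤ ‖toL2 (bessel t φ)‖ := by
  have := norm_toL2_mult_le (weight_hasTemperateGrowth s) (weight_hasTemperateGrowth t) (C := 1)
    (fun ξ => by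
      rw [norm_weight, norm_weight, one_mul]
      exact Real.rpow_le_rpow_of_exponent_le (by nlinarith [sq_nonneg ‖ξ‖]) (by linarith)) φ
  rwa [one_mul] at this

theorem norm_bessel_deriv_le (s : ℝ) (φ : SchwartzMap ℝ ℂ) :
    ‖toL2 (bessel s (SchwartzMap.derivCLM ℂ ℂ φ))‖ ≤ 2 * Real.pi * ‖toL2 (bessel (s + 1) φ)‖ := by
  rw [derivCLM_eq_mult, SchwartzMap.fourierMultiplierCLM_fourierMultiplierCLM_apply
    (weight_hasTemperateGrowth s) (derivSymbol_hasTemperateGrowth 1)]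
  refine norm_toL2_mult_le ((weight_hasTemperateGrowth s).mul (derivSymbol_hasTemperateGrowth 1))
    (weight_hasTemperateGrowth _) (fun ξ => ?_) φ
  rw [← weight_mul, Pi.mul_apply, Pi.mul_apply, norm_mul, norm_mul]
  have := norm_derivSymbol_le (j := 1) (s := 1) (by simp) ξ
  rw [pow_one] at this
  nlinarith [norm_nonneg (weight s ξ)]

/-- Induction on `k` with `φ = φ₁ + c φ₁''`, where `φ₁` is two orders smoother. Moving one
derivative from `φ₁''` onto `w` leaves two pairings of weak order `k`, and both are controlled by
the norm of `φ` of order `-(k + 1)`. -/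
theorem exists_bound {k : ℕ} {w : ℝ → ℂ} (h : HasWeakDerivs k w) :
    ∃ C : ℝ, ∀ φ : SchwartzMap ℝ ℂ,
      ‖∫ x, φ x * w x‖ ≤ C * ‖toL2 (bessel (-(k : ℝ)) φ)‖ := by
  induction k generalizing w with
  | zero =>
    refine ⟨‖(memLp_star h).toLp‖, fun φ => ?_⟩
    have : ∫ x, φ x * w x = inner ℂ (memLp_star h).toLp (toL2 φ) := by
      rw [inner_toL2_right]
      refine integral_congr_ae ?_
      filter_upwards [(memLp_star h).coeFn_toLp] with x hx
      rw [hx, star_star, mul_comm]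
    rw [this, Nat.cast_zero, neg_zero, bessel_zero]
    exact norm_inner_le_norm _ _
  | succ k ih =>
    obtain ⟨C₀, hC₀⟩ := ih h.of_succ
    obtain ⟨h0, w', hw', hi⟩ := h
    obtain ⟨C₁, hC₁⟩ := ih hw'
    refine ⟨|C₀| + ‖(-(2 * Real.pi : ℂ)⁻¹ ^ 2)‖ * (|C₁| * (2 * Real.pi)), fun φ => ?_⟩
    set φ₁ := bessel (-2) φ with hφ₁
    set c := (-(2 * Real.pi : ℂ)⁻¹ ^ 2)
    have h1 : ∫ x, φ x * w x = (∫ x, φ₁ x * w x) -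
        c * ∫ x, SchwartzMap.derivCLM ℂ ℂ φ₁ x * w' x := by
      have h2 : ∀ x, φ x * w x = φ₁ x * w x +
          c * (deriv (SchwartzMap.derivCLM ℂ ℂ φ₁) x * w x) := by
        intro x
        have := congrArg (fun f : SchwartzMap ℝ ℂ => f x) (schwartz_eq_bessel φ)
        simp only [add_apply, smul_apply,
          SchwartzMap.derivCLM_apply, smul_eq_mul] at this
        rw [this]
        simp only [φ₁, c]
        ring
      simp only [h2]
      have h3 := integrable_mul h0 (SchwartzMap.derivCLM ℂ ℂ (SchwartzMap.derivCLM ℂ ℂ φ₁))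
      simp only [SchwartzMap.derivCLM_apply ℂ (SchwartzMap.derivCLM ℂ ℂ φ₁)] at h3
      rw [integral_add (integrable_mul h0 φ₁) (h3.const_mul c), integral_const_mul, hi]
      ring
    have hb : ∀ s t : ℝ, s + -2 ≤ t → ‖toL2 (bessel s φ₁)‖ ≤ ‖toL2 (bessel t φ)‖ := by
      intro s t hst
      rw [hφ₁, bessel_bessel]
      exact norm_bessel_le hst φ
    set B := ‖toL2 (bessel (-((k + 1 : ℕ) : ℝ)) φ)‖
    have h4 : ‖∫ x, φ₁ x * w x‖ ≤ |C₀| * B :=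
      (hC₀ φ₁).trans (mul_le_mul (le_abs_self _) (hb _ _ (by push_cast; linarith))
        (norm_nonneg _) (abs_nonneg _))
    have h5 : ‖∫ x, SchwartzMap.derivCLM ℂ ℂ φ₁ x * w' x‖ ≤ |C₁| * (2 * Real.pi * B) := by
      refine (hC₁ _).trans (mul_le_mul (le_abs_self _) ?_ (norm_nonneg _) (abs_nonneg _))
      refine (norm_bessel_deriv_le _ _).trans (mul_le_mul_of_nonneg_left ?_ (by positivity))
      exact hb _ _ (by push_cast; linarith)
    rw [h1]
    refine (norm_sub_le _ _).trans ?_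
    rw [norm_mul]
    calc _ ≤ |C₀| * B + ‖c‖ * (|C₁| * (2 * Real.pi * B)) :=
          add_le_add h4 (mul_le_mul_of_nonneg_left h5 (norm_nonneg _))
      _ = _ := by ring

/-- A cut-off iterated primitive of a locally square integrable function. -/
theorem mul_iterate_prim (a : ℝ) (i : ℕ) {g : ℝ → ℂ} (hg : LocallyIntegrable g)
    (hg2 : ∀ χ : TestFn, MemLp (fun x => χ x * g x) 2 volume) (χ : TestFn) :
    HasWeakDerivs i (fun x => χ x * (prim a)^[i] g x) := by
  induction i generalizing g χ with
  | zero => exact hg2 χ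
  | succ i ih =>
    have hcont : ∀ f : ℝ → ℂ, Continuous f → ∀ χ : TestFn, MemLp (fun x => χ x * f x) 2 volume :=
      fun f hf χ => (χ.smooth.continuous.mul hf).memLp_of_hasCompactSupport
        χ.hasCompactSupport.mul_right
    have h1 := ih hg hg2 χ
    -- Product rule: the term with `χ'` still contains `i + 1` primitives and is read as the
    -- `i`-fold primitive of `prim a g`, so that the induction hypothesis applies to it.
    have h2 := ih (continuous_prim a hg).locallyIntegrable (hcont _ (continuous_prim a hg))
      (TestFn.iterDeriv 1 χ)
    have hG := LocInt.iterate_prim a hg i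
    refine ⟨?_, _, h1.add h2, fun ψ => ?_⟩
    · rw [Function.iterate_succ_apply']
      exact hcont _ (continuous_prim a hG) χ
    · rw [← Function.iterate_succ_apply, Function.iterate_succ_apply']
      have hψχ : ∀ x, HasDerivAt (fun x => ψ x * χ x) (deriv ψ x * χ x + ψ x * deriv χ x) x :=
        fun x => (ψ.hasDerivAt x).mul (χ.differentiable x).hasDerivAt
      let θ : TestFn := TestFn.mkSmooth (fun x => ψ x * χ x) ((ψ.smooth ⊤).mul χ.smooth)
        χ.hasCompactSupport.mul_left
      have h3 := integral_mul_testFn_eq_prim a hG 0 θ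
      have h4 : deriv θ = fun x => deriv ψ x * χ x + ψ x * deriv χ x := funext fun x => (hψχ x).deriv
      rw [h4] at h3
      simp only [zero_add, θ, TestFn.mkSmooth_apply] at h3
      simp only [TestFn.coe_iterDeriv, iteratedDeriv_one, mul_add]
      have i1 := integrable_mul h1.memLp ψ
      have h2m := h2.memLp
      rw [TestFn.coe_iterDeriv, iteratedDeriv_one, ← Function.iterate_succ_apply,
        Function.iterate_succ_apply'] at h2m
      have i2 := integrable_mul h2m ψ
      have i3 := integrable_mul (hcont _ (continuous_prim a hG) χ) (SchwartzMap.derivCLM ℂ ℂ ψ)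
      simp only [SchwartzMap.derivCLM_apply] at i3
      rw [integral_add i1 i2, neg_add]
      have h5 : ∫ x, prim a ((prim a)^[i] g) x * (deriv ψ x * χ x + ψ x * deriv χ x) =
          (∫ x, deriv ψ x * (χ x * prim a ((prim a)^[i] g) x)) +
            ∫ x, ψ x * (deriv χ x * prim a ((prim a)^[i] g) x) := by
        rw [← integral_add i3 i2]
        congr 1 with x
        ring
      have h6 : ∫ x, (prim a)^[i] g x * (ψ x * χ x) = ∫ x, ψ x * (χ x * (prim a)^[i] g x) := by
        congr 1 with x
        ring
      rw [h5, h6] at h3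
      linear_combination h3

end HasWeakDerivs

/-! ### The Sobolev space `H^α(0, L)` -/

/-- Schwartz functions, restricted to the interval. -/
def resL2 (L : ℝ) : SchwartzMap ℝ ℂ →L[ℂ] Lp ℂ 2 (volume.restrict (Ioo 0 L)) :=
  SchwartzMap.toLpCLM ℂ ℂ 2 (volume.restrict (Ioo 0 L))

theorem coeFn_resL2 (L : ℝ) (f : SchwartzMap ℝ ℂ) : resL2 L f =ᵐ[volume.restrict (Ioo 0 L)] f :=
  f.coeFn_toLp 2 _

theorem inner_resL2 (L : ℝ) (f : SchwartzMap ℝ ℂ) (u : Lp ℂ 2 (volume.restrict (Ioo 0 L))) :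
    inner ℂ (resL2 L f) u = ∫ x in Ioo 0 L, star (f x) * u x := by
  rw [L2.inner_def]
  refine integral_congr_ae ?_
  filter_upwards [coeFn_resL2 L f] with x hx
  rw [hx]
  simp [mul_comm]

theorem inner_resL2_right (L : ℝ) (u : Lp ℂ 2 (volume.restrict (Ioo 0 L))) (f : SchwartzMap ℝ ℂ) :
    inner ℂ u (resL2 L f) = ∫ x in Ioo 0 L, star (u x) * f x := by
  rw [L2.inner_def]
  refine integral_congr_ae ?_
  filter_upwards [coeFn_resL2 L f] with x hx
  rw [hx]
  simp [mul_comm]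

theorem norm_resL2_sq (L : ℝ) (f : SchwartzMap ℝ ℂ) :
    ‖resL2 L f‖ ^ 2 = ∫ x in Ioo 0 L, ‖f x‖ ^ 2 := by
  change ‖f.toLp 2 (volume.restrict (Ioo 0 L))‖ ^ 2 = _
  rw [SchwartzMap.norm_toLp' (by norm_num) (by norm_num)]
  simp only [ENNReal.toReal_ofNat, Real.rpow_ofNat]
  rw [← Real.rpow_natCast, ← Real.rpow_mul (integral_nonneg fun x => by positivity)]
  norm_num

theorem norm_resL2_le (L : ℝ) (f : SchwartzMap ℝ ℂ) : ‖resL2 L f‖ ≤ ‖toL2 f‖ := by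
  refine le_of_sq_le_sq ?_ (norm_nonneg _)
  rw [norm_resL2_sq, norm_toL2_sq]
  exact setIntegral_le_integral ((f.memLp 2 volume).integrable_norm_pow (by norm_num))
    (.of_forall fun x => by positivity)

/-- The test functions with support in `Ω`. -/
def testOn (Ω : Set ℝ) : Submodule ℂ TestFn where
  carrier := {φ | tsupport φ ⊆ Ω}
  zero_mem' := by
    change tsupport (0 : ℝ → ℂ) ⊆ Ω
    simp
  add_mem' {φ ψ} hφ hψ := (tsupport_add (φ : ℝ → ℂ) ψ).trans (union_subset hφ hψ)
  smul_mem' c φ hφ := (tsupport_smul_subset_right (fun _ => c) (φ : ℝ → ℂ)).trans hφ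

/-- The space of all weak `k`-jets of functions of `H^k(0, L)`. -/
def jetSpace (k : ℕ) (L : ℝ) :
    Submodule ℂ (PiLp 2 fun _ : Fin (k + 1) => Lp ℂ 2 (volume.restrict (Ioo 0 L))) where
  carrier := {v | ∀ j : Fin (k + 1), ∀ φ : TestFn, tsupport φ ⊆ Ioo 0 L →
    inner ℂ (resL2 L (TestFn.toSchwartz (TestFn.iterDeriv j φ).conj)) (v 0) =
      (-1) ^ (j : ℕ) * inner ℂ (resL2 L (TestFn.toSchwartz φ.conj)) (v j)}
  zero_mem' j φ _ := by simp
  add_mem' {v w} hv hw j φ hφ := by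
    simp only [PiLp.add_apply, inner_add_right, mul_add, hv j φ hφ, hw j φ hφ]
  smul_mem' c v hv j φ hφ := by
    simp only [PiLp.smul_apply, inner_smul_right, hv j φ hφ]
    ring

theorem isClosed_jetSpace (k : ℕ) (L : ℝ) :
    IsClosed (jetSpace k L :
      Set (PiLp 2 fun _ : Fin (k + 1) => Lp ℂ 2 (volume.restrict (Ioo 0 L)))) := by
  simp only [jetSpace, Submodule.coe_set_mk, AddSubmonoid.coe_set_mk, AddSubsemigroup.coe_set_mk,
    ofPred_forall]
  refine isClosed_iInter fun j => isClosed_iInter fun φ => isClosed_iInter fun _ => ?_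
  exact isClosed_eq (by fun_prop) (by fun_prop)

/-- The Hilbert space `H^k(0, L)`, as the space of the weak `k`-jets. -/
def JetSpace (k : ℕ) (L : ℝ) : Type := jetSpace k L

instance (k : ℕ) (L : ℝ) : NormedAddCommGroup (JetSpace k L) :=
  inferInstanceAs (NormedAddCommGroup (jetSpace k L))

instance (k : ℕ) (L : ℝ) : InnerProductSpace ℂ (JetSpace k L) :=
  Submodule.innerProductSpace (jetSpace k L)

instance (k : ℕ) (L : ℝ) : Inner ℂ (JetSpace k L) := InnerProductSpace.toInner

instance (k : ℕ) (L : ℝ) : CompleteSpace (JetSpace k L) :=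
  (isClosed_jetSpace k L).completeSpace_coe

/-- The jet of order `j` of an element of `H^k(0, L)`. -/
def JetSpace.coord {k : ℕ} {L : ℝ} (v : JetSpace k L) (j : Fin (k + 1)) :
    Lp ℂ 2 (volume.restrict (Ioo 0 L)) :=
  (Subtype.val v : PiLp 2 fun _ : Fin (k + 1) => Lp ℂ 2 (volume.restrict (Ioo 0 L))) j

theorem JetSpace.ext {k : ℕ} {L : ℝ} {v w : JetSpace k L} (h : ∀ j, v.coord j = w.coord j) :
    v = w :=
  Subtype.ext (PiLp.ext h)

theorem JetSpace.norm_eq {k : ℕ} {L : ℝ} (v : JetSpace k L) :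
    ‖v‖ = √(∑ j, ‖v.coord j‖ ^ 2) :=
  PiLp.norm_eq_of_L2 (Subtype.val v :
    PiLp 2 fun _ : Fin (k + 1) => Lp ℂ 2 (volume.restrict (Ioo 0 L)))

theorem JetSpace.inner_eq {k : ℕ} {L : ℝ} (v w : JetSpace k L) :
    inner ℂ v w = ∑ j, inner ℂ (v.coord j) (w.coord j) :=
  PiLp.inner_apply (Subtype.val v :
    PiLp 2 fun _ : Fin (k + 1) => Lp ℂ 2 (volume.restrict (Ioo 0 L))) _

theorem mem_jetSpace_iff {k : ℕ} {L : ℝ}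
    {v : PiLp 2 fun _ : Fin (k + 1) => Lp ℂ 2 (volume.restrict (Ioo 0 L))} :
    v ∈ jetSpace k L ↔ ∀ j : Fin (k + 1), IsWeakDeriv (Ioo 0 L) j (v 0) (v j) := by
  refine forall_congr' fun j => forall_congr' fun φ => imp_congr_right fun _ => ?_
  rw [inner_resL2, inner_resL2]
  simp only [TestFn.toSchwartz_apply, TestFn.conj_apply, star_star, TestFn.coe_iterDeriv,
    mul_comm _ ((v _ : ℝ → ℂ) _)]

theorem isWeakDeriv_of_smooth {Ω : Set ℝ} {u : ℝ → ℂ} (hu : ContDiff ℝ ∞ u) (j : ℕ) :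
    IsWeakDeriv Ω j u (iteratedDeriv j u) := by
  intro φ hφ
  have h1 := integral_mul_iteratedDeriv_testFn hu j φ
  have h2 := TestFn.integral_eq (φ := TestFn.iterDeriv j φ)
    ((TestFn.tsupport_iterDeriv j φ).trans hφ) u
  rw [TestFn.coe_iterDeriv] at h2
  rw [h2, h1, TestFn.integral_eq hφ]

theorem IsWeakDeriv.congr {Ω : Set ℝ} {j : ℕ} {u u' v v' : ℝ → ℂ} (h : IsWeakDeriv Ω j u v)
    (hu : u' =ᵐ[volume.restrict Ω] u) (hv : v' =ᵐ[volume.restrict Ω] v) :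
    IsWeakDeriv Ω j u' v' := by
  intro φ hφ
  have h1 : ∫ x in Ω, u' x * iteratedDeriv j φ x = ∫ x in Ω, u x * iteratedDeriv j φ x :=
    integral_congr_ae (by filter_upwards [hu] with x hx; rw [hx])
  have h2 : ∫ x in Ω, v' x * φ x = ∫ x in Ω, v x * φ x :=
    integral_congr_ae (by filter_upwards [hv] with x hx; rw [hx])
  rw [h1, h2, h φ hφ]

theorem JetSpace.isWeakDeriv {k : ℕ} {L : ℝ} (v : JetSpace k L) (j : Fin (k + 1)) :
    IsWeakDeriv (Ioo 0 L) j (v.coord 0) (v.coord j) :=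
  mem_jetSpace_iff.1 (Subtype.property v) j

/-- The jet of a Schwartz function. -/
def schwartzJet (k : ℕ) (L : ℝ) : SchwartzMap ℝ ℂ →ₗ[ℂ] JetSpace k L where
  toFun f := ⟨WithLp.toLp 2 fun j => resL2 L ((SchwartzMap.derivCLM ℂ ℂ ^ (j : ℕ)) f), by
    rw [mem_jetSpace_iff]
    intro j
    refine (isWeakDeriv_of_smooth (f.smooth ⊤) j).congr ?_ ?_
    · exact (coeFn_resL2 L _).trans (by simp)
    · refine (coeFn_resL2 L _).trans ?_
      rw [FunLike.coe_pow_eq_iterate, coe_derivCLM_iterate]⟩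
  map_add' f g := Subtype.ext (PiLp.ext fun j => by
    simp only [map_add]
    rfl)
  map_smul' c f := Subtype.ext (PiLp.ext fun j => by
    simp only [map_smul]
    rfl)

theorem schwartzJet_apply (k : ℕ) (L : ℝ) (f : SchwartzMap ℝ ℂ) (j : Fin (k + 1)) :
    (schwartzJet k L f).coord j = resL2 L ((SchwartzMap.derivCLM ℂ ℂ)^[j] f) := by
  rw [← FunLike.coe_pow_eq_iterate]
  rfl

/-- The jet of a test function. -/
def testJet (k : ℕ) (L : ℝ) : TestFn →ₗ[ℂ] JetSpace k L := schwartzJet k L ∘ₗ TestFn.toSchwartz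

theorem testJet_apply (k : ℕ) (L : ℝ) (φ : TestFn) (j : Fin (k + 1)) :
    (testJet k L φ).coord j = resL2 L (TestFn.toSchwartz (TestFn.iterDeriv j φ)) := by
  rw [testJet, LinearMap.comp_apply, schwartzJet_apply]
  congr 1
  ext x
  rw [coe_derivCLM_iterate, TestFn.coe_toSchwartz, TestFn.toSchwartz_apply, TestFn.coe_iterDeriv]

theorem norm_testJet (k : ℕ) (L : ℝ) (φ : TestFn) : ‖testJet k L φ‖ =
    √(∑ j ∈ Finset.range (k + 1), ∫ x in Ioo 0 L, ‖iteratedDeriv j φ x‖ ^ 2) := by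
  rw [JetSpace.norm_eq, Finset.sum_range]
  congr 1
  refine Finset.sum_congr rfl fun j _ => ?_
  rw [testJet_apply, norm_resL2_sq]
  simp only [TestFn.toSchwartz_apply, TestFn.coe_iterDeriv]

theorem norm_schwartzJet_le (k : ℕ) (L : ℝ) : ∃ C ≥ 0, ∀ f : SchwartzMap ℝ ℂ,
    ‖schwartzJet k L f‖ ≤ C * ‖toL2 (bessel k f)‖ := by
  refine ⟨√(∑ j : Fin (k + 1), ((2 * Real.pi) ^ (j : ℕ)) ^ 2), Real.sqrt_nonneg _, fun f => ?_⟩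
  rw [JetSpace.norm_eq]
  refine Real.sqrt_le_iff.2 ⟨by positivity, ?_⟩
  rw [mul_pow, Real.sq_sqrt (Finset.sum_nonneg fun j _ => by positivity), Finset.sum_mul]
  refine Finset.sum_le_sum fun j _ => ?_
  rw [schwartzJet_apply, ← mul_pow]
  refine pow_le_pow_left₀ (norm_nonneg _) ((norm_resL2_le L _).trans ?_) 2
  exact norm_toL2_iterate_deriv_le (by exact_mod_cast Nat.lt_succ_iff.1 j.2) f

/-- The function part of a jet. -/
def jetFun (k : ℕ) (L : ℝ) : JetSpace k L →L[ℂ] Lp ℂ 2 (volume.restrict (Ioo 0 L)) :=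
  PiLp.proj 2 (fun _ : Fin (k + 1) => Lp ℂ 2 (volume.restrict (Ioo 0 L))) 0 ∘L (jetSpace k L).subtypeL

theorem jetFun_apply (k : ℕ) (L : ℝ) (v : JetSpace k L) : jetFun k L v = v.coord 0 := rfl

/-- The functional `v ↦ ∫₀^L conj v φ`, as an element of the jet space. -/
def pairing (k : ℕ) (L : ℝ) : TestFn →ₗ[ℂ] JetSpace k L :=
  (ContinuousLinearMap.adjoint (jetFun k L)).toLinearMap ∘ₗ (resL2 L).toLinearMap ∘ₗ
    TestFn.toSchwartz

theorem inner_pairing (k : ℕ) (L : ℝ) (v : JetSpace k L) (φ : TestFn) :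
    inner ℂ v (pairing k L φ) = ∫ x in Ioo 0 L, star (jetFun k L v x) * φ x := by
  change inner ℂ v (ContinuousLinearMap.adjoint (jetFun k L) (resL2 L (TestFn.toSchwartz φ))) = _
  rw [ContinuousLinearMap.adjoint_inner_right, inner_resL2_right]
  rfl

theorem jetFun_testJet (k : ℕ) (L : ℝ) (φ : TestFn) :
    jetFun k L (testJet k L φ) =ᵐ[volume.restrict (Ioo 0 L)] φ := by
  rw [jetFun_apply, testJet_apply]
  exact (coeFn_resL2 L _).trans (by simp [TestFn.coe_toSchwartz, TestFn.coe_iterDeriv])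

theorem locallyIntegrable_indicator {L : ℝ} {u : ℝ → ℂ}
    (hu : MemLp u 2 (volume.restrict (Ioo 0 L))) :
    LocallyIntegrable ((Ioo 0 L).indicator u) volume :=
  ((integrable_indicator_iff measurableSet_Ioo).2 (hu.integrable (by norm_num))).locallyIntegrable

theorem integral_indicator_mul {L : ℝ} (u φ : ℝ → ℂ) :
    ∫ x, (Ioo 0 L).indicator u x * φ x = ∫ x in Ioo 0 L, u x * φ x := by
  rw [← integral_indicator measurableSet_Ioo]
  congr 1 with x
  by_cases hx : x ∈ Ioo 0 L <;> simp [hx]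

theorem ae_eq_zero_on_interval {L : ℝ} {u : ℝ → ℂ} (hu : MemLp u 2 (volume.restrict (Ioo 0 L)))
    (h : ∀ φ : TestFn, tsupport φ ⊆ Ioo 0 L → ∫ x in Ioo 0 L, u x * φ x = 0) :
    u =ᵐ[volume.restrict (Ioo 0 L)] 0 := by
  have := ae_eq_zero_of_integral_testFn isOpen_Ioo (locallyIntegrable_indicator hu)
    (fun φ hφ => by rw [integral_indicator_mul, h φ hφ])
  rw [Filter.EventuallyEq, ae_restrict_iff' measurableSet_Ioo]
  filter_upwards [this] with x hx hx'
  simpa [hx'] using hx hx'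

theorem jet_eq_zero {k : ℕ} {L : ℝ} {v : JetSpace k L} (h : jetFun k L v = 0) : v = 0 := by
  refine JetSpace.ext fun j => ?_
  have hv := v.isWeakDeriv j
  refine (Lp.eq_zero_iff_ae_eq_zero).2 (ae_eq_zero_on_interval (Lp.memLp _) fun φ hφ => ?_)
  have h1 := hv φ hφ
  rw [jetFun_apply] at h
  rw [h] at h1
  have h2 : ∫ x in Ioo 0 L, (0 : Lp ℂ 2 (volume.restrict (Ioo 0 L))) x *
      iteratedDeriv j φ x = 0 := by
    rw [← integral_zero ℝ ℂ (μ := volume.restrict (Ioo 0 L))]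
    refine integral_congr_ae ?_
    filter_upwards [Lp.coeFn_zero ℂ 2 (volume.restrict (Ioo 0 L))] with x hx
    rw [hx]
    simp
  rw [h2] at h1
  simpa using h1.symm

theorem jet_eq_zero_of_pairing {k : ℕ} {L : ℝ} {v : JetSpace k L}
    (h : ∀ φ : TestFn, tsupport φ ⊆ Ioo 0 L → inner ℂ v (pairing k L φ) = 0) : v = 0 := by
  refine jet_eq_zero ((Lp.eq_zero_iff_ae_eq_zero).2 ?_)
  have := ae_eq_zero_on_interval (memLp_star (Lp.memLp (jetFun k L v))) fun φ hφ => by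
    rw [← inner_pairing, h φ hφ]
  filter_upwards [this] with x hx
  simpa using hx

theorem exists_jet {k : ℕ} {L : ℝ} {f : ℝ → ℂ} (hf : MemH k (Ioo 0 L) f) :
    ∃ v : JetSpace k L, jetFun k L v =ᵐ[volume.restrict (Ioo 0 L)] f := by
  -- Order zero is forced to be `f` itself, so that the jet really has `f` as its function part.
  have : ∀ j : Fin (k + 1), ∃ v : ℝ → ℂ, MemLp v 2 (volume.restrict (Ioo 0 L)) ∧
      IsWeakDeriv (Ioo 0 L) j f v ∧ (j = 0 → v = f) := by
    intro j
    by_cases hj : j = 0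
    · subst hj
      exact ⟨f, hf.1, fun φ _ => by simp, fun _ => rfl⟩
    · obtain ⟨v, h1, h2⟩ := hf.2 j (Nat.lt_succ_iff.1 j.2)
      exact ⟨v, h1, h2, fun h => absurd h hj⟩
  choose v hv hvw hv0 using this
  refine ⟨⟨WithLp.toLp 2 fun j => (hv j).toLp, mem_jetSpace_iff.2 fun j => ?_⟩, ?_⟩
  · refine (hvw j).congr ?_ (hv j).coeFn_toLp
    simp only
    rw [← hv0 0 rfl]
    exact (hv 0).coeFn_toLp
  · change ((hv 0).toLp : ℝ → ℂ) =ᵐ[volume.restrict (Ioo 0 L)] f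
    rw [← hv0 0 rfl]
    exact (hv 0).coeFn_toLp

/-! ### The dual norm of `H^k(0, L)` is the Sobolev norm of order `-k` -/

/-- A function of `H^k(0, L)` agrees on the interval with a function of `H^k(ℝ)`. -/
theorem exists_extension {k : ℕ} {L : ℝ} (hL : 0 < L) (v : JetSpace k L) :
    ∃ w : ℝ → ℂ, HasWeakDerivs k w ∧ ∀ᵐ x, x ∈ Ioo 0 L → w x = jetFun k L v x := by
  -- The extension integrates the top weak derivative, continued by zero, `k` times. On the interval
  -- this differs from the function by a polynomial; that is added, and everything is cut off.
  set u : ℝ → ℂ := (Ioo 0 L).indicator (jetFun k L v)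
  set g : ℝ → ℂ := (Ioo 0 L).indicator (v.coord (Fin.last k))
  have hu : LocallyIntegrable u := locallyIntegrable_indicator (Lp.memLp _)
  have hg : LocallyIntegrable g := locallyIntegrable_indicator (Lp.memLp _)
  have hg2 : MemLp g 2 volume := (memLp_indicator_iff_restrict measurableSet_Ioo).2 (Lp.memLp _)
  have hG := LocInt.iterate_prim 0 hg k
  have hw : ∀ φ : TestFn, tsupport φ ⊆ Ioo 0 L →
      ∫ x, (u x - (prim 0)^[k] g x) * iteratedDeriv k φ x = 0 := by
    intro φ hφ
    have h1 := integral_mul_iteratedDeriv_eq_iterate_prim 0 hg φ k 0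
    have h2 := v.isWeakDeriv (Fin.last k) φ hφ
    simp only [sub_mul]
    rw [integral_sub (LocInt.integrable_mul_iteratedDeriv hu φ k)
      (LocInt.integrable_mul_iteratedDeriv hG φ k), integral_indicator_mul, jetFun_apply]
    rw [integral_indicator_mul, iteratedDeriv_zero, zero_add] at h1
    rw [Fin.val_last] at h2
    rw [h2, h1, ← mul_assoc, ← mul_pow]
    norm_num
  obtain ⟨c, hc⟩ := ae_eq_polynomial_of_iteratedDeriv isOpen_Ioo ordConnected_Ioo
    (nonempty_Ioo.2 hL) k (LocInt.sub hu hG) hw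
  obtain ⟨χ, -, hχ⟩ := TestFn.exists_cutoff (a := 0) (b := L) (a' := -1) (b' := L + 1)
    (by linarith) (by linarith)
  let P : TestFn := TestFn.smoothMul _ (contDiff_polynomial c k) χ
  refine ⟨_, (HasWeakDerivs.testFn k P).add (HasWeakDerivs.mul_iterate_prim 0 k hg
    (fun θ => ?_) χ), ?_⟩
  · obtain ⟨C, hC⟩ := θ.smooth.continuous.bounded_above_of_compact_support θ.hasCompactSupport
    exact hg2.mul (p := ⊤) (q := 2)
      (memLp_top_of_bound θ.smooth.continuous.aestronglyMeasurable C (.of_forall hC))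
  · filter_upwards [hc] with x hx hxΩ
    have h1 := (hχ x ⟨hxΩ.1.le, hxΩ.2.le⟩).self_of_nhds
    have h2 := hx hxΩ
    simp only [u, indicator_of_mem hxΩ] at h2
    simp only [P, TestFn.coe_smoothMul, h1, one_mul, mul_one]
    rw [← h2]
    ring

/-- For fixed `v`, an extension to the line bounds the pairing with `φ` by `‖φ‖_{-k}`, with a
constant depending on `v`. The uniform boundedness principle removes this dependence, so no norm
control of the extension is needed. -/
theorem norm_pairing_le {k : ℕ} {L : ℝ} (hL : 0 < L) : ∃ C : ℝ, 0 ≤ C ∧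
    ∀ φ : TestFn, tsupport φ ⊆ Ioo 0 L → ‖pairing k L φ‖ ≤ C * ‖sob (-(k : ℝ)) φ‖ := by
  have hv : ∀ v : JetSpace k L, ∃ C : ℝ, ∀ φ : TestFn, tsupport φ ⊆ Ioo 0 L →
      ‖inner ℂ (pairing k L φ) v‖ ≤ C * ‖sob (-(k : ℝ)) φ‖ := by
    intro v
    obtain ⟨w, hw, hwv⟩ := exists_extension hL v
    obtain ⟨C, hC⟩ := hw.exists_bound
    refine ⟨C, fun φ hφ => ?_⟩
    have h1 := hC (TestFn.toSchwartz φ.conj)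
    rw [← sob_apply, norm_sob_conj] at h1
    convert h1 using 2
    rw [← inner_conj_symm, inner_pairing, ← integral_conj]
    have h2 := TestFn.integral_eq ((TestFn.tsupport_conj φ).trans hφ) w
    simp only [TestFn.toSchwartz_apply, mul_comm _ (w _)]
    rw [← h2]
    refine integral_congr_ae ?_
    rw [Filter.EventuallyEq, ae_restrict_iff' measurableSet_Ioo]
    filter_upwards [hwv] with x hx hxΩ
    rw [hx hxΩ]
    simp
  have hbs := banach_steinhaus (𝕜 := ℂ) (𝕜₂ := ℂ) (E := JetSpace k L) (F := ℂ)
    (ι := testOn (Ioo 0 L))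
    (g := fun φ => innerSL ℂ (((‖sob (-(k : ℝ)) φ.1‖⁻¹ : ℝ) : ℂ) • pairing k L φ.1))
    (fun v => by
      obtain ⟨C, hC⟩ := hv v
      refine ⟨|C|, fun φ => ?_⟩
      rw [innerSL_apply_apply, inner_smul_left, norm_mul, Complex.conj_ofReal, Complex.norm_real,
        norm_inv, norm_norm]
      rcases (norm_nonneg (sob (-(k : ℝ)) φ.1)).eq_or_lt with h0 | h0
      · rw [← h0, inv_zero, zero_mul]
        positivity
      · rw [inv_mul_le_iff₀ h0, mul_comm]
        exact (hC φ.1 φ.2).trans (mul_le_mul_of_nonneg_right (le_abs_self _) h0.le))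
  obtain ⟨C, hC⟩ := hbs
  refine ⟨|C|, abs_nonneg _, fun φ hφ => ?_⟩
  rcases (norm_nonneg (sob (-(k : ℝ)) φ)).eq_or_lt with h0 | h0
  -- Here the normalising factor is `0⁻¹ = 0` and the uniform bound is empty; the bound for the
  -- single vector `pairing k L φ` shows that it vanishes.
  · obtain ⟨C', hC'⟩ := hv (pairing k L φ)
    have := hC' φ hφ
    rw [← h0, mul_zero, norm_le_zero_iff, inner_self_eq_zero] at this
    rw [this, ← h0]
    simp
  · have := hC ⟨φ, hφ⟩
    rw [innerSL_apply_norm, norm_smul, Complex.norm_real, norm_inv, norm_norm,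
      inv_mul_le_iff₀ h0, mul_comm] at this
    exact this.trans (mul_le_mul_of_nonneg_right (le_abs_self _) h0.le)

/-- `‖φ‖_{-k}²` is the pairing of `φ` with `u`, the Bessel potential of order `-2k` of `φ`, and `u`
has norm `‖φ‖_{-k}` in `H^k`. As `φ` lives on the interval, only the restriction of `u` matters. -/
theorem norm_sob_le_norm_pairing (k : ℕ) (L : ℝ) : ∃ C : ℝ, 0 ≤ C ∧
    ∀ φ : TestFn, tsupport φ ⊆ Ioo 0 L → ‖sob (-(k : ℝ)) φ‖ ≤ C * ‖pairing k L φ‖ := by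
  obtain ⟨C, hC0, hC⟩ := norm_schwartzJet_le k L
  refine ⟨C, hC0, fun φ hφ => ?_⟩
  rcases (norm_nonneg (sob (-(k : ℝ)) φ)).eq_or_lt with h0 | h0
  · rw [← h0]
    positivity
  set u := bessel (-(k : ℝ) + -(k : ℝ)) (TestFn.toSchwartz φ) with hu
  have h1 : ‖schwartzJet k L u‖ ≤ C * ‖sob (-(k : ℝ)) φ‖ := by
    refine (hC u).trans_eq ?_
    rw [hu, bessel_bessel, sob_apply]
    have : (k : ℝ) + (-(k : ℝ) + -(k : ℝ)) = -(k : ℝ) := by ring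
    rw [this]
  have h2 : (‖sob (-(k : ℝ)) φ‖ : ℂ) ^ 2 = inner ℂ (pairing k L φ) (schwartzJet k L u) := by
    have h3 : inner ℂ (sob (-(k : ℝ)) φ) (sob (-(k : ℝ)) φ) =
        inner ℂ (toL2 (TestFn.toSchwartz φ)) (toL2 u) := by
      rw [sob_apply, inner_toL2_bessel, bessel_bessel]
    rw [inner_self_eq_norm_sq_to_K] at h3
    refine h3.trans ?_
    rw [← inner_conj_symm (pairing k L φ), inner_pairing, ← integral_conj, inner_toL2]
    have h4 := TestFn.integral_eq ((TestFn.tsupport_conj φ).trans hφ) u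
    have h5 : ∀ x, star (TestFn.toSchwartz φ x) * u x = u x * φ.conj x := fun x => by
      simp [mul_comm]
    simp only [h5]
    rw [← h4]
    refine integral_congr_ae ?_
    have h6 : jetFun k L (schwartzJet k L u) =ᵐ[volume.restrict (Ioo 0 L)] u := by
      rw [jetFun_apply, schwartzJet_apply]
      exact coeFn_resL2 L _
    filter_upwards [h6] with x hx
    rw [hx]
    simp
  have h3 : ‖sob (-(k : ℝ)) φ‖ ^ 2 ≤ ‖pairing k L φ‖ * (C * ‖sob (-(k : ℝ)) φ‖) := by
    have h4 := congrArg norm h2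
    rw [norm_pow, Complex.norm_real, norm_norm] at h4
    rw [h4]
    exact (norm_inner_le_norm _ _).trans (mul_le_mul_of_nonneg_left h1 (norm_nonneg _))
  have h4 : ‖sob (-(k : ℝ)) φ‖ * ‖sob (-(k : ℝ)) φ‖ ≤
      C * ‖pairing k L φ‖ * ‖sob (-(k : ℝ)) φ‖ := by
    calc _ = ‖sob (-(k : ℝ)) φ‖ ^ 2 := (sq _).symm
      _ ≤ _ := h3
      _ = _ := by ring
  exact le_of_mul_le_mul_right h4 h0

/-! ### Abstract lemmas on sesquilinear forms -/

section HilbertSpace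

variable {E V : Type*} [AddCommGroup E] [Module ℂ E] [NormedAddCommGroup V] [InnerProductSpace ℂ V]

theorem denseRange_of_inner_eq_zero [CompleteSpace V] (e : E →ₗ[ℂ] V)
    (h : ∀ g : V, (∀ x, inner ℂ g (e x) = 0) → g = 0) :
    DenseRange e := by
  have h1 : (LinearMap.range e).topologicalClosure = ⊤ := by
    rw [Submodule.topologicalClosure_eq_top_iff, Submodule.eq_bot_iff]
    intro g hg
    refine h g fun x => ?_
    exact (Submodule.mem_orthogonal' _ _).1 hg _ (LinearMap.mem_range_self e x)
  intro x
  have h2 : x ∈ (LinearMap.range e).topologicalClosure := h1 ▸ Submodule.mem_top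
  rw [← SetLike.mem_coe, Submodule.topologicalClosure_coe, LinearMap.coe_range] at h2
  exact h2

theorem norm_le_of_norm_inner_le {e : E →ₗ[ℂ] V} (he : DenseRange e) {y : V} {M : ℝ}
    (hM : 0 ≤ M) (h : ∀ x, ‖inner ℂ (e x) y‖ ≤ M * ‖e x‖) : ‖y‖ ≤ M := by
  have h1 : ∀ z : V, ‖inner ℂ z y‖ ≤ M * ‖z‖ := fun z =>
    he.induction_on z (isClosed_le (by fun_prop) (by fun_prop)) h
  rcases (norm_nonneg y).eq_or_lt with h0 | h0
  · rw [← h0]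
    exact hM
  · have h2 := h1 y
    rw [inner_self_eq_norm_sq_to_K, norm_pow] at h2
    have h3 : ‖y‖ * ‖y‖ ≤ M * ‖y‖ := by
      simpa [sq] using h2
    exact le_of_mul_le_mul_right h3 h0

/-- The Lax-Milgram lemma, for a form given on a dense subspace. -/
theorem exists_unique_of_coercive [CompleteSpace V] {e : E →ₗ[ℂ] V} (he : DenseRange e)
    (s : E →ₗ[ℂ] V) {C c : ℝ}
    (hs : ∀ x, ‖s x‖ ≤ C * ‖e x‖) (hc : 0 < c) (h : ∀ x, c * ‖e x‖ ^ 2 ≤ ‖inner ℂ (s x) (e x)‖)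
    (w : V) : ∃ y : V, (∀ x, inner ℂ y (s x) = inner ℂ w (e x)) ∧
      ∀ y' : V, (∀ x, inner ℂ y' (s x) = inner ℂ w (e x)) → y' = y := by
  let A : V →L[ℂ] V := s.extendOfNorm e
  have hA : ∀ x, A (e x) = s x := LinearMap.extendOfNorm_eq he ⟨C, hs⟩
  have hAc : ∀ z : V, ‖z‖ ^ 2 * c ≤ ‖inner ℂ (A z) z‖ := fun z =>
    he.induction_on z (isClosed_le (by fun_prop) (by fun_prop)) fun x => by
      rw [hA, mul_comm]
      exact h x
  have hunit : IsUnit A :=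
    ContinuousLinearMap.isUnit_of_forall_le_norm_inner_map A (c := ⟨c, hc.le⟩) hc hAc
  -- The unknown stands on the other side of the form: the equation reads `A* y = w`.
  have hstar : IsUnit (ContinuousLinearMap.adjoint A) := by
    rw [← ContinuousLinearMap.star_eq_adjoint]
    exact hunit.star
  have hbij := ContinuousLinearMap.isUnit_iff_bijective.1 hstar
  have hiff : ∀ y : V, (∀ x, inner ℂ y (s x) = inner ℂ w (e x)) ↔
      ContinuousLinearMap.adjoint A y = w := by
    intro y
    constructor
    · intro hy
      refine ext_inner_right ℂ fun z => he.induction_on z (isClosed_eq (by fun_prop) (by fun_prop))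
        fun x => ?_
      rw [ContinuousLinearMap.adjoint_inner_left, hA, hy]
    · rintro rfl x
      rw [ContinuousLinearMap.adjoint_inner_left, hA]
  obtain ⟨y, hy⟩ := hbij.2 w
  exact ⟨y, (hiff y).2 hy, fun y' hy' => hbij.1 (((hiff y').1 hy').trans hy.symm)⟩

/-- The Cauchy-Schwarz inequality for a positive semidefinite Hermitian form. -/
theorem norm_form_le_of_symm {E V : Type*} [AddCommGroup E] [Module ℂ E] [NormedAddCommGroup V]
    (b : E → E → ℂ) (hsymm : ∀ x y, star (b y x) = b x y)
    (hadd : ∀ x y z, b (x + y) z = b x z + b y z) (hsmul : ∀ x y (r : ℂ), b (r • x) y = star r * b x y)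
    (hnn : ∀ x, 0 ≤ (b x x).re) {T : E → V} {K : ℝ} (hK : 0 ≤ K)
    (hb : ∀ x, (b x x).re ≤ K * ‖T x‖ ^ 2) (x y : E) : ‖b x y‖ ≤ K * (‖T x‖ * ‖T y‖) := by
  let core : PreInnerProductSpace.Core ℂ E :=
    { inner := b
      conj_inner_symm := hsymm
      re_inner_nonneg := hnn
      add_left := hadd
      smul_left := hsmul }
  have h1 : ‖b x y‖ * ‖b y x‖ ≤ (b x x).re * (b y y).re :=
    InnerProductSpace.Core.inner_mul_inner_self_le (𝕜 := ℂ) (c := core) x y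
  have h2 : ‖b y x‖ = ‖b x y‖ := by rw [← hsymm x y, norm_star]
  rw [h2] at h1
  refine abs_le_of_sq_le_sq' ?_ (by positivity) |>.2
  calc ‖b x y‖ ^ 2 ≤ (b x x).re * (b y y).re := by rw [sq]; exact h1
    _ ≤ (K * ‖T x‖ ^ 2) * (K * ‖T y‖ ^ 2) := mul_le_mul (hb x) (hb y) (hnn y) (by positivity)
    _ = (K * (‖T x‖ * ‖T y‖)) ^ 2 := by ring

end HilbertSpace

/-- A bounded form that is coercive on a dense subspace is coercive. -/
theorem coercive_of_dense {E V D : Type*} [AddCommGroup E] [Module ℂ E] [NormedAddCommGroup V]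
    [NormedSpace ℂ V] (b : E → E → ℂ) (hsymm : ∀ x y, star (b y x) = b x y)
    (hadd : ∀ x y z, b (x + y) z = b x z + b y z) (T : E →ₗ[ℂ] V) {K c : ℝ}
    (hb : ∀ x y, ‖b x y‖ ≤ K * (‖T x‖ * ‖T y‖)) (i : D → E) (hi : DenseRange fun d => T (i d))
    (hc : ∀ d, c * ‖T (i d)‖ ^ 2 ≤ (b (i d) (i d)).re) (x : E) :
    c * ‖T x‖ ^ 2 ≤ (b x x).re := by
  obtain ⟨u, hu, hux⟩ := mem_closure_iff_seq_limit.1 (hi (T x))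
  choose d hd using hu
  simp only at hd
  have h1 : ∀ k, c * ‖u k‖ ^ 2 ≤ (b x x).re + K * (‖T x - u k‖ * ‖T x‖) +
      K * (‖T x - u k‖ * ‖u k‖) := by
    intro k
    have hadd' : ∀ x y z, b x (y + z) = b x y + b x z := fun x y z => by
      rw [← hsymm, hadd, star_add, hsymm, hsymm]
    have h2 : b x x = b (x - i (d k)) x + b (i (d k)) (x - i (d k)) + b (i (d k)) (i (d k)) := by
      rw [add_assoc, ← hadd', sub_add_cancel, ← hadd, sub_add_cancel]
    have h3 := hb (x - i (d k)) x
    have h4 := hb (i (d k)) (x - i (d k))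
    have h5 := hc (d k)
    rw [map_sub, hd] at h3 h4
    rw [hd] at h5
    have h6 := (Complex.abs_re_le_norm _).trans h3
    have h7 := (Complex.abs_re_le_norm _).trans h4
    rw [h2, Complex.add_re, Complex.add_re]
    rw [mul_comm ‖u k‖] at h7
    linarith [(abs_le.1 h6).1, (abs_le.1 h7).1]
  have h2 : Filter.Tendsto (fun k => T x - u k) Filter.atTop (nhds 0) := by
    have := (tendsto_const_nhds (x := T x)).sub hux
    rwa [sub_self] at this
  have h3 := h2.norm
  rw [norm_zero] at h3
  have h4 := hux.norm
  have h5 := (tendsto_const_nhds (x := (b x x).re)).add ((h3.mul_const ‖T x‖).const_mul K) |>.add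
    ((h3.mul h4).const_mul K)
  simp only [zero_mul, mul_zero, add_zero] at h5
  exact le_of_tendsto_of_tendsto ((h4.pow 2).const_mul c) h5 (.of_forall h1)

/-! ### The form of the kernel -/

/-- The sesquilinear form of the kernel. -/
def kernelForm (R : ℝ → ℝ → ℂ) (ψ χ : TestFn) : ℂ := ∫ x, kernelOp R ψ.conj x * χ x

theorem integrable_kernel_mul {R : ℝ → ℝ → ℂ} (hR : LocallyIntegrable (Function.uncurry R) volume)
    (φ ψ : TestFn) : Integrable (fun z : ℝ × ℝ => R z.1 z.2 * (φ z.1 * ψ z.2)) volume := by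
  have h1 : Continuous fun z : ℝ × ℝ => φ z.1 * ψ z.2 :=
    (φ.smooth.continuous.comp continuous_fst).mul (ψ.smooth.continuous.comp continuous_snd)
  have h2 : HasCompactSupport fun z : ℝ × ℝ => φ z.1 * ψ z.2 := by
    refine HasCompactSupport.intro (φ.hasCompactSupport.prod ψ.hasCompactSupport) fun z hz => ?_
    simp only [mem_prod, not_and_or] at hz
    rcases hz with h | h <;> simp [image_eq_zero_of_notMem_tsupport h]
  refine (hR.integrable_smul_left_of_hasCompactSupport h1 h2).congr (.of_forall fun z => ?_)
  simp only [smul_eq_mul, Function.uncurry, mul_comm]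

theorem kernelForm_eq (R : ℝ → ℝ → ℂ) (ψ χ : TestFn) :
    kernelForm R ψ χ = ∫ x, ∫ y, R x y * (χ x * star (ψ y)) := by
  simp only [kernelForm, kernelOp]
  refine integral_congr_ae (.of_forall fun x => ?_)
  simp only
  rw [← integral_mul_const]
  refine integral_congr_ae (.of_forall fun y => ?_)
  simp only [TestFn.conj_apply]
  ring

/-- Fubini together with `R(x, y) = conj R(y, x)`. -/
theorem kernelForm_symm {R : ℝ → ℝ → ℂ} (hR : LocallyIntegrable (Function.uncurry R) volume)
    (hRself : ∀ x y, R x y = star (R y x)) (ψ χ : TestFn) :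
    star (kernelForm R χ ψ) = kernelForm R ψ χ := by
  rw [kernelForm_eq, kernelForm_eq, ← starRingEnd_apply, ← integral_conj]
  have h := integrable_kernel_mul hR χ ψ.conj
  rw [Measure.volume_eq_prod] at h
  rw [integral_integral_swap (f := fun x y => R x y * (χ x * star (ψ y))) h]
  refine integral_congr_ae (.of_forall fun y => ?_)
  simp only
  rw [← integral_conj]
  refine integral_congr_ae (.of_forall fun x => ?_)
  simp only [starRingEnd_apply]
  rw [hRself x y, star_mul', star_mul', star_star]
  ring

theorem integral_testFn_add {u : ℝ → ℂ} (hu : LocallyIntegrable u) (φ ψ : TestFn) :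
    ∫ x, u x * (φ + ψ) x = (∫ x, u x * φ x) + ∫ x, u x * ψ x := by
  rw [← integral_add (LocInt.integrable_mul hu φ) (LocInt.integrable_mul hu ψ)]
  refine integral_congr_ae (.of_forall fun x => ?_)
  simp [mul_add]

theorem integral_testFn_smul (u : ℝ → ℂ) (c : ℂ) (φ : TestFn) :
    ∫ x, u x * (c • φ) x = c * ∫ x, u x * φ x := by
  rw [← integral_const_mul]
  refine integral_congr_ae (.of_forall fun x => ?_)
  simp
  ring

theorem kernelForm_add_right {R : ℝ → ℝ → ℂ} (hRL2 : ∀ φ : TestFn, MemLp (kernelOp R φ) 2 volume)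
    (ψ χ χ' : TestFn) : kernelForm R ψ (χ + χ') = kernelForm R ψ χ + kernelForm R ψ χ' :=
  integral_testFn_add (locallyIntegrable_of_memLp (hRL2 _)) χ χ'

theorem kernelForm_smul_right (R : ℝ → ℝ → ℂ) (ψ χ : TestFn) (c : ℂ) :
    kernelForm R ψ (c • χ) = c * kernelForm R ψ χ :=
  integral_testFn_smul _ c χ

/-! ### Coercivity of the kernel -/

theorem iteratedDeriv_star (j : ℕ) (u : ℝ → ℂ) :
    iteratedDeriv j (fun x => star (u x)) = fun x => star (iteratedDeriv j u x) := by
  induction j with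
  | zero => simp
  | succ j ih =>
    rw [iteratedDeriv_succ, ih, iteratedDeriv_succ]
    ext x
    exact deriv.star

/-- Adjoint and transpose differ by conjugation before and after. The hypotheses concern the
adjoint; distributional equations use the transpose. -/
theorem adjointOp_eq (k : ℕ) (a : ℕ → ℝ → ℂ) (u : ℝ → ℂ) :
    adjointOp k a (fun x => star (u x)) = fun x => star (transposeOp k a u x) := by
  ext x
  simp only [adjointOp, transposeOp, star_sum, star_mul']
  refine Finset.sum_congr rfl fun j _ => ?_
  rw [← congrFun (iteratedDeriv_star j fun t => a j t * u t) x]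
  simp

/-- The right-hand side is the kernel form at `Qᵗζ`; this is how the estimate for `PQ*` reaches the
kernel. -/
theorem integral_adjointOp {n m : ℕ} {q p : ℕ → ℝ → ℂ} (hq : ∀ j, ContDiff ℝ ∞ (q j))
    (hp : ∀ j, ContDiff ℝ ∞ (p j)) (ζ : TestFn) :
    ∫ x, diffOp m p (adjointOp n q ζ.conj) x * star (ζ.conj x) =
      ∫ x, star (transposeLin n q hq ζ x) * transposeLin m p hp ζ x := by
  have h1 : adjointOp n q ζ.conj = (transposeLin n q hq ζ).conj := adjointOp_eq n q ζ
  rw [h1]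
  simp only [TestFn.conj_apply, star_star]
  rw [← integral_mul_transposeOp m hp (TestFn.smooth _)]
  rfl

theorem norm_sob_transpose_eq (s : ℝ) {n : ℕ} {q : ℕ → ℝ → ℂ} (hq : ∀ j, ContDiff ℝ ∞ (q j))
    (ζ : TestFn) : ‖sob s (transposeLin n q hq ζ)‖ = sobolevNorm s (adjointOp n q ζ.conj) := by
  have h1 : adjointOp n q ζ.conj = (transposeLin n q hq ζ).conj := adjointOp_eq n q ζ
  rw [h1, ← norm_sob, norm_sob_conj]

/-- Since `n - α = (n + m) / 2`, both hypotheses involve the same norm of `ζ`, which can be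
eliminated between them. -/
theorem form_bounds {n m α : ℕ} (hn : Even n) (hm : Even m) (hmn : m < n) (hα : α = (n - m) / 2)
    {q p : ℕ → ℝ → ℂ} (hq : ∀ j, ContDiff ℝ ∞ (q j)) (hp : ∀ j, ContDiff ℝ ∞ (p j))
    (hQstar : ∃ c₃ > 0, ∃ c₄ > 0, ∀ φ : TestFn,
      c₃ * sobolevNorm (-(α : ℝ) + n) φ ≤ sobolevNorm (-(α : ℝ)) (adjointOp n q φ) ∧
      sobolevNorm (-(α : ℝ)) (adjointOp n q φ) ≤ c₄ * sobolevNorm (-(α : ℝ) + n) φ)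
    (hPQstar : ∃ c₅ > 0, ∃ c₆ > 0, ∀ φ : TestFn,
      c₅ * sobolevNorm (((n : ℝ) + m) / 2) φ ^ 2 ≤
        (∫ x, diffOp m p (adjointOp n q φ) x * star (φ x)).re ∧
      (∫ x, diffOp m p (adjointOp n q φ) x * star (φ x)).re ≤
        c₆ * sobolevNorm (((n : ℝ) + m) / 2) φ ^ 2) :
    ∃ c > 0, ∃ K ≥ 0, ∀ ζ : TestFn,
      c * ‖sob (-(α : ℝ)) (transposeLin n q hq ζ)‖ ^ 2 ≤
        (∫ x, star (transposeLin n q hq ζ x) * transposeLin m p hp ζ x).re ∧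
      (∫ x, star (transposeLin n q hq ζ x) * transposeLin m p hp ζ x).re ≤
        K * ‖sob (-(α : ℝ)) (transposeLin n q hq ζ)‖ ^ 2 := by
  obtain ⟨c₃, h3, c₄, h4, hQ⟩ := hQstar
  obtain ⟨c₅, h5, c₆, h6, hP⟩ := hPQstar
  have hs : -(α : ℝ) + n = ((n : ℝ) + m) / 2 := by
    obtain ⟨a, rfl⟩ := hn
    obtain ⟨b, rfl⟩ := hm
    have : (α : ℝ) = a - b := by
      have : α + b = a := by omega
      rw [← this]
      push_cast
      ring
    rw [this]
    push_cast
    ring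
  refine ⟨c₅ / c₄ ^ 2, by positivity, c₆ / c₃ ^ 2, by positivity, fun ζ => ?_⟩
  have hQ' := hQ ζ.conj
  have hP' := hP ζ.conj
  rw [integral_adjointOp hq hp] at hP'
  rw [hs, ← norm_sob_transpose_eq (hq := hq)] at hQ'
  set x := ‖sob (-(α : ℝ)) (transposeLin n q hq ζ)‖
  set y := sobolevNorm (((n : ℝ) + m) / 2) ζ.conj
  have hy : 0 ≤ y := Real.sqrt_nonneg _
  have hx : 0 ≤ x := norm_nonneg _
  constructor
  · refine le_trans ?_ hP'.1
    rw [div_mul_eq_mul_div, div_le_iff₀ (by positivity)]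
    have := pow_le_pow_left₀ hx hQ'.2 2
    rw [mul_pow] at this
    nlinarith
  · refine hP'.2.trans ?_
    rw [div_mul_eq_mul_div, le_div_iff₀ (by positivity)]
    have := pow_le_pow_left₀ (by positivity) hQ'.1 2
    rw [mul_pow] at this
    nlinarith

/-! ### Uniqueness in `L²`, density of the range of the transpose, and bounds for the kernel. -/

/-- The difference is a weak solution of `Qu = 0` in `L²(ℝ)`: smooth by regularity, and then zero by
hypothesis. -/
theorem eq_of_weak_solution {n : ℕ} {q : ℕ → ℝ → ℂ} (hq : ∀ j, ContDiff ℝ ∞ (q j))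
    (hqn : ∀ x, q n x ≠ 0)
    (hline : ∀ u : ℝ → ℂ, IsODESolution n q u → MemLp u 2 volume → u = 0)
    {v w : ℝ → ℂ} (hv : MemLp v 2 volume) (hw : MemLp w 2 volume)
    (h : ∀ ζ : TestFn, ∫ x, v x * transposeLin n q hq ζ x = ∫ x, w x * transposeLin n q hq ζ x) :
    v =ᵐ[volume] w := by
  have hvw := hv.sub hw
  obtain ⟨u, hu, huv, hud⟩ := exists_smooth_of_weak_solution n hq hqn (v := v - w) (g := fun _ => 0)
    (locallyIntegrable_of_memLp hvw) contDiff_const (fun ζ => by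
      have h1 := h ζ
      simp only [Pi.sub_apply, sub_mul, zero_mul, integral_zero]
      rw [integral_sub, sub_eq_zero]
      · exact h1
      · exact LocInt.integrable_mul (locallyIntegrable_of_memLp hv) (transposeLin n q hq ζ)
      · exact LocInt.integrable_mul (locallyIntegrable_of_memLp hw) (transposeLin n q hq ζ))
  have hu0 := hline u ⟨hu, hud⟩ (hvw.ae_eq huv)
  filter_upwards [huv] with x hx
  rw [hu0] at hx
  exact sub_eq_zero.1 hx

/-- A functional on `H^{-α}` that annihilates the range is given by `F ∈ H^α` with `QF = 0` weakly,
so `F = 0`. -/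
theorem denseRange_sob_transpose (α : ℕ) {n : ℕ} {q : ℕ → ℝ → ℂ} (hq : ∀ j, ContDiff ℝ ∞ (q j))
    (hqn : ∀ x, q n x ≠ 0)
    (hline : ∀ u : ℝ → ℂ, IsODESolution n q u → MemLp u 2 volume → u = 0) :
    DenseRange (sob (-(α : ℝ)) ∘ₗ transposeLin n q hq) := by
  refine denseRange_of_inner_eq_zero _ fun g hg => ?_
  obtain ⟨F, hF, hFi⟩ := exists_memH_of_inner α g
  have hF2 : MemLp F 2 volume := by simpa using hF.1
  have h0 := eq_of_weak_solution hq hqn hline (w := fun _ => 0) hF2 MemLp.zero' fun ζ => by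
    rw [hFi]
    simpa using hg ζ
  refine dense_sob (s := -(α : ℝ)) (by simp) fun φ => ?_
  rw [← hFi]
  refine integral_eq_zero_of_ae ?_
  filter_upwards [h0] with x hx
  simp [hx]

theorem kernelForm_transpose {n m : ℕ} {q p : ℕ → ℝ → ℂ} (hq : ∀ j, ContDiff ℝ ∞ (q j))
    (hp : ∀ j, ContDiff ℝ ∞ (p j)) {R : ℝ → ℝ → ℂ} (hR : KernelEq n m q p R) (ψ ζ : TestFn) :
    kernelForm R ψ (transposeLin n q hq ζ) = ∫ x, star (ψ x) * transposeLin m p hp ζ x := by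
  have h1 := hR ζ ψ.conj
  rw [← integral_mul_transposeOp m hp (TestFn.smooth _)] at h1
  exact h1

/-- The equation for `R` determines the form only when one argument lies in the range of `Qᵗ`.
Bounds are proved there first, then extended by duality and density. The result is that `R` is
bounded and coercive as a form on `H^{-α}`. -/
theorem norm_kernelForm_transpose_le {n m α : ℕ} {q p : ℕ → ℝ → ℂ}
    (hq : ∀ j, ContDiff ℝ ∞ (q j)) (hp : ∀ j, ContDiff ℝ ∞ (p j)) (hqn : ∀ x, q n x ≠ 0)
    (hline : ∀ u : ℝ → ℂ, IsODESolution n q u → MemLp u 2 volume → u = 0)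
    {R : ℝ → ℝ → ℂ} (hRloc : LocallyIntegrable (Function.uncurry R) volume)
    (hRself : ∀ x y, R x y = star (R y x))
    (hRL2 : ∀ φ : TestFn, MemLp (kernelOp R φ) 2 volume) (hR : KernelEq n m q p R)
    {c K : ℝ} (hc : 0 < c) (hK : 0 ≤ K) (hb : ∀ ζ : TestFn,
      c * ‖sob (-(α : ℝ)) (transposeLin n q hq ζ)‖ ^ 2 ≤
        (∫ x, star (transposeLin n q hq ζ x) * transposeLin m p hp ζ x).re ∧
      (∫ x, star (transposeLin n q hq ζ x) * transposeLin m p hp ζ x).re ≤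
        K * ‖sob (-(α : ℝ)) (transposeLin n q hq ζ)‖ ^ 2) :
    (∀ ζ : TestFn, ‖sob α (transposeLin m p hp ζ)‖ ≤
      K * ‖sob (-(α : ℝ)) (transposeLin n q hq ζ)‖) ∧
    (∀ ψ χ : TestFn, ‖kernelForm R ψ χ‖ ≤ K * (‖sob (-(α : ℝ)) ψ‖ * ‖sob (-(α : ℝ)) χ‖)) ∧
    ∀ χ : TestFn, c * ‖sob (-(α : ℝ)) χ‖ ^ 2 ≤ (kernelForm R χ χ).re := by
  set A := transposeLin n q hq
  set B := transposeLin m p hp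
  have hform : ∀ ψ ζ, kernelForm R ψ (A ζ) = ∫ x, star (ψ x) * B ζ x :=
    kernelForm_transpose hq hp hR
  have hsymm := fun ψ χ => kernelForm_symm hRloc hRself ψ χ
  have hadd : ∀ x y z, kernelForm R (x + y) z = kernelForm R x z + kernelForm R y z := by
    intro x y z
    rw [← hsymm, kernelForm_add_right hRL2, star_add, hsymm, hsymm]
  have hsmul : ∀ x y (r : ℂ), kernelForm R (r • x) y = star r * kernelForm R x y := by
    intro x y r
    rw [← hsymm, kernelForm_smul_right, star_mul', hsymm]
  have hdense := denseRange_sob_transpose α hq hqn hline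
  -- Positivity on the range of `Qᵗ` gives Cauchy-Schwarz, so the bound on the diagonal suffices.
  have h1 : ∀ η ζ : TestFn, ‖kernelForm R (A η) (A ζ)‖ ≤
      K * (‖sob (-(α : ℝ)) (A η)‖ * ‖sob (-(α : ℝ)) (A ζ)‖) := by
    refine norm_form_le_of_symm (fun η ζ => kernelForm R (A η) (A ζ)) (fun x y => hsymm _ _)
      (fun x y z => ?_) (fun x y r => ?_) (fun x => ?_) (T := fun ζ => sob (-(α : ℝ)) (A ζ)) hK
      (fun x => ?_)
    · simp only [map_add, hadd]
    · simp only [map_smul, hsmul]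
    · rw [hform]
      exact le_trans (by positivity) (hb x).1
    · rw [hform]
      exact (hb x).2
  -- The norm in `H^α` is computed by duality against the dense range of `Qᵗ` in `H^{-α}`.
  have h2 : ∀ ζ : TestFn, ‖sob α (B ζ)‖ ≤ K * ‖sob (-(α : ℝ)) (A ζ)‖ := by
    intro ζ
    refine norm_le_of_norm_inner_le hdense (by positivity) fun η => ?_
    have h3 := h1 η ζ
    rw [hform, integral_mul_eq_inner_sob α] at h3
    exact h3.trans_eq (by
      rw [LinearMap.comp_apply]
      ring)
  have h3 : ∀ ψ χ : TestFn, ‖kernelForm R ψ χ‖ ≤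
      K * (‖sob (-(α : ℝ)) ψ‖ * ‖sob (-(α : ℝ)) χ‖) := by
    intro ψ χ
    let ℓ : TestFn →ₗ[ℂ] ℂ :=
      { toFun := fun ζ => kernelForm R ψ (A ζ)
        map_add' := fun x y => by rw [map_add, kernelForm_add_right hRL2]
        map_smul' := fun r x => by
          rw [map_smul, kernelForm_smul_right]
          rfl }
    obtain ⟨y, hy, hyi⟩ := exists_inner_of_norm_le (sob (-(α : ℝ)) ∘ₗ A) ℓ
      (C := K * ‖sob (-(α : ℝ)) ψ‖) (by positivity) fun ζ => by
        change ‖kernelForm R ψ (A ζ)‖ ≤ _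
        rw [hform, integral_mul_eq_inner_sob α]
        refine (norm_inner_le_norm _ _).trans ?_
        calc _ ≤ ‖sob (-(α : ℝ)) ψ‖ * (K * ‖sob (-(α : ℝ)) (A ζ)‖) :=
              mul_le_mul_of_nonneg_left (h2 ζ) (norm_nonneg _)
          _ = _ := by
            rw [LinearMap.comp_apply]
            ring
    obtain ⟨F, hF, hFi⟩ := exists_memH_of_inner α y
    have hF2 : MemLp F 2 volume := by simpa using hF.1
    -- `F` represents a bounded functional on `H^{-α}` and satisfies the same weak equation as `R
    -- ψ̄`; both lie in `L²`, so they agree.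
    have h4 := eq_of_weak_solution hq hqn hline hF2 (hRL2 ψ.conj) fun ζ => by
      rw [hFi]
      exact (hyi ζ).symm
    have h5 : kernelForm R ψ χ = inner ℂ y (sob (-(α : ℝ)) χ) := by
      rw [← hFi, kernelForm]
      refine integral_congr_ae ?_
      filter_upwards [h4] with x hx
      rw [hx]
    rw [h5]
    refine (norm_inner_le_norm _ _).trans ?_
    rw [← mul_assoc]
    exact mul_le_mul_of_nonneg_right hy (norm_nonneg _)
  refine ⟨h2, h3, fun χ => ?_⟩
  refine coercive_of_dense (kernelForm R) hsymm hadd (sob (-(α : ℝ))) h3 A hdense (fun ζ => ?_) χ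
  rw [hform]
  exact (hb ζ).1

/-! ### Solution of the integral equation in the dual of `H^k(0, L)` -/

theorem denseRange_pairing (k : ℕ) (L : ℝ) :
    DenseRange (pairing k L ∘ₗ (testOn (Ioo 0 L)).subtype) :=
  denseRange_of_inner_eq_zero _ fun _ hg => jet_eq_zero_of_pairing fun φ hφ => hg ⟨φ, hφ⟩

theorem eq_of_inner_pairing {k : ℕ} {L : ℝ} {v w : JetSpace k L}
    (h : ∀ φ : TestFn, tsupport φ ⊆ Ioo 0 L →
      inner ℂ v (pairing k L φ) = inner ℂ w (pairing k L φ)) : v = w := by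
  rw [← sub_eq_zero]
  refine jet_eq_zero_of_pairing fun φ hφ => ?_
  rw [inner_sub_left, h φ hφ, sub_self]

theorem inner_testJet_pairing (k : ℕ) (L : ℝ) (ψ φ : TestFn) :
    inner ℂ (testJet k L ψ) (pairing k L φ) = ∫ x in Ioo 0 L, star (ψ x) * φ x := by
  rw [inner_pairing]
  refine integral_congr_ae ?_
  filter_upwards [jetFun_testJet k L ψ] with x hx
  rw [hx]

/-- The kernel, as an operator from test functions to `H^k(0, L)`. -/
theorem exists_kernel_jet {k : ℕ} {L : ℝ} {R : ℝ → ℝ → ℂ}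
    (hRloc : LocallyIntegrable (Function.uncurry R) volume)
    (hRself : ∀ x y, R x y = star (R y x))
    (hRL2 : ∀ φ : TestFn, MemLp (kernelOp R φ) 2 volume) {K : ℝ} (hK : 0 ≤ K)
    (hb : ∀ ψ χ : TestFn, ‖kernelForm R ψ χ‖ ≤ K * (‖sob (-(k : ℝ)) ψ‖ * ‖sob (-(k : ℝ)) χ‖)) :
    ∃ s : TestFn →ₗ[ℂ] JetSpace k L, (∀ φ χ : TestFn, tsupport χ ⊆ Ioo 0 L →
      inner ℂ (s φ) (pairing k L χ) = kernelForm R φ χ) ∧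
      ∃ C ≥ 0, ∀ φ, ‖s φ‖ ≤ C * ‖sob (-(k : ℝ)) φ‖ := by
  obtain ⟨C, hC, hsob⟩ := norm_sob_le_norm_pairing k L
  -- Riesz representation of `χ ↦ kernelForm R φ χ` in the dual norm on the interval. The function
  -- part of the resulting jet is `y ↦ ∫ R(x, y) φ(x) dx`.
  have hex : ∀ φ : TestFn, ∃ y : JetSpace k L, ‖y‖ ≤ K * C * ‖sob (-(k : ℝ)) φ‖ ∧
      ∀ χ : TestFn, tsupport χ ⊆ Ioo 0 L → inner ℂ y (pairing k L χ) = kernelForm R φ χ := by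
    intro φ
    let ℓ : testOn (Ioo 0 L) →ₗ[ℂ] ℂ :=
      { toFun := fun χ => kernelForm R φ χ.1
        map_add' := fun χ χ' => kernelForm_add_right hRL2 φ χ.1 χ'.1
        map_smul' := fun r χ => kernelForm_smul_right R φ χ.1 r }
    obtain ⟨y, hy, hyi⟩ := exists_inner_of_norm_le
      (pairing k L ∘ₗ (testOn (Ioo 0 L)).subtype) ℓ (C := K * C * ‖sob (-(k : ℝ)) φ‖)
      (by positivity) fun χ => by
        refine (hb φ χ.1).trans ?_
        calc K * (‖sob (-(k : ℝ)) φ‖ * ‖sob (-(k : ℝ)) χ.1‖)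
            ≤ K * (‖sob (-(k : ℝ)) φ‖ * (C * ‖pairing k L χ.1‖)) := by
              gcongr
              exact hsob χ.1 χ.2
          _ = _ := by
            rw [LinearMap.comp_apply, Submodule.subtype_apply]
            ring
    exact ⟨y, hy, fun χ hχ => (hyi ⟨χ, hχ⟩).symm⟩
  choose s hs hsi using hex
  refine ⟨{ toFun := s, map_add' := fun φ ψ => ?_, map_smul' := fun r φ => ?_ }, hsi, K * C,
    by positivity, hs⟩
  · refine eq_of_inner_pairing fun χ hχ => ?_
    rw [inner_add_left, hsi _ χ hχ, hsi _ χ hχ, hsi _ χ hχ, ← kernelForm_symm hRloc hRself,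
      kernelForm_add_right hRL2, star_add, kernelForm_symm hRloc hRself,
      kernelForm_symm hRloc hRself]
  · refine eq_of_inner_pairing fun χ hχ => ?_
    rw [RingHom.id_apply, inner_smul_left, hsi _ χ hχ, hsi _ χ hχ, ← kernelForm_symm hRloc hRself,
      kernelForm_smul_right, star_mul', kernelForm_symm hRloc hRself]
    rfl

theorem integral_kernel_left {R : ℝ → ℝ → ℂ} (hRself : ∀ x y, R x y = star (R y x)) (φ : TestFn)
    (y : ℝ) : ∫ x, R x y * φ x = star (kernelOp R φ.conj y) := by
  rw [kernelOp, ← starRingEnd_apply, ← integral_conj]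
  refine integral_congr_ae (.of_forall fun x => ?_)
  simp only [TestFn.conj_apply, starRingEnd_apply]
  rw [hRself x y, star_mul', star_star]

/-- A test function that agrees with the kernel operator on the interval has the same jet. -/
theorem testJet_eq_kernel_jet {k : ℕ} {L : ℝ} {R : ℝ → ℝ → ℂ}
    (hRself : ∀ x y, R x y = star (R y x)) {s : TestFn →ₗ[ℂ] JetSpace k L}
    (hs : ∀ φ χ : TestFn, tsupport χ ⊆ Ioo 0 L →
      inner ℂ (s φ) (pairing k L χ) = kernelForm R φ χ) {φ ψ : TestFn}
    (hψ : ∀ᵐ y ∂(volume.restrict (Ioo 0 L)), ψ y = ∫ x, R x y * φ x) : testJet k L ψ = s φ := by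
  refine eq_of_inner_pairing fun χ hχ => ?_
  rw [hs φ χ hχ, inner_testJet_pairing, kernelForm, ← TestFn.integral_eq hχ]
  refine integral_congr_ae ?_
  filter_upwards [hψ] with x hx
  rw [hx, integral_kernel_left hRself, star_star]

/-- The equation `QR = P`, transposed by Hermitian symmetry: `R Qᵗ = Pᵗ` on the interval. -/
theorem testJet_transpose {k : ℕ} {L : ℝ} {R : ℝ → ℝ → ℂ} {n m : ℕ} {q p : ℕ → ℝ → ℂ}
    (hq : ∀ j, ContDiff ℝ ∞ (q j)) (hp : ∀ j, ContDiff ℝ ∞ (p j)) (hR : KernelEq n m q p R)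
    (hRloc : LocallyIntegrable (Function.uncurry R) volume)
    (hRself : ∀ x y, R x y = star (R y x)) {s : TestFn →ₗ[ℂ] JetSpace k L}
    (hs : ∀ φ χ : TestFn, tsupport χ ⊆ Ioo 0 L →
      inner ℂ (s φ) (pairing k L χ) = kernelForm R φ χ) (ζ : TestFn) :
    testJet k L (transposeLin m p hp ζ) = s (transposeLin n q hq ζ) := by
  refine eq_of_inner_pairing fun χ hχ => ?_
  rw [hs _ χ hχ, inner_testJet_pairing, ← kernelForm_symm hRloc hRself,
    kernelForm_transpose hq hp hR, ← starRingEnd_apply, ← integral_conj]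
  rw [TestFn.integral_eq (φ := χ) hχ (fun x => star (transposeLin m p hp ζ x))]
  refine integral_congr_ae (.of_forall fun x => ?_)
  simp [mul_comm]

/-- Supplies the representative that `SolvesOn` asks for: a smooth version of the kernel operator,
cut off outside the interval. -/
theorem exists_testFn_eq_kernel {L : ℝ} {R : ℝ → ℝ → ℂ} (hRself : ∀ x y, R x y = star (R y x))
    (hsmooth : ∀ φ : TestFn, ∃ u : ℝ → ℂ, ContDiff ℝ ∞ u ∧ kernelOp R φ =ᵐ[volume] u)
    (φ : TestFn) : ∃ ψ : TestFn,
      ∀ᵐ y ∂(volume.restrict (Ioo 0 L)), ψ y = ∫ x, R x y * φ x := by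
  obtain ⟨u, hu, hue⟩ := hsmooth φ.conj
  rcases le_or_gt L 0 with hL | hL
  · exact ⟨0, by simp [Ioo_eq_empty (not_lt.2 hL)]⟩
  obtain ⟨χ, -, hχ⟩ := TestFn.exists_cutoff (a := 0) (b := L) (a' := -1) (b' := L + 1)
    (by linarith) (by linarith)
  have hu' : ContDiff ℝ ∞ (fun x => star (u x)) := Complex.conjCLE.contDiff.comp hu
  refine ⟨TestFn.smoothMul _ hu' χ, ?_⟩
  rw [ae_restrict_iff' measurableSet_Ioo]
  filter_upwards [hue] with x hx hxΩ
  rw [integral_kernel_left hRself, hx, TestFn.coe_smoothMul]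
  simp [(hχ x ⟨hxΩ.1.le, hxΩ.2.le⟩).self_of_nhds]

theorem exists_distr_inner_testJet {k : ℕ} {L : ℝ} (y : JetSpace k L) :
    ∃ h : Distr, ∀ φ, h φ = inner ℂ y (testJet k L φ) := by
  refine exists_distr_of_bound ((innerSL ℂ y).toLinearMap ∘ₗ testJet k L) k fun K _ =>
    ⟨‖y‖ * √(∑ j ∈ Finset.range (k + 1), (volume.restrict (Ioo 0 L)).real univ),
      fun φ _ B hB => ?_⟩
  have hB0 : 0 ≤ B := (norm_nonneg _).trans (hB 0 (Nat.zero_le _) 0)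
  change ‖inner ℂ y (testJet k L φ)‖ ≤ _
  refine (norm_inner_le_norm _ _).trans ?_
  rw [mul_assoc]
  refine mul_le_mul_of_nonneg_left ?_ (norm_nonneg _)
  rw [norm_testJet]
  refine Real.sqrt_le_iff.2 ⟨by positivity, ?_⟩
  rw [mul_pow, Real.sq_sqrt (Finset.sum_nonneg fun j _ => measureReal_nonneg), Finset.sum_mul]
  refine Finset.sum_le_sum fun j hj => ?_
  have h1 : ∫ x in Ioo 0 L, ‖iteratedDeriv j φ x‖ ^ 2 ≤ ∫ x in Ioo 0 L, B ^ 2 := by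
    refine integral_mono_of_nonneg (.of_forall fun x => by positivity) (integrable_const _)
      (.of_forall fun x => ?_)
    exact pow_le_pow_left₀ (norm_nonneg _)
      (hB j (Nat.lt_succ_iff.1 (Finset.mem_range.1 hj)) x) 2
  simpa using h1

theorem exists_inner_of_memDualH {k : ℕ} {L : ℝ} {h : Distr} (hh : MemDualH k L h) :
    ∃ y : JetSpace k L, ∀ φ, h φ = inner ℂ y (testJet k L φ) := by
  obtain ⟨C, hC⟩ := hh
  obtain ⟨y, -, hy⟩ := exists_inner_of_norm_le (testJet k L) h.toLinearMap (abs_nonneg C)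
    fun φ => by
      rw [norm_testJet]
      exact (hC φ).trans (mul_le_mul_of_nonneg_right (le_abs_self C) (Real.sqrt_nonneg _))
  exact ⟨y, hy⟩

theorem isWeakDeriv_star {Ω : Set ℝ} {j : ℕ} {u v : ℝ → ℂ} (h : IsWeakDeriv Ω j u v) :
    IsWeakDeriv Ω j (fun x => star (u x)) (fun x => star (v x)) := by
  intro φ hφ
  have h1 := congrArg star (h φ.conj ((TestFn.tsupport_conj φ).trans hφ))
  have h2 : ⇑φ.conj = fun x => star (φ x) := rfl
  rw [h2, iteratedDeriv_star] at h1
  simp only [← starRingEnd_apply, map_mul, ← integral_conj] at h1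
  simpa using h1

theorem MemH.star_of_le {k n : ℕ} (hkn : k ≤ n) {Ω : Set ℝ} {f : ℝ → ℂ} (hf : MemH n Ω f) :
    MemH k Ω (fun x => star (f x)) :=
  ⟨memLp_star hf.1, fun j hj => by
    obtain ⟨v, hv, hvw⟩ := hf.2 j (hj.trans hkn)
    exact ⟨_, memLp_star hv, isWeakDeriv_star hvw⟩⟩

/-- Elements `h` of the dual correspond to jets `y` by `h φ = ⟨y, testJet φ⟩`, and test functions on
`(0, L)` are dense through `pairing`. In these terms the equation is `⟨y, s φ⟩ = ∫ f φ`, whose form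
is the kernel form; it is coercive because the dual norm is equivalent to that of `H^{-k}(ℝ)`. -/
theorem exists_solution {k n : ℕ} (hkn : k ≤ n) {L : ℝ} (hL : 0 < L) {R : ℝ → ℝ → ℂ}
    (hRself : ∀ x y, R x y = star (R y x)) {K c : ℝ} (hc : 0 < c)
    (hcoer : ∀ χ : TestFn, c * ‖sob (-(k : ℝ)) χ‖ ^ 2 ≤ (kernelForm R χ χ).re)
    (hsmooth : ∀ φ : TestFn, ∃ u : ℝ → ℂ, ContDiff ℝ ∞ u ∧ kernelOp R φ =ᵐ[volume] u)
    {s : TestFn →ₗ[ℂ] JetSpace k L}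
    (hs : ∀ φ χ : TestFn, tsupport χ ⊆ Ioo 0 L →
      inner ℂ (s φ) (pairing k L χ) = kernelForm R φ χ)
    (hK : 0 ≤ K) (hsb : ∀ φ, ‖s φ‖ ≤ K * ‖sob (-(k : ℝ)) φ‖)
    {f : ℝ → ℂ} (hf : MemH n (Ioo 0 L) f) :
    ∃ y : JetSpace k L, (∀ φ : TestFn, tsupport φ ⊆ Ioo 0 L →
        inner ℂ y (s φ) = ∫ x in Ioo 0 L, f x * φ x) ∧
      (∀ y' : JetSpace k L, (∀ φ : TestFn, tsupport φ ⊆ Ioo 0 L →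
        inner ℂ y' (s φ) = ∫ x in Ioo 0 L, f x * φ x) → y' = y) ∧
      ∃ h : Distr, (∀ φ, h φ = inner ℂ y (testJet k L φ)) ∧ MemDualH k L h ∧ SolvesOn R L f h ∧
        ∀ h' : Distr, MemDualH k L h' → SolvesOn R L f h' → h' = h := by
  -- The jet of `conj f`, because the inner product is conjugate linear in its first argument.
  obtain ⟨w, hw⟩ := exists_jet (hf.star_of_le hkn)
  obtain ⟨C₁, hC₁, hsob⟩ := norm_sob_le_norm_pairing k L
  obtain ⟨C₂, hC₂, hpair⟩ := norm_pairing_le (k := k) hL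
  have hwi : ∀ φ : TestFn, inner ℂ w (pairing k L φ) = ∫ x in Ioo 0 L, f x * φ x := by
    intro φ
    rw [inner_pairing]
    refine integral_congr_ae ?_
    filter_upwards [hw] with x hx
    rw [hx, star_star]
  obtain ⟨y, hy, hyu⟩ := exists_unique_of_coercive (denseRange_pairing k L)
    (s ∘ₗ (testOn (Ioo 0 L)).subtype) (C := K * C₁) (c := c / (C₂ + 1) ^ 2) (fun φ => by
      refine (hsb φ.1).trans ?_
      rw [mul_assoc]
      exact mul_le_mul_of_nonneg_left (hsob φ.1 φ.2) hK) (by positivity) (fun φ => by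
      have h1 := (Complex.re_le_norm _).trans_eq' (rfl : _ = (kernelForm R φ.1 φ.1).re)
      change _ ≤ ‖inner ℂ (s φ.1) (pairing k L φ.1)‖
      rw [hs _ _ φ.2]
      refine le_trans ?_ ((hcoer φ.1).trans h1)
      rw [div_mul_eq_mul_div, div_le_iff₀ (by positivity), mul_assoc, ← mul_pow]
      refine mul_le_mul_of_nonneg_left (pow_le_pow_left₀ (norm_nonneg _) ?_ 2) hc.le
      refine (hpair φ.1 φ.2).trans ?_
      rw [mul_comm]
      exact mul_le_mul_of_nonneg_left (by linarith) (norm_nonneg _)) w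
  have hy' : ∀ φ : TestFn, tsupport φ ⊆ Ioo 0 L →
      inner ℂ y (s φ) = ∫ x in Ioo 0 L, f x * φ x := fun φ hφ => by
    rw [← hwi]
    exact hy ⟨φ, hφ⟩
  obtain ⟨h, hh⟩ := exists_distr_inner_testJet y
  refine ⟨y, hy', fun y' hy'' => hyu y' fun φ => (hy'' φ.1 φ.2).trans (hwi φ.1).symm, h, hh,
    ⟨‖y‖, fun φ => ?_⟩, fun φ hφ => ?_, fun h' hh' hs' => ?_⟩
  · rw [hh, ← norm_testJet]
    exact norm_inner_le_norm _ _
  · obtain ⟨ψ, hψ⟩ := exists_testFn_eq_kernel (L := L) hRself hsmooth φ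
    exact ⟨ψ, hψ, by rw [hh, testJet_eq_kernel_jet hRself hs hψ, hy' φ hφ]⟩
  · obtain ⟨y', hy''⟩ := exists_inner_of_memDualH hh'
    have : y' = y := hyu y' fun φ => by
      obtain ⟨ψ, hψ, hψi⟩ := hs' φ.1 φ.2
      change inner ℂ y' (s φ.1) = inner ℂ w (pairing k L φ.1)
      rw [hwi, ← hψi, hy'', testJet_eq_kernel_jet hRself hs hψ]
    ext φ
    rw [hy'', hh, this]

/-! ### Functionals supported at the end points -/

/-- The pairing of `∑_{j < N} [a⁻_j δ^{(j)}(x) + a⁺_j δ^{(j)}(x - L)]` with `u`. -/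
def boundarySum (L : ℝ) {N : ℕ} (a : (Fin N → ℂ) × (Fin N → ℂ)) (u : ℝ → ℂ) : ℂ :=
  ∑ j : Fin N, (a.1 j * (-1) ^ (j : ℕ) * iteratedDeriv j u 0 +
    a.2 j * (-1) ^ (j : ℕ) * iteratedDeriv j u L)

theorem boundarySum_sub_left (L : ℝ) {N : ℕ} (a b : (Fin N → ℂ) × (Fin N → ℂ)) (u : ℝ → ℂ) :
    boundarySum L (a - b) u = boundarySum L a u - boundarySum L b u := by
  simp only [boundarySum, ← Finset.sum_sub_distrib, Prod.fst_sub, Prod.snd_sub, Pi.sub_apply]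
  exact Finset.sum_congr rfl fun j _ => by ring

theorem boundarySum_congr (L : ℝ) {N : ℕ} (a : (Fin N → ℂ) × (Fin N → ℂ)) {u v : ℝ → ℂ}
    (h0 : u =ᶠ[nhds 0] v) (hL : u =ᶠ[nhds L] v) : boundarySum L a u = boundarySum L a v := by
  simp only [boundarySum, h0.iteratedDeriv_eq, hL.iteratedDeriv_eq]

theorem boundarySum_add (L : ℝ) {N : ℕ} (a : (Fin N → ℂ) × (Fin N → ℂ)) {u v : ℝ → ℂ}
    (hu : ContDiff ℝ ∞ u) (hv : ContDiff ℝ ∞ v) :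
    boundarySum L a (u + v) = boundarySum L a u + boundarySum L a v := by
  simp only [boundarySum, ← Finset.sum_add_distrib]
  refine Finset.sum_congr rfl fun j _ => ?_
  rw [iteratedDeriv_add (smooth_of_nat hu j).contDiffAt (smooth_of_nat hv j).contDiffAt,
    iteratedDeriv_add (smooth_of_nat hu j).contDiffAt (smooth_of_nat hv j).contDiffAt]
  ring

/-- The derivative of order `j` at a point, as a functional on test functions. -/
def derivAt (j : ℕ) (x : ℝ) : TestFn →ₗ[ℂ] ℂ where
  toFun φ := iteratedDeriv j φ x
  map_add' φ ψ := iteratedDeriv_add (smooth_of_nat φ.smooth j).contDiffAt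
    (smooth_of_nat ψ.smooth j).contDiffAt
  map_smul' c φ := by
    change iteratedDeriv j (fun t => c * φ t) x = c * _
    rw [iteratedDeriv_const_mul_field]

theorem derivAt_apply (j : ℕ) (x : ℝ) (φ : TestFn) : derivAt j x φ = iteratedDeriv j φ x := rfl

theorem iteratedDeriv_sub_pow (i j : ℕ) (x₀ : ℝ) :
    iteratedDeriv i (fun x : ℝ => ((x : ℂ) - x₀) ^ j) x₀ = if i = j then (j.factorial : ℂ) else 0 := by
  induction i generalizing j with
  | zero =>
    rcases Nat.eq_zero_or_pos j with rfl | hj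
    · simp
    · simp [hj.ne', hj.ne]
  | succ i ih =>
    rw [iteratedDeriv_succ']
    have hd : deriv (fun x : ℝ => ((x : ℂ) - x₀) ^ j) =
        fun x : ℝ => (j : ℂ) * ((x : ℂ) - x₀) ^ (j - 1) := by
      ext y
      have h := (((Complex.ofRealCLM.hasDerivAt (x := y)).sub_const (x₀ : ℂ)).pow j)
      exact h.deriv.trans (by simp)
    rw [hd, iteratedDeriv_const_mul_field, ih]
    rcases j with _ | j
    · simp
    · simp only [Nat.add_sub_cancel, Nat.add_right_cancel_iff, Nat.factorial_succ]
      split_ifs <;> simp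

/-- A test function supported near `x₀` whose derivatives at `x₀` all vanish but one. -/
theorem exists_testFn_jet (x₀ : ℝ) {r : ℝ} (hr : 0 < r) (j : ℕ) :
    ∃ ζ : TestFn, tsupport ζ ⊆ Ioo (x₀ - r) (x₀ + r) ∧
      ∀ i, iteratedDeriv i ζ x₀ = if i = j then (j.factorial : ℂ) else 0 := by
  obtain ⟨χ, hχ, hχ1⟩ := TestFn.exists_cutoff (a := x₀) (b := x₀) (a' := x₀ - r) (b' := x₀ + r)
    (by linarith) (by linarith)
  have hs : ContDiff ℝ ∞ (fun x : ℝ => ((x : ℂ) - x₀) ^ j) :=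
    (Complex.ofRealCLM.contDiff.sub contDiff_const).pow j
  refine ⟨TestFn.smoothMul _ hs χ, (TestFn.tsupport_smoothMul _ _ _).trans hχ, fun i => ?_⟩
  rw [← iteratedDeriv_sub_pow i j x₀]
  refine Filter.EventuallyEq.iteratedDeriv_eq i ?_
  filter_upwards [hχ1 x₀ (by simp)] with y hy
  simp only [TestFn.coe_smoothMul, hy, mul_one]

theorem iteratedDeriv_eq_zero_of_notMem {u : ℝ → ℂ} {x : ℝ} (hx : x ∉ tsupport u) (i : ℕ) :
    iteratedDeriv i u x = 0 :=
  image_eq_zero_of_notMem_tsupport fun h => hx (tsupport_iteratedDeriv_subset' u i h)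

/-- The functionals are separated by test functions with one nonzero derivative at one end point and
support within distance less than `L` of it, so that the other end point is not seen. -/
theorem eq_zero_of_boundarySum {L : ℝ} (hL : 0 < L) {N : ℕ} {a : (Fin N → ℂ) × (Fin N → ℂ)}
    (h : ∀ ζ : TestFn, boundarySum L a ζ = 0) : a = 0 := by
  have key : ∀ x₀ x₁ : ℝ, |x₁ - x₀| = L → ∀ j : Fin N, ∃ ζ : TestFn,
      (∀ i : ℕ, iteratedDeriv i ζ x₁ = 0) ∧
      ∀ i : ℕ, iteratedDeriv i ζ x₀ = if i = j then ((j : ℕ).factorial : ℂ) else 0 := by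
    intro x₀ x₁ hx j
    obtain ⟨ζ, hζ, hζj⟩ := exists_testFn_jet x₀ hL j
    refine ⟨ζ, fun i => iteratedDeriv_eq_zero_of_notMem (fun hx' => ?_) i, hζj⟩
    obtain ⟨h1, h2⟩ := hζ hx'
    exact absurd hx (ne_of_lt (abs_lt.2 ⟨by linarith, by linarith⟩))
  refine Prod.ext (funext fun j => ?_) (funext fun j => ?_)
  · obtain ⟨ζ, h1, h0⟩ := key 0 L (by rw [sub_zero, abs_of_pos hL]) j
    have := h ζ
    simp only [boundarySum, h1, h0, mul_zero, add_zero, mul_ite, Fin.val_inj, Finset.sum_ite_eq',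
      Finset.mem_univ, if_true] at this
    simpa [Nat.factorial_ne_zero] using this
  · obtain ⟨ζ, h1, h0⟩ := key L 0 (by rw [zero_sub, abs_neg, abs_of_pos hL]) j
    have := h ζ
    simp only [boundarySum, h1, h0, mul_zero, zero_add, mul_ite, Fin.val_inj, Finset.sum_ite_eq',
      Finset.mem_univ, if_true] at this
    simpa [Nat.factorial_ne_zero] using this

/-- Integration by parts for functions with vanishing jets at the end points. -/
theorem integral_mul_iteratedDeriv_eq_prim {L : ℝ} (hL : 0 ≤ L) {N : ℕ} {u : ℝ → ℂ}
    (hu : ContDiff ℝ ∞ u)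
    (h0 : ∀ i < N, iteratedDeriv i u 0 = 0) (h1 : ∀ i < N, iteratedDeriv i u L = 0) {f : ℝ → ℂ}
    (hf : LocallyIntegrable f) {i j : ℕ} (hij : j + i ≤ N) :
    ∫ x in Ioc 0 L, f x * iteratedDeriv j u x =
      (-1) ^ i * ∫ x in Ioc 0 L, (prim 0)^[i] f x * iteratedDeriv (j + i) u x := by
  induction i with
  | zero => simp
  | succ i ih =>
    have hg := LocInt.iterate_prim 0 hf i
    rw [ih (by omega), integral_mul_eq_sub_primitive hL
      ((locallyIntegrable_iff.1 hg _ isCompact_Icc).mono_set Ioc_subset_Icc_self)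
      (F := prim 0 ((prim 0)^[i] f)) (fun x _ => by simp [prim])
      (fun x => hasDerivAt_iteratedDeriv hu (j + i) x) (continuous_iteratedDeriv_of_smooth hu _),
      h0 _ (by omega), h1 _ (by omega), Function.iterate_succ_apply']
    simp only [mul_zero, sub_zero, zero_sub, pow_succ, add_assoc]
    ring

theorem integral_smooth_mul_iteratedDeriv {L : ℝ} (hL : 0 ≤ L) {N : ℕ} {u v : ℝ → ℂ}
    (hu : ContDiff ℝ ∞ u) (hv : ContDiff ℝ ∞ v)
    (h0 : ∀ i < N, iteratedDeriv i u 0 = 0) (h1 : ∀ i < N, iteratedDeriv i u L = 0) {i : ℕ}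
    (hi : i ≤ N) :
    ∫ x in Ioc 0 L, v x * iteratedDeriv i u x =
      (-1) ^ i * ∫ x in Ioc 0 L, iteratedDeriv i v x * u x := by
  induction i generalizing v with
  | zero => simp
  | succ i ih =>
    have hv' := (contDiff_infty_iff_deriv.1 hv).2
    have hd := fun x => (hv.differentiable (by simp) x).hasDerivAt
    have := ih hv' (by omega)
    rw [integral_mul_eq_sub_primitive hL
      ((hv'.continuous.integrableOn_Icc).mono_set Ioc_subset_Icc_self) (F := v) (fun x _ => by
        rw [intervalIntegral.integral_eq_sub_of_hasDerivAt (fun y _ => hd y)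
          (hv'.continuous.intervalIntegrable _ _), add_sub_cancel])
      (fun x => hasDerivAt_iteratedDeriv hu i x) (continuous_iteratedDeriv_of_smooth hu _),
      h0 _ (by omega), h1 _ (by omega)] at this
    rw [iteratedDeriv_succ' (f := v), pow_succ, mul_assoc, neg_one_mul, mul_neg, ← this]
    ring

theorem exists_bound_on_Icc {u : ℝ → ℂ} (hu : Continuous u) (a b : ℝ) :
    ∃ C ≥ 0, ∀ x ∈ Icc a b, ‖u x‖ ≤ C := by
  obtain ⟨C, hC⟩ := isCompact_Icc.exists_bound_of_continuousOn hu.continuousOn (s := Icc a b)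
  exact ⟨max C 0, le_max_right _ _, fun x hx => (hC x hx).trans (le_max_left _ _)⟩

theorem memLp_interval_of_continuous {u : ℝ → ℂ} (hu : Continuous u) (L : ℝ) (p : ENNReal) :
    MemLp u p (volume.restrict (Ioo 0 L)) := by
  obtain ⟨C, -, hC⟩ := exists_bound_on_Icc hu 0 L
  refine MemLp.of_bound hu.aestronglyMeasurable C ?_
  filter_upwards [ae_restrict_mem measurableSet_Ioo] with x hx
  exact hC x (Ioo_subset_Icc_self hx)

/-- By Riesz, `D ζ` is a sum of integrals of `ζ^{(j)}` against functions in `L²`. Vanishing end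
point jets allow integration by parts to `∫ W ζ^{(N)}`; as `D` kills `C₀^∞(0, L)`, `W` is a
polynomial, and integrating back leaves `P^{(N)} = 0`. -/
theorem eq_zero_of_jet_eq_zero {L : ℝ} (hL : 0 < L) {N : ℕ} {D : TestFn →ₗ[ℂ] ℂ} {C : ℝ}
    (hC : ∀ ζ, ‖D ζ‖ ≤ C * ‖testJet N L ζ‖) (hD : ∀ ζ : TestFn, tsupport ζ ⊆ Ioo 0 L → D ζ = 0)
    {ζ : TestFn} (h0 : ∀ i < N, iteratedDeriv i ζ 0 = 0)
    (h1 : ∀ i < N, iteratedDeriv i ζ L = 0) : D ζ = 0 := by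
  obtain ⟨y, -, hy⟩ := exists_inner_of_norm_le (testJet N L) D (abs_nonneg C) fun ζ =>
    (hC ζ).trans (mul_le_mul_of_nonneg_right (le_abs_self C) (norm_nonneg _))
  replace hy : ∀ ζ, D ζ = inner ℂ y (testJet N L ζ) := hy
  set g : Fin (N + 1) → ℝ → ℂ := fun j => (Ioo 0 L).indicator fun x => star (y.coord j x)
  have hg : ∀ j, LocallyIntegrable (g j) := fun j =>
    locallyIntegrable_indicator (memLp_star (Lp.memLp (y.coord j)))
  set W : ℝ → ℂ := fun x => ∑ j : Fin (N + 1), (-1) ^ (N - j : ℕ) * (prim 0)^[N - j] (g j) x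
  have hWj : ∀ j : Fin (N + 1), LocallyIntegrable
      (fun x => (-1 : ℂ) ^ (N - j : ℕ) * (prim 0)^[N - j] (g j) x) := fun j =>
    (LocInt.iterate_prim 0 (hg j) _).smul ((-1 : ℂ) ^ (N - j : ℕ))
  have hW : LocallyIntegrable W := locallyIntegrable_finsetSum _ fun j _ => hWj j
  have key : ∀ θ : TestFn, (∀ i < N, iteratedDeriv i θ 0 = 0) →
      (∀ i < N, iteratedDeriv i θ L = 0) →
      D θ = ∫ x in Ioc 0 L, W x * iteratedDeriv N θ x := by
    intro θ hθ0 hθ1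
    simp only [W, Finset.sum_mul]
    rw [hy, JetSpace.inner_eq, integral_finsetSum]
    · refine Finset.sum_congr rfl fun j _ => ?_
      have hjN : (j : ℕ) + (N - j) = N := by omega
      have := integral_mul_iteratedDeriv_eq_prim hL.le θ.smooth hθ0 hθ1 (hg j) hjN.le
      rw [hjN] at this
      simp only [mul_assoc]
      rw [integral_const_mul, ← this, testJet_apply, inner_resL2_right,
        integral_Ioc_eq_integral_Ioo]
      refine setIntegral_congr_fun measurableSet_Ioo fun x hx => ?_
      simp only [g, indicator_of_mem hx]
      rfl
    · exact fun j _ => (LocInt.integrable_mul_iteratedDeriv (hWj j) θ N).integrableOn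
  obtain ⟨p, hp⟩ := ae_eq_polynomial_of_iteratedDeriv (Ω := Ioo 0 L) isOpen_Ioo ordConnected_Ioo
    (nonempty_Ioo.2 hL) N hW fun φ hφ => by
      rw [← hD φ hφ, key φ
        (fun i _ => iteratedDeriv_eq_zero_of_notMem (fun h => lt_irrefl _ (hφ h).1) i)
        (fun i _ => iteratedDeriv_eq_zero_of_notMem (fun h => lt_irrefl _ (hφ h).2) i)]
      exact (TestFn.integral_eq (φ := TestFn.iterDeriv N φ)
        ((TestFn.tsupport_iterDeriv N φ).trans (hφ.trans Ioo_subset_Ioc_self)) W).symm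
  set P : ℝ → ℂ := fun x => ∑ j ∈ Finset.range N, p j * (x : ℂ) ^ j
  have hP : ContDiff ℝ ∞ P := contDiff_polynomial p N
  have hWP : ∀ θ : TestFn, ∫ x in Ioc 0 L, W x * iteratedDeriv N θ x =
      ∫ x in Ioc 0 L, P x * iteratedDeriv N θ x := fun θ => by
    rw [integral_Ioc_eq_integral_Ioo, integral_Ioc_eq_integral_Ioo]
    refine setIntegral_congr_ae measurableSet_Ioo ?_
    filter_upwards [hp] with x hx hxΩ
    rw [hx hxΩ]
  -- That `P^{(N)} = 0` is read off by testing `D` on `C₀^∞(0, L)` once more, now with the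
  -- polynomial in place of `W`.
  have hPN : iteratedDeriv N P =ᵐ[volume.restrict (Ioo 0 L)] 0 := by
    refine ae_eq_zero_on_interval
      (memLp_interval_of_continuous (continuous_iteratedDeriv_of_smooth hP N) L 2) fun φ hφ => ?_
    have e0 : ∀ i < N, iteratedDeriv i φ 0 = 0 := fun i _ =>
      iteratedDeriv_eq_zero_of_notMem (fun h => lt_irrefl _ (hφ h).1) i
    have e1 : ∀ i < N, iteratedDeriv i φ L = 0 := fun i _ =>
      iteratedDeriv_eq_zero_of_notMem (fun h => lt_irrefl _ (hφ h).2) i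
    have := hD φ hφ
    rw [key φ e0 e1, hWP, integral_smooth_mul_iteratedDeriv hL.le φ.smooth hP e0 e1 le_rfl,
      integral_Ioc_eq_integral_Ioo] at this
    simpa using this
  rw [key ζ h0 h1, hWP, integral_smooth_mul_iteratedDeriv hL.le ζ.smooth hP h0 h1 le_rfl,
    integral_Ioc_eq_integral_Ioo, integral_congr_ae (g := 0)]
  · simp
  · filter_upwards [hPN] with x hx
    simp [hx]

/-- A functional which is bounded for the norm of `H^N(0, L)` and vanishes on `C₀^∞(0, L)` is a
combination of the derivatives of order less than `N` at the end points. -/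
theorem exists_eq_boundarySum {L : ℝ} (hL : 0 < L) {N : ℕ} {D : TestFn →ₗ[ℂ] ℂ} {C : ℝ}
    (hC : ∀ ζ, ‖D ζ‖ ≤ C * ‖testJet N L ζ‖)
    (hD : ∀ ζ : TestFn, tsupport ζ ⊆ Ioo 0 L → D ζ = 0) :
    ∃ a : (Fin N → ℂ) × (Fin N → ℂ), ∀ ζ, D ζ = boundarySum L a ζ := by
  let ℓ : Fin N ⊕ Fin N → TestFn →ₗ[ℂ] ℂ := Sum.elim
    (fun j => (-1 : ℂ) ^ (j : ℕ) • derivAt j 0) (fun j => (-1 : ℂ) ^ (j : ℕ) • derivAt j L)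
  -- Finitely many functionals whose common kernel lies in the kernel of `D` span `D`.
  have hmem : D ∈ Submodule.span ℂ (range ℓ) := by
    refine mem_span_of_iInf_ker_le_ker fun ζ hζ => ?_
    rw [Submodule.mem_iInf] at hζ
    refine eq_zero_of_jet_eq_zero hL hC hD (fun i hi => ?_) fun i hi => ?_
    · simpa [ℓ, derivAt_apply] using hζ (Sum.inl ⟨i, hi⟩)
    · simpa [ℓ, derivAt_apply] using hζ (Sum.inr ⟨i, hi⟩)
  obtain ⟨c, hc⟩ := (Submodule.mem_span_range_iff_exists_fun ℂ).1 hmem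
  refine ⟨(fun j => c (Sum.inl j), fun j => c (Sum.inr j)), fun ζ => ?_⟩
  rw [← hc]
  simp only [Fintype.sum_sum_type, LinearMap.add_apply, LinearMap.sum_apply, LinearMap.smul_apply,
    ℓ, Sum.elim_inl, Sum.elim_inr, derivAt_apply, smul_eq_mul, boundarySum,
    Finset.sum_add_distrib, mul_assoc]

/-! ### Differential operators and jets -/

theorem exists_deriv_diffOp (k : ℕ) {b : ℕ → ℝ → ℂ} (hb : ∀ j, ContDiff ℝ ∞ (b j)) :
    ∃ b' : ℕ → ℝ → ℂ, (∀ j, ContDiff ℝ ∞ (b' j)) ∧ b' (k + 1) = b k ∧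
      ∀ u : ℝ → ℂ, ContDiff ℝ ∞ u → deriv (diffOp k b u) = diffOp (k + 1) b' u := by
  have hb' := fun j => (contDiff_infty_iff_deriv.1 (hb j)).2
  refine ⟨fun j x => (if j ≤ k then deriv (b j) x else 0) + (if j = 0 then 0 else b (j - 1) x),
    fun j => ?_, by simp, fun u hu => funext fun x => ?_⟩
  · refine ContDiff.add ?_ ?_
    · split_ifs
      exacts [hb' j, contDiff_const]
    · split_ifs
      exacts [contDiff_const, hb _]
  · have h1 : ∀ j ∈ Finset.range (k + 1), HasDerivAt (fun y => b j y * iteratedDeriv j u y)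
        (deriv (b j) x * iteratedDeriv j u x + b j x * iteratedDeriv (j + 1) u x) x := fun j _ =>
      (((hb j).differentiable (by simp) x).hasDerivAt).mul (hasDerivAt_iteratedDeriv hu j x)
    have h2 : deriv (diffOp k b u) x = _ := (HasDerivAt.fun_sum h1).deriv
    rw [h2]
    simp only [diffOp, add_mul, Finset.sum_add_distrib]
    congr 1
    · rw [Finset.sum_range_succ _ (k + 1)]
      simp only [Nat.not_succ_le_self, if_false, zero_mul, add_zero]
      refine Finset.sum_congr rfl fun j hj => ?_
      rw [if_pos (Finset.mem_range_succ_iff.1 hj)]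
    · rw [Finset.sum_range_succ' _ (k + 1)]
      simp

/-- The derivatives of `∑ b_j u^{(j)}` are again differential expressions in `u`, with the same
leading coefficient. -/
theorem exists_iteratedDeriv_diffOp (k : ℕ) {b : ℕ → ℝ → ℂ} (hb : ∀ j, ContDiff ℝ ∞ (b j)) (i : ℕ) :
    ∃ b' : ℕ → ℝ → ℂ, (∀ j, ContDiff ℝ ∞ (b' j)) ∧ b' (k + i) = b k ∧
      ∀ u : ℝ → ℂ, ContDiff ℝ ∞ u → iteratedDeriv i (diffOp k b u) = diffOp (k + i) b' u := by
  induction i with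
  | zero => exact ⟨b, hb, rfl, fun u _ => by simp⟩
  | succ i ih =>
    obtain ⟨b₁, hb₁, hk, h⟩ := ih
    obtain ⟨b₂, hb₂, hk₂, h₂⟩ := exists_deriv_diffOp (k + i) hb₁
    exact ⟨b₂, hb₂, hk₂.trans hk, fun u hu => by rw [iteratedDeriv_succ, h u hu, h₂ u hu, add_assoc]⟩

theorem norm_resL2_smoothMul_le {u : ℝ → ℂ} (hu : ContDiff ℝ ∞ u) (L : ℝ) :
    ∃ C ≥ 0, ∀ φ : TestFn, ‖resL2 L (TestFn.toSchwartz (TestFn.smoothMul u hu φ))‖ ≤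
      C * ‖resL2 L (TestFn.toSchwartz φ)‖ := by
  obtain ⟨C, hC, hb⟩ := exists_bound_on_Icc hu.continuous 0 L
  refine ⟨C, hC, fun φ => le_of_sq_le_sq ?_ (by positivity)⟩
  rw [mul_pow, norm_resL2_sq, norm_resL2_sq, ← integral_const_mul]
  have hi : ∀ ψ : TestFn, IntegrableOn (fun x => ‖TestFn.toSchwartz ψ x‖ ^ 2) (Ioo 0 L) := fun ψ =>
    (((TestFn.toSchwartz ψ).memLp 2 volume).integrable_norm_pow (by norm_num)).integrableOn
  refine setIntegral_mono_on (hi _) ((hi _).const_mul _) measurableSet_Ioo fun x hx => ?_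
  rw [TestFn.toSchwartz_apply, TestFn.toSchwartz_apply, TestFn.coe_smoothMul, norm_mul, mul_pow]
  exact mul_le_mul_of_nonneg_right (pow_le_pow_left₀ (norm_nonneg _)
    (hb x (Ioo_subset_Icc_self hx)) 2) (by positivity)

theorem JetSpace.norm_coord_le {k : ℕ} {L : ℝ} (v : JetSpace k L) (j : Fin (k + 1)) :
    ‖v.coord j‖ ≤ ‖v‖ := by
  rw [JetSpace.norm_eq]
  exact Real.le_sqrt_of_sq_le
    (Finset.single_le_sum (fun i _ => sq_nonneg ‖v.coord i‖) (Finset.mem_univ j))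

theorem JetSpace.norm_le_sum {k : ℕ} {L : ℝ} (v : JetSpace k L) : ‖v‖ ≤ ∑ j, ‖v.coord j‖ := by
  rw [JetSpace.norm_eq]
  refine Real.sqrt_le_iff.2 ⟨Finset.sum_nonneg fun _ _ => norm_nonneg _, ?_⟩
  exact Finset.sum_sq_le_sq_sum_of_nonneg fun _ _ => norm_nonneg _

theorem norm_resL2_iterDeriv_le (k : ℕ) (L : ℝ) (φ : TestFn) {j : ℕ} (hj : j ≤ k) :
    ‖resL2 L (TestFn.toSchwartz (TestFn.iterDeriv j φ))‖ ≤ ‖testJet k L φ‖ := by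
  have := (testJet k L φ).norm_coord_le ⟨j, Nat.lt_succ_of_le hj⟩
  rwa [testJet_apply] at this

/-- `α` derivatives of an expression of order `m` reach order `m + α` at most, with coefficients
bounded on the interval. -/
theorem norm_testJet_transpose_le (m α : ℕ) {p : ℕ → ℝ → ℂ} (hp : ∀ j, ContDiff ℝ ∞ (p j)) (L : ℝ) :
    ∃ C ≥ 0, ∀ ζ : TestFn,
      ‖testJet α L (transposeTest m p hp ζ)‖ ≤ C * ‖testJet (m + α) L ζ‖ := by
  obtain ⟨b, hb, -, hbu⟩ := exists_transposeOp_eq_diffOp m hp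
  choose b' hb' _ hbb using fun i => exists_iteratedDeriv_diffOp m hb i
  choose C hC hCb using fun i j => norm_resL2_smoothMul_le (hb' i j) L
  refine ⟨∑ i : Fin (α + 1), ∑ j ∈ Finset.range (m + i + 1), C i j,
    Finset.sum_nonneg fun i _ => Finset.sum_nonneg fun j _ => hC i j, fun ζ => ?_⟩
  refine (JetSpace.norm_le_sum _).trans ?_
  rw [Finset.sum_mul]
  refine Finset.sum_le_sum fun i _ => ?_
  have hsum : TestFn.iterDeriv i (transposeTest m p hp ζ) =
      ∑ j ∈ Finset.range (m + i + 1), TestFn.smoothMul (b' i j) (hb' i j) (TestFn.iterDeriv j ζ) := by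
    ext x
    rw [TestFn.coe_iterDeriv, coe_transposeTest, hbu _ ζ.smooth, hbb i _ ζ.smooth]
    simp [diffOp, TestFn.coe_smoothMul, TestFn.coe_iterDeriv]
  rw [testJet_apply, hsum, map_sum, map_sum, Finset.sum_mul]
  refine (norm_sum_le _ _).trans (Finset.sum_le_sum fun j hj => (hCb i j _).trans ?_)
  exact mul_le_mul_of_nonneg_left (norm_resL2_iterDeriv_le _ L ζ
    (by have := Finset.mem_range.1 hj; omega)) (hC i j)

theorem norm_integral_mul_le_testJet (k : ℕ) {L : ℝ} {g : ℝ → ℂ}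
    (hg : MemLp g 2 (volume.restrict (Ioo 0 L))) :
    ∃ C ≥ 0, ∀ ζ : TestFn, ‖∫ x in Ioo 0 L, g x * ζ x‖ ≤ C * ‖testJet k L ζ‖ := by
  refine ⟨‖(memLp_star hg).toLp‖, norm_nonneg _, fun ζ => ?_⟩
  have h1 : ∫ x in Ioo 0 L, g x * ζ x =
      inner ℂ (memLp_star hg).toLp (resL2 L (TestFn.toSchwartz (TestFn.iterDeriv 0 ζ))) := by
    rw [inner_resL2_right]
    refine integral_congr_ae ?_
    filter_upwards [(memLp_star hg).coeFn_toLp] with x hx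
    rw [hx, star_star, TestFn.toSchwartz_apply, TestFn.coe_iterDeriv, iteratedDeriv_zero]
  rw [h1]
  exact (norm_inner_le_norm _ _).trans
    (mul_le_mul_of_nonneg_left (norm_resL2_iterDeriv_le k L ζ k.zero_le) (norm_nonneg _))

theorem MemH.weakDeriv_spec {n : ℕ} {Ω : Set ℝ} {f : ℝ → ℂ} (hf : MemH n Ω f) {j : ℕ} (hj : j ≤ n) :
    MemLp (weakDeriv Ω j f) 2 (volume.restrict Ω) ∧ IsWeakDeriv Ω j f (weakDeriv Ω j f) := by
  rw [weakDeriv, dif_pos (hf.2 j hj)]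
  exact (hf.2 j hj).choose_spec

theorem memLp_continuous_mul {L : ℝ} {u f : ℝ → ℂ} (hu : Continuous u)
    (hf : MemLp f 2 (volume.restrict (Ioo 0 L))) :
    MemLp (fun x => u x * f x) 2 (volume.restrict (Ioo 0 L)) :=
  hf.mul (memLp_interval_of_continuous hu L ⊤)

theorem MemH.memLp_weakDiffOp {n : ℕ} {L : ℝ} {f : ℝ → ℂ} (hf : MemH n (Ioo 0 L) f)
    {q : ℕ → ℝ → ℂ} (hq : ∀ j, ContDiff ℝ ∞ (q j)) :
    MemLp (weakDiffOp n q (Ioo 0 L) f) 2 (volume.restrict (Ioo 0 L)) :=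
  memLp_finsetSum _ fun j hj => memLp_continuous_mul (hq j).continuous
    (hf.weakDeriv_spec (Finset.mem_range_succ_iff.1 hj)).1

theorem integrable_mul_testFn {Ω : Set ℝ} {f : ℝ → ℂ} (hf : MemLp f 2 (volume.restrict Ω))
    (φ : TestFn) : IntegrableOn (fun x => f x * φ x) Ω :=
  hf.integrable_mul (φ.memLp 2 _)

theorem MemH.integral_mul_transposeOp {n : ℕ} {L : ℝ} {f : ℝ → ℂ} (hf : MemH n (Ioo 0 L) f)
    {q : ℕ → ℝ → ℂ} (hq : ∀ j, ContDiff ℝ ∞ (q j)) {ζ : TestFn} (hζ : tsupport ζ ⊆ Ioo 0 L) :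
    ∫ x in Ioo 0 L, f x * transposeOp n q ζ x =
      ∫ x in Ioo 0 L, weakDiffOp n q (Ioo 0 L) f x * ζ x := by
  simp only [transposeOp, weakDiffOp, Finset.mul_sum, Finset.sum_mul]
  have hs : ∀ j, (fun x => f x * ((-1) ^ j * iteratedDeriv j (fun t => q j t * ζ t) x)) =
      fun x => (-1) ^ j * (f x * iteratedDeriv j (TestFn.smoothMul (q j) (hq j) ζ) x) := fun j =>
    funext fun x => mul_left_comm _ _ _
  rw [integral_finsetSum, integral_finsetSum]
  · refine Finset.sum_congr rfl fun j hj => ?_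
    rw [hs, integral_const_mul, (hf.weakDeriv_spec (Finset.mem_range_succ_iff.1 hj)).2 _
      ((TestFn.tsupport_smoothMul _ _ _).trans hζ), ← mul_assoc, ← mul_pow, neg_one_mul, neg_neg,
      one_pow, one_mul]
    refine integral_congr_ae (.of_forall fun x => ?_)
    simp only [TestFn.coe_smoothMul]
    ring
  · intro j hj
    exact integrable_mul_testFn (memLp_continuous_mul (hq j).continuous
      (hf.weakDeriv_spec (Finset.mem_range_succ_iff.1 hj)).1) ζ
  · intro j _
    rw [hs]
    exact (integrable_mul_testFn hf.1
      (TestFn.iterDeriv j (TestFn.smoothMul (q j) (hq j) ζ))).const_mul _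

/-- The functional `Ph - Qf` vanishes on `C₀^∞(0, L)`, since there `h(Pᵗζ) = ⟨y, s(Qᵗζ)⟩ = ∫ f Qᵗζ`.
It is bounded for the norm of order `m + α`, which fixes the range of the boundary derivatives. -/
theorem exists_boundarySum_of_solution {n m α N : ℕ} (hN : N = m + α) {L : ℝ} (hL : 0 < L)
    {q p : ℕ → ℝ → ℂ} (hq : ∀ j, ContDiff ℝ ∞ (q j)) (hp : ∀ j, ContDiff ℝ ∞ (p j))
    {f : ℝ → ℂ} (hf : MemH n (Ioo 0 L) f) {s : TestFn →ₗ[ℂ] JetSpace α L}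
    (hs : ∀ ζ, testJet α L (transposeLin m p hp ζ) = s (transposeLin n q hq ζ))
    {y : JetSpace α L} (hy : ∀ φ : TestFn, tsupport φ ⊆ Ioo 0 L →
      inner ℂ y (s φ) = ∫ x in Ioo 0 L, f x * φ x) :
    ∃ a : (Fin N → ℂ) × (Fin N → ℂ), ∀ ζ : TestFn,
      inner ℂ y (testJet α L (transposeLin m p hp ζ)) =
        (∫ x in Ioo 0 L, weakDiffOp n q (Ioo 0 L) f x * ζ x) + boundarySum L a ζ := by
  subst hN
  have hg := hf.memLp_weakDiffOp hq
  obtain ⟨C₁, hC₁, h₁⟩ := norm_testJet_transpose_le m α hp L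
  obtain ⟨C₂, hC₂, h₂⟩ := norm_integral_mul_le_testJet (m + α) hg
  let I : TestFn →ₗ[ℂ] ℂ :=
    { toFun := fun ζ => ∫ x in Ioo 0 L, weakDiffOp n q (Ioo 0 L) f x * ζ x
      map_add' := fun ζ ζ' => by
        rw [← integral_add (integrable_mul_testFn hg ζ) (integrable_mul_testFn hg ζ')]
        exact integral_congr_ae (.of_forall fun x => mul_add _ _ _)
      map_smul' := fun c ζ => by
        rw [RingHom.id_apply, smul_eq_mul, ← integral_const_mul]
        exact integral_congr_ae (.of_forall fun x => mul_left_comm _ _ _) }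
  let D : TestFn →ₗ[ℂ] ℂ :=
    (innerSL ℂ y).toLinearMap ∘ₗ testJet α L ∘ₗ transposeLin m p hp - I
  have hD : ∀ ζ, D ζ = inner ℂ y (testJet α L (transposeLin m p hp ζ)) -
    ∫ x in Ioo 0 L, weakDiffOp n q (Ioo 0 L) f x * ζ x := fun ζ => rfl
  obtain ⟨a, ha⟩ := exists_eq_boundarySum hL (D := D) (C := ‖y‖ * C₁ + C₂) (N := m + α)
    (fun ζ => by
      rw [hD, add_mul]
      refine (norm_sub_le _ _).trans (add_le_add ?_ (h₂ ζ))
      refine (norm_inner_le_norm _ _).trans ?_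
      rw [mul_assoc]
      exact mul_le_mul_of_nonneg_left (h₁ ζ) (norm_nonneg _)) fun ζ hζ => by
      rw [hD, hs, hy (transposeLin n q hq ζ) ((tsupport_transposeTest n q hq ζ).trans hζ),
        coe_transposeLin,
        hf.integral_mul_transposeOp hq hζ, sub_self]
  exact ⟨a, fun ζ => by rw [← ha, hD, add_sub_cancel]⟩

/-! ### Bounds for solutions of `Pᵗ u = χ` -/

/-- Cauchy-Schwarz, read off from the nonnegative mean square deviation of `‖v‖` from its mean `A /
L`. -/
theorem sq_setIntegral_norm_le {L : ℝ} (hL : 0 < L) {v : ℝ → ℂ} (hv : Continuous v) :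
    (∫ x in Ioo 0 L, ‖v x‖) ^ 2 ≤ L * ∫ x in Ioo 0 L, ‖v x‖ ^ 2 := by
  set A := ∫ x in Ioo 0 L, ‖v x‖
  have h1 : IntegrableOn (fun x => ‖v x‖) (Ioo 0 L) :=
    hv.norm.integrableOn_Icc.mono_set Ioo_subset_Icc_self
  have h2 : IntegrableOn (fun x => ‖v x‖ ^ 2) (Ioo 0 L) :=
    (hv.norm.pow 2).integrableOn_Icc.mono_set Ioo_subset_Icc_self
  have h3 : ∫ x in Ioo 0 L, (‖v x‖ - A / L) ^ 2 =
      (∫ x in Ioo 0 L, ‖v x‖ ^ 2) - 2 * (A / L) * A + L * (A / L) ^ 2 := by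
    have e : ∀ x, (‖v x‖ - A / L) ^ 2 = ‖v x‖ ^ 2 - 2 * (A / L) * ‖v x‖ + (A / L) ^ 2 :=
      fun x => by ring
    simp only [e]
    have h6 : IntegrableOn (fun x => ‖v x‖ ^ 2 - 2 * (A / L) * ‖v x‖) (Ioo 0 L) :=
      h2.sub (h1.const_mul _)
    rw [integral_add h6 (integrableOn_const (by simp)),
      integral_sub h2 (h1.const_mul _), integral_const_mul]
    simp [hL.le, A]
  have h4 : 0 ≤ ∫ x in Ioo 0 L, (‖v x‖ - A / L) ^ 2 := integral_nonneg fun x => sq_nonneg _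
  rw [h3] at h4
  have h5 : (∫ x in Ioo 0 L, ‖v x‖ ^ 2) - 2 * (A / L) * A + L * (A / L) ^ 2 =
      ((L * ∫ x in Ioo 0 L, ‖v x‖ ^ 2) - A ^ 2) / L := by
    field_simp
    ring
  rw [h5] at h4
  rwa [le_div_iff₀ hL, zero_mul, sub_nonneg] at h4

theorem setIntegral_norm_testFn_le {L : ℝ} (hL : 0 < L) (φ : TestFn) :
    ∫ x in Ioo 0 L, ‖φ x‖ ≤ √L * ‖resL2 L (TestFn.toSchwartz φ)‖ := by
  refine le_of_sq_le_sq ?_ (by positivity)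
  rw [mul_pow, Real.sq_sqrt hL.le, norm_resL2_sq]
  exact sq_setIntegral_norm_le hL φ.smooth.continuous

/-- The Sobolev embedding on the interval. -/
theorem norm_iteratedDeriv_le_testJet {L : ℝ} (hL : 0 < L) (α : ℕ) :
    ∃ C ≥ 0, ∀ φ : TestFn, ∀ j < α, ∀ x ∈ Icc 0 L,
      ‖iteratedDeriv j φ x‖ ≤ C * ‖testJet α L φ‖ := by
  refine ⟨√L / L + √L, by positivity, fun φ j hj x hx => ?_⟩
  set v := iteratedDeriv j φ
  have hv : Continuous v := continuous_iteratedDeriv_of_smooth φ.smooth j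
  have hv' : Continuous (iteratedDeriv (j + 1) φ) := continuous_iteratedDeriv_of_smooth φ.smooth _
  have hi : IntegrableOn (fun t => ‖iteratedDeriv (j + 1) φ t‖) (Ioo 0 L) :=
    hv'.norm.integrableOn_Icc.mono_set Ioo_subset_Icc_self
  set B := ∫ t in Ioo 0 L, ‖iteratedDeriv (j + 1) φ t‖
  -- `v x` is compared with `v y` through the integral of the derivative; averaging over `y` gives
  -- the bound.
  have h1 : ∀ y ∈ Ioo 0 L, ‖v x‖ ≤ ‖v y‖ + B := by
    intro y hy
    have h := intervalIntegral.integral_eq_sub_of_hasDerivAt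
      (fun t _ => hasDerivAt_iteratedDeriv φ.smooth j t) (hv'.intervalIntegrable y x)
    have h2 : ‖v x - v y‖ ≤ B := by
      rw [← h]
      refine intervalIntegral.norm_integral_le_integral_norm_uIoc.trans ?_
      change _ ≤ ∫ t in Ioo 0 L, ‖iteratedDeriv (j + 1) φ t‖
      rw [← integral_Icc_eq_integral_Ioo]
      exact setIntegral_mono_set hv'.norm.integrableOn_Icc (.of_forall fun t => norm_nonneg _)
        (uIoc_subset_uIcc.trans (uIcc_subset_Icc (Ioo_subset_Icc_self hy) hx)).eventuallyLE
    have h3 := norm_add_le (v x - v y) (v y)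
    rw [sub_add_cancel] at h3
    linarith
  have h2 : L * ‖v x‖ ≤ (∫ y in Ioo 0 L, ‖v y‖) + L * B := by
    have hvi : IntegrableOn (fun t => ‖v t‖) (Ioo 0 L) :=
      hv.norm.integrableOn_Icc.mono_set Ioo_subset_Icc_self
    have := setIntegral_mono_on (integrableOn_const (by simp))
      (hvi.add (integrableOn_const (C := B) (by simp))) measurableSet_Ioo h1
    simp only [Pi.add_apply] at this
    rw [integral_add hvi (integrableOn_const (by simp))] at this
    simpa [hL.le] using this
  have h3 : ∫ y in Ioo 0 L, ‖v y‖ ≤ √L * ‖testJet α L φ‖ :=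
    (setIntegral_norm_testFn_le hL (TestFn.iterDeriv j φ)).trans
      (mul_le_mul_of_nonneg_left (norm_resL2_iterDeriv_le α L φ hj.le) (by positivity))
  have h4 : B ≤ √L * ‖testJet α L φ‖ :=
    (setIntegral_norm_testFn_le hL (TestFn.iterDeriv (j + 1) φ)).trans
      (mul_le_mul_of_nonneg_left (norm_resL2_iterDeriv_le α L φ hj) (by positivity))
  have h5 : L * ‖v x‖ ≤ L * ((√L / L + √L) * ‖testJet α L φ‖) := by
    have : L * ((√L / L + √L) * ‖testJet α L φ‖) =
        √L * ‖testJet α L φ‖ + L * (√L * ‖testJet α L φ‖) := by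
      field_simp
    rw [this]
    exact h2.trans (add_le_add h3 (mul_le_mul_of_nonneg_left h4 hL.le))
  exact le_of_mul_le_mul_left h5 hL

/-- Orders below `m` are bounded by the Cauchy estimate through the supremum of `χ`, which needs `α
> 0`. Order `m + l` with `l < α` comes from the equation differentiated `l` times and solved for the
top term. -/
theorem norm_iteratedDeriv_cauchy_le {m : ℕ} {b : ℕ → ℝ → ℂ} (hb : ∀ j, ContDiff ℝ ∞ (b j))
    (hbm : ∀ x, b m x = 1) {L : ℝ} (hL : 0 < L) {α : ℕ} (hα : 0 < α) (i : ℕ) (hi : i < m + α) :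
    ∃ C ≥ 0, ∀ (χ : TestFn) (u : ℝ → ℂ), ContDiff ℝ ∞ u → diffOp m b u = χ →
      (∀ j < m, iteratedDeriv j u (L / 2) = 0) →
      ∀ x ∈ Icc 0 L, ‖iteratedDeriv i u x‖ ≤ C * ‖testJet α L χ‖ := by
  obtain ⟨C₁, hC₁, h₁⟩ := norm_iteratedDeriv_le_testJet hL α
  -- With data at the midpoint, `[0, L]` is exactly the ball of radius `L / 2` in the Cauchy
  -- estimate.
  have hIcc : ∀ x, |x - L / 2| ≤ L / 2 ↔ x ∈ Icc 0 L := fun x => by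
    rw [abs_le, mem_Icc]
    constructor <;> rintro ⟨h, h'⟩ <;> constructor <;> linarith
  induction i using Nat.strong_induction_on with
  | _ i ih =>
    rcases lt_or_ge i m with him | him
    · obtain ⟨C₂, hC₂, h₂⟩ := cauchy_bound m hb hbm (L / 2) (L / 2)
      refine ⟨C₂ * C₁, by positivity, fun χ u hu hd h0 x hx => ?_⟩
      rw [mul_assoc]
      refine h₂ u hu h0 _ (fun t ht => ?_) i him.le x ((hIcc x).2 hx)
      rw [hd]
      simpa using h₁ χ 0 hα t ((hIcc t).1 ht)
    · obtain ⟨l, rfl⟩ := Nat.exists_eq_add_of_le him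
      obtain ⟨b', hb', hbm', hbd⟩ := exists_iteratedDeriv_diffOp m hb l
      choose B hB hBb using fun j => exists_bound_on_Icc (hb' j).continuous 0 L
      have ih' : ∀ j ∈ Finset.range (m + l), ∃ C ≥ 0, ∀ (χ : TestFn) (u : ℝ → ℂ),
          ContDiff ℝ ∞ u → diffOp m b u = χ → (∀ j < m, iteratedDeriv j u (L / 2) = 0) →
          ∀ x ∈ Icc 0 L, ‖iteratedDeriv j u x‖ ≤ C * ‖testJet α L χ‖ := fun j hj =>
        ih j (Finset.mem_range.1 hj) ((Finset.mem_range.1 hj).trans hi)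
      choose! C hC hCb using ih'
      refine ⟨C₁ + ∑ j ∈ Finset.range (m + l), B j * C j, add_nonneg hC₁
        (Finset.sum_nonneg fun j hj => mul_nonneg (hB j) (hC j hj)), fun χ u hu hd h0 x hx => ?_⟩
      have h := congrFun (hbd u hu) x
      rw [hd, diffOp, Finset.sum_range_succ, hbm', hbm, one_mul, ← sub_eq_iff_eq_add'] at h
      rw [← h, add_mul, Finset.sum_mul]
      refine (norm_sub_le _ _).trans (add_le_add (h₁ χ l (by omega) x hx) ?_)
      refine norm_sum_le_of_le _ fun j hj => ?_
      rw [norm_mul, mul_assoc]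
      exact mul_le_mul (hBb j x hx) (hCb j hj χ u hu hd h0 x hx) (norm_nonneg _) (hB j)

theorem norm_boundarySum_cauchy_le {m : ℕ} {b : ℕ → ℝ → ℂ} (hb : ∀ j, ContDiff ℝ ∞ (b j))
    (hbm : ∀ x, b m x = 1) {L : ℝ} (hL : 0 < L) {α : ℕ} (hα : 0 < α) {N : ℕ} (hN : N = m + α)
    (a : (Fin N → ℂ) × (Fin N → ℂ)) :
    ∃ C ≥ 0, ∀ (χ : TestFn) (u : ℝ → ℂ), ContDiff ℝ ∞ u → diffOp m b u = χ →
      (∀ j < m, iteratedDeriv j u (L / 2) = 0) →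
      ‖boundarySum L a u‖ ≤ C * ‖testJet α L χ‖ := by
  subst hN
  choose C hC hCb using fun i : Fin (m + α) => norm_iteratedDeriv_cauchy_le hb hbm hL hα i i.2
  refine ⟨∑ i, (‖a.1 i‖ * C i + ‖a.2 i‖ * C i), Finset.sum_nonneg fun i _ => by
    have := hC i
    positivity, fun χ u hu hd h0 => ?_⟩
  rw [boundarySum, Finset.sum_mul]
  refine norm_sum_le_of_le _ fun i _ => ?_
  have hx := hCb i χ u hu hd h0
  rw [add_mul, mul_assoc, mul_assoc]
  refine norm_add_le_of_le ?_ ?_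
  · rw [norm_mul, norm_mul, norm_pow, norm_neg, norm_one, one_pow, one_mul, mul_assoc]
    exact mul_le_mul_of_nonneg_left (hx 0 ⟨le_rfl, hL.le⟩) (norm_nonneg _)
  · rw [norm_mul, norm_mul, norm_pow, norm_neg, norm_one, one_pow, one_mul, mul_assoc]
    exact mul_le_mul_of_nonneg_left (hx L ⟨hL.le, le_rfl⟩) (norm_nonneg _)

/-! ### The representation formula -/

/-- The causal fundamental solution, with the smoothness and support properties of `y ↦ G y φ`. -/
def IsCausalFamily (m : ℕ) (p : ℕ → ℝ → ℂ) (G : ℝ → Distr) : Prop :=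
  ∀ φ : TestFn, ContDiff ℝ ∞ (fun y => G y φ) ∧ transposeOp m p (fun y => G y φ) = φ ∧
    ∀ M, tsupport φ ⊆ Iio M → ∀ y ≥ M, G y φ = 0

theorem testJet_congr {k : ℕ} {L : ℝ} {φ ψ : TestFn} (h : ∀ x ∈ Ioo 0 L, φ x = ψ x) :
    testJet k L φ = testJet k L ψ := by
  refine eq_of_inner_pairing fun χ hχ => ?_
  rw [inner_testJet_pairing, inner_testJet_pairing]
  exact setIntegral_congr_fun measurableSet_Ioo fun x hx => by simp only [h x hx]

theorem representation_eq (G : ℝ → Distr) (L : ℝ) (g : ℝ → ℂ) {N : ℕ}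
    (a : (Fin N → ℂ) × (Fin N → ℂ)) (φ : TestFn) :
    representation G L g a φ =
      (∫ y in Ioo 0 L, g y * G y φ) + boundarySum L a (fun y => G y φ) := rfl

theorem representation_transpose {m : ℕ} {p : ℕ → ℝ → ℂ} {hp : ∀ j, ContDiff ℝ ∞ (p j)}
    {G : ℝ → Distr} (hG : IsCausalFundamental m p hp G) (L : ℝ) (g : ℝ → ℂ) {N : ℕ}
    (a : (Fin N → ℂ) × (Fin N → ℂ)) (ζ : TestFn) :
    representation G L g a (transposeLin m p hp ζ) =
      (∫ y in Ioo 0 L, g y * ζ y) + boundarySum L a ζ := by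
  simp only [representation_eq, transposeLin_apply, hG.1]

/-- On the interval `φ` agrees with `Pᵗψ`, where `ψ` is `y ↦ G y φ` cut off to the left of `0`; the
formula for `Pᵗζ` is used at `ζ = ψ`. The agreement holds in neighbourhoods of `0` and `L`, so the
boundary derivatives match too. -/
theorem eq_representation {m : ℕ} {p : ℕ → ℝ → ℂ} (hp : ∀ j, ContDiff ℝ ∞ (p j))
    {G : ℝ → Distr} (hG : IsCausalFamily m p G) {L : ℝ} (hL : 0 < L) {g : ℝ → ℂ} {N k : ℕ}
    {a : (Fin N → ℂ) × (Fin N → ℂ)} {y : JetSpace k L}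
    (h : ∀ ζ : TestFn, inner ℂ y (testJet k L (transposeLin m p hp ζ)) =
      (∫ x in Ioo 0 L, g x * ζ x) + boundarySum L a ζ) (φ : TestFn) :
    inner ℂ y (testJet k L φ) = representation G L g a φ := by
  obtain ⟨M, hM⟩ := φ.exists_Iio
  obtain ⟨h1, h2, h3⟩ := hG φ
  obtain ⟨ψ, hψ, hψt⟩ := exists_transpose_cutoff (m := m) hp h1 (h3 M hM) 0
  have e : testJet k L φ = testJet k L (transposeLin m p hp ψ) := testJet_congr fun x hx => by
    rw [transposeLin_apply, hψt x hx.1.le, h2]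
  rw [e, h, representation_eq]
  congr 1
  · exact setIntegral_congr_fun measurableSet_Ioo fun x hx => by
      simp only [(hψ x hx.1.le).self_of_nhds]
  · exact boundarySum_congr L a (hψ 0 le_rfl) (hψ L hL.le)

/-- If `z` is the jet of an element of the dual, `F` is the kernel operator applied to that element,
on the whole line. -/
theorem exists_memH_of_jet {α : ℕ} {L C : ℝ} (hC : 0 ≤ C)
    {s : TestFn →ₗ[ℂ] JetSpace α L} (hsb : ∀ φ, ‖s φ‖ ≤ C * ‖sob (-(α : ℝ)) φ‖)
    (z : JetSpace α L) :
    ∃ F : ℝ → ℂ, MemH α univ F ∧ ∀ χ : TestFn, ∫ x, F x * χ x = inner ℂ z (s χ) := by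
  obtain ⟨w, -, hw⟩ := exists_inner_of_norm_le (sob (-(α : ℝ))) ((innerSL ℂ z).toLinearMap ∘ₗ s)
    (C := ‖z‖ * C) (by positivity) fun χ => by
      refine (norm_inner_le_norm z (s χ)).trans ?_
      rw [mul_assoc]
      exact mul_le_mul_of_nonneg_left (hsb χ) (norm_nonneg _)
  obtain ⟨F, hF, hFw⟩ := exists_memH_of_inner α w
  exact ⟨F, hF, fun χ => (hFw χ).trans (hw χ).symm⟩

theorem MemH.memLp {k : ℕ} {F : ℝ → ℂ} (hF : MemH k univ F) : MemLp F 2 volume := by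
  simpa using hF.1

theorem MemH.locallyIntegrable {k : ℕ} {F : ℝ → ℂ} (hF : MemH k univ F) :
    LocallyIntegrable F volume :=
  locallyIntegrable_of_memLp hF.memLp

/-- The extension is `F = Rh`: it equals `f` on `(0, L)` by the integral equation, and `QF = Ph` has
the required form. -/
theorem isAdmissible_of_solution {n m α N : ℕ} {L : ℝ} {q p : ℕ → ℝ → ℂ}
    (hq : ∀ j, ContDiff ℝ ∞ (q j)) (hp : ∀ j, ContDiff ℝ ∞ (p j)) {f : ℝ → ℂ}
    (hf : MemH n (Ioo 0 L) f) {s : TestFn →ₗ[ℂ] JetSpace α L}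
    (hs : ∀ ζ, testJet α L (transposeLin m p hp ζ) = s (transposeLin n q hq ζ))
    {C : ℝ} (hC : 0 ≤ C) (hsb : ∀ φ, ‖s φ‖ ≤ C * ‖sob (-(α : ℝ)) φ‖) {y : JetSpace α L}
    (hy : ∀ φ : TestFn, tsupport φ ⊆ Ioo 0 L → inner ℂ y (s φ) = ∫ x in Ioo 0 L, f x * φ x)
    {a : (Fin N → ℂ) × (Fin N → ℂ)}
    (ha : ∀ ζ : TestFn, inner ℂ y (testJet α L (transposeLin m p hp ζ)) =
      (∫ x in Ioo 0 L, weakDiffOp n q (Ioo 0 L) f x * ζ x) + boundarySum L a ζ) :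
    IsAdmissible n α q L f a := by
  obtain ⟨F, hF, hFs⟩ := exists_memH_of_jet hC hsb y
  refine ⟨F, hF, ?_, fun ζ => ?_⟩
  · have h1 : MemLp (fun x => F x - f x) 2 (volume.restrict (Ioo 0 L)) :=
      hF.memLp.restrict _ |>.sub hf.1
    have := ae_eq_zero_on_interval h1 fun φ hφ => by
      simp only [sub_mul]
      rw [integral_sub (LocInt.integrable_mul hF.locallyIntegrable φ).integrableOn
        (integrable_mul_testFn hf.1 φ), TestFn.integral_eq hφ, hFs, hy φ hφ, sub_self]
    filter_upwards [this] with x hx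
    exact sub_eq_zero.1 hx
  · rw [← coe_transposeLin n q hq, hFs, ← hs, ha]
    rfl

/-- `η` splits into a part to the left of `0`, killed by causality, and a part to the right of `L`,
killed by hypothesis. The transition between them takes place in `[0, L]`, where `η` vanishes. -/
theorem boundarySum_causal_eq_zero {m : ℕ} {p : ℕ → ℝ → ℂ} {G : ℝ → Distr}
    (hG : IsCausalFamily m p G) {L : ℝ} (hL : 0 < L) {N : ℕ} {a : (Fin N → ℂ) × (Fin N → ℂ)}
    (hr : ∀ φ : TestFn, tsupport φ ⊆ Ioi L → boundarySum L a (fun y => G y φ) = 0)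
    {η : TestFn} (hη : ∀ x ∈ Icc 0 L, x ∉ tsupport η) : boundarySum L a (fun y => G y η) = 0 := by
  obtain ⟨χ, hχ, hχ1⟩ : ∃ σ : ℝ → ℂ, ContDiff ℝ ∞ σ ∧ (∀ x ≤ 0, σ x = 0) ∧ ∀ x ≥ L, σ x = 1 :=
    ⟨fun x => (Real.smoothTransition (x / L) : ℂ),
      contDiff_ofReal_comp (Real.smoothTransition.contDiff.comp (contDiff_id.div_const L)),
      fun x hx => by
        simp only [Real.smoothTransition.zero_of_nonpos (div_nonpos_of_nonpos_of_nonneg hx hL.le),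
          Complex.ofReal_zero],
      fun x hx => by
        simp only [Real.smoothTransition.one_of_one_le ((one_le_div hL).2 hx), Complex.ofReal_one]⟩
  set η₁ := TestFn.smoothMul χ hχ η
  have h1 : tsupport η₁ ⊆ Ioi L := by
    intro x hx
    have hx' := TestFn.tsupport_smoothMul χ hχ η hx
    have h0 : tsupport η₁ ⊆ Ici 0 := closure_minimal (fun t ht => by
      by_contra hneg
      exact ht (by simp [η₁, TestFn.coe_smoothMul, hχ1.1 t (not_le.1 hneg).le])) isClosed_Ici
    by_contra hxL
    exact hη x ⟨h0 hx, not_lt.1 hxL⟩ hx'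
  have h2 : tsupport (η - η₁) ⊆ Iio 0 := by
    intro x hx
    have hx' : x ∈ tsupport η := by
      refine closure_mono (fun t ht => ?_) hx
      intro h
      exact ht (by simp [η₁, TestFn.coe_smoothMul, h])
    have h0 : tsupport (η - η₁) ⊆ Iic L := closure_minimal (fun t ht => by
      by_contra hneg
      exact ht (by simp [η₁, TestFn.coe_smoothMul, hχ1.2 t (not_le.1 hneg).le])) isClosed_Iic
    by_contra hxL
    exact hη x ⟨not_lt.1 hxL, h0 hx⟩ hx'
  have h3 : boundarySum L a (fun y => G y (η - η₁)) = 0 := by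
    have hc : IsCompact (tsupport (η - η₁)) := (η - η₁).hasCompactSupport
    -- Compactness keeps the support a positive distance away from `0`. So `G y` vanishes on it for
    -- `y` in a neighbourhood of `0`, and all derivatives there are zero.
    obtain ⟨M, hM0, hM⟩ : ∃ M < 0, tsupport (η - η₁) ⊆ Iio M := by
      rcases (tsupport (η - η₁)).eq_empty_or_nonempty with he | hne
      · exact ⟨-1, by norm_num, by rw [he]; exact empty_subset _⟩
      · obtain ⟨x, hx, hmax⟩ := hc.exists_isGreatest hne
        have : x < 0 := h2 hx
        exact ⟨x / 2, by linarith, fun t ht => by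
          have := hmax ht
          rw [mem_Iio]
          linarith⟩
    have hz : ∀ x ≥ 0, (fun y => G y (η - η₁)) =ᶠ[nhds x] fun _ => 0 := fun x hx => by
      filter_upwards [Ioi_mem_nhds (hM0.trans_le hx)] with y hy
      exact (hG _).2.2 M hM y (le_of_lt hy)
    rw [boundarySum_congr L a (hz 0 le_rfl) (hz L hL.le)]
    simp [boundarySum]
  have h4 : (fun y => G y η) = (fun y => G y (η - η₁)) + fun y => G y η₁ := by
    ext y
    simp
  rw [h4, boundarySum_add L a (hG _).1 (hG _).1, h3, hr η₁ h1, add_zero]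

/-- If the combination of the derivatives of `G` vanishes to the right of the interval, it is a
bounded functional for the norm of `H^α(0, L)`. -/
theorem norm_boundarySum_causal_le {m : ℕ} (hm : Even m) {p : ℕ → ℝ → ℂ}
    (hp : ∀ j, ContDiff ℝ ∞ (p j)) (hpm : ∀ x, p m x = 1) {G : ℝ → Distr}
    (hG : IsCausalFamily m p G) {L : ℝ} (hL : 0 < L) {α N : ℕ} (hα : 0 < α) (hN : N = m + α)
    {a : (Fin N → ℂ) × (Fin N → ℂ)}
    (hr : ∀ φ : TestFn, tsupport φ ⊆ Ioi L → boundarySum L a (fun y => G y φ) = 0) :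
    ∃ C ≥ 0, ∀ χ : TestFn, ‖boundarySum L a (fun y => G y χ)‖ ≤ C * ‖testJet α L χ‖ := by
  have hG' := causal_isCausalFundamental hm hp hpm hG
  obtain ⟨b, hb, hbm, hbt⟩ := transposeOp_leading_eq_one hm hp hpm
  obtain ⟨C, hC, hCb⟩ := norm_boundarySum_cauchy_le hb hbm hL hα hN a
  refine ⟨C, hC, fun χ => ?_⟩
  -- Near `[0, L]` the function `χ` equals `Pᵗζ` with `ζ` a cutoff of `u`, and the remainder
  -- contributes nothing. Hence `G` can be replaced by `u`, whose jets at the end points are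
  -- controlled by `χ` on the interval alone.
  obtain ⟨u, hu, hud, hu0⟩ := cauchy_exists m hb hbm (L / 2) χ.smooth
  obtain ⟨θ, -, hθ⟩ := TestFn.exists_cutoff (a := 0) (b := L) (a' := -1) (b' := L + 1)
    (by linarith) (by linarith)
  set ζ := TestFn.smoothMul u hu θ
  have hζ : ∀ x ∈ Icc 0 L, ζ =ᶠ[nhds x] u := fun x hx => by
    filter_upwards [hθ x hx] with t ht
    simp only [ζ, TestFn.coe_smoothMul, ht, mul_one]
  have hη : ∀ x ∈ Icc 0 L, x ∉ tsupport (χ - transposeTest m p hp ζ) := by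
    intro x hx
    rw [notMem_tsupport_iff_eventuallyEq]
    filter_upwards [(hζ x hx).eventually_nhds] with t ht
    have : transposeOp m p ζ t = χ t := by
      rw [hbt _ ζ.smooth, ← hud]
      simp only [diffOp, Filter.EventuallyEq.iteratedDeriv_eq _ ht]
    simp [coe_transposeTest, this]
  have h1 := boundarySum_causal_eq_zero hG hL hr hη
  have h2 : (fun y => G y χ) = (fun y => G y (χ - transposeTest m p hp ζ)) + ζ := by
    ext y
    simp [hG'.1]
  rw [h2, boundarySum_add L a (hG _).1 ζ.smooth, h1, zero_add,
    boundarySum_congr L a (hζ 0 ⟨le_rfl, hL.le⟩) (hζ L ⟨hL.le, le_rfl⟩)]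
  exact hCb χ u hu hud hu0

/-- The difference of the two right-hand sides is an element `z` of the dual of `H^α(0, L)`. Its
image under the kernel is the difference of the two extensions, which vanishes on the interval, so
`z` solves the homogeneous equation. -/
theorem eq_of_isAdmissible {n m α N : ℕ} (hm : Even m) (hα : 0 < α) (hN : N = m + α) {L : ℝ}
    (hL : 0 < L) {q p : ℕ → ℝ → ℂ}
    (hq : ∀ j, ContDiff ℝ ∞ (q j)) (hp : ∀ j, ContDiff ℝ ∞ (p j)) (hqn : ∀ x, q n x ≠ 0)
    (hpm : ∀ x, p m x = 1)
    (hline : ∀ u : ℝ → ℂ, IsODESolution n q u → MemLp u 2 volume → u = 0)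
    {G : ℝ → Distr} (hG : IsCausalFamily m p G) {f : ℝ → ℂ}
    {s : TestFn →ₗ[ℂ] JetSpace α L}
    (hs : ∀ ζ, testJet α L (transposeLin m p hp ζ) = s (transposeLin n q hq ζ))
    {C : ℝ} (hC : 0 ≤ C) (hsb : ∀ φ, ‖s φ‖ ≤ C * ‖sob (-(α : ℝ)) φ‖) {y : JetSpace α L}
    (hy : ∀ φ : TestFn, tsupport φ ⊆ Ioo 0 L → inner ℂ y (s φ) = ∫ x in Ioo 0 L, f x * φ x)
    (hyu : ∀ y' : JetSpace α L, (∀ φ : TestFn, tsupport φ ⊆ Ioo 0 L →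
        inner ℂ y' (s φ) = ∫ x in Ioo 0 L, f x * φ x) → y' = y)
    {a b : (Fin N → ℂ) × (Fin N → ℂ)}
    (ha : IsAdmissible n α q L f a) (hb : IsAdmissible n α q L f b)
    (hr : ∀ φ : TestFn, tsupport φ ⊆ Ioi L → boundarySum L (b - a) (fun y => G y φ) = 0) :
    b = a := by
  have hG' := causal_isCausalFundamental hm hp hpm hG
  obtain ⟨C₁, hC₁, hb₁⟩ := norm_boundarySum_causal_le hm hp hpm hG hL hα hN hr
  let D : TestFn →ₗ[ℂ] ℂ :=
    { toFun := fun χ => boundarySum L (b - a) (fun y => G y χ)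
      map_add' := fun χ χ' => by
        rw [← boundarySum_add L _ (hG χ).1 (hG χ').1]
        simp only [map_add]
        rfl
      map_smul' := fun c χ => by
        simp only [map_smul, smul_eq_mul, boundarySum, iteratedDeriv_const_mul_field,
          Finset.mul_sum, RingHom.id_apply]
        exact Finset.sum_congr rfl fun j _ => by ring }
  obtain ⟨z, -, hz⟩ := exists_inner_of_norm_le (testJet α L) D hC₁ hb₁
  replace hz : ∀ χ, boundarySum L (b - a) (fun y => G y χ) = inner ℂ z (testJet α L χ) := hz
  -- `R Qᵗ = Pᵗ` and `G(Pᵗζ) = ζ`: applying `Q` to the kernel image of `z` leaves only the boundary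
  -- terms.
  have hzB : ∀ ζ : TestFn, inner ℂ z (s (transposeLin n q hq ζ)) = boundarySum L (b - a) ζ := by
    intro ζ
    rw [← hs, ← hz]
    simp only [transposeLin_apply, hG'.1]
  obtain ⟨Fa, hFa, hFaf, hFaQ⟩ := ha
  obtain ⟨Fb, hFb, hFbf, hFbQ⟩ := hb
  obtain ⟨F, hF, hFz⟩ := exists_memH_of_jet hC hsb z
  have hdiff : ∀ φ : TestFn, ∫ x, (Fb - Fa) x * φ x = (∫ x, Fb x * φ x) - ∫ x, Fa x * φ x := by
    intro φ
    simp only [Pi.sub_apply, sub_mul]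
    exact integral_sub (LocInt.integrable_mul hFb.locallyIntegrable φ)
      (LocInt.integrable_mul hFa.locallyIntegrable φ)
  -- Both sides lie in `L²` and have the same image under `Q`, since the terms with `Qf` cancel.
  have hFF : F =ᵐ[volume] Fb - Fa :=
    eq_of_weak_solution hq hqn hline hF.memLp (hFb.memLp.sub hFa.memLp) fun ζ => by
      rw [hFz, hzB, hdiff, coe_transposeLin, hFaQ, hFbQ, boundarySum_sub_left, boundarySum,
        boundarySum]
      ring
  have hz0 : ∀ φ : TestFn, tsupport φ ⊆ Ioo 0 L → inner ℂ z (s φ) = 0 := by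
    intro φ hφ
    rw [← hFz, integral_congr_ae (g := fun x => (Fb - Fa) x * φ x)
      (by filter_upwards [hFF] with x hx; rw [hx]), ← TestFn.integral_eq hφ]
    refine integral_eq_zero_of_ae ?_
    filter_upwards [hFaf, hFbf] with x h1 h2
    simp [h1, h2]
  -- `y + z` solves the same equation as `y`, so uniqueness gives `z = 0`.
  have hz1 : z = 0 := by
    have := hyu (y + z) fun φ hφ => by rw [inner_add_left, hz0 φ hφ, add_zero, hy φ hφ]
    simpa using this
  rw [← sub_eq_zero]
  refine eq_zero_of_boundarySum hL fun ζ => ?_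
  rw [← hzB, hz1, inner_zero_left]

/-! ### Assembly of the theorem. -/

theorem theorem1p3
    -- even orders `n > m ≥ 0`, and `α = (n - m) / 2`
    (n m α : ℕ) (hn : Even n) (hm : Even m) (hmn : m < n) (hα : α = (n - m) / 2)
    -- smooth coefficients; `q_n` is real and bounded away from zero, `p_m = 1`
    (q p : ℕ → ℝ → ℂ) (hq : ∀ j, ContDiff ℝ ∞ (q j)) (hp : ∀ j, ContDiff ℝ ∞ (p j))
    (c : ℝ) (hc : 0 < c) (hqn : ∀ x, (q n x).im = 0 ∧ c ≤ |(q n x).re|)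
    (hpm : ∀ x, p m x = 1)
    -- solutions of `Q u = 0` that are square integrable on the half-lines, and on the line
    (hminus : ∃ u : Fin (n / 2) → ℝ → ℂ, LinearIndependent ℂ u ∧
      ∀ i, IsODESolution n q (u i) ∧ MemLp (u i) 2 (volume.restrict (Iio 0)))
    (hplus : ∃ u : Fin (n / 2) → ℝ → ℂ, LinearIndependent ℂ u ∧
      ∀ i, IsODESolution n q (u i) ∧ MemLp (u i) 2 (volume.restrict (Ioi 0)))
    (hline : ∀ u : ℝ → ℂ, IsODESolution n q u → MemLp u 2 volume → u = 0)
    -- the selfadjoint kernel, with `Q R = P δ(x - y)`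
    (R : ℝ → ℝ → ℂ) (hRloc : LocallyIntegrable (Function.uncurry R) volume)
    (hRself : ∀ x y, R x y = star (R y x))
    (hRL2 : ∀ φ : TestFn, MemLp (kernelOp R φ) 2 volume)
    (hR : KernelEq n m q p R)
    -- the two-sided estimates for `Q*` and `P Q*`
    (hQstar : ∃ c₃ > 0, ∃ c₄ > 0, ∀ φ : TestFn,
      c₃ * sobolevNorm (-(α : ℝ) + n) φ ≤ sobolevNorm (-(α : ℝ)) (adjointOp n q φ) ∧
      sobolevNorm (-(α : ℝ)) (adjointOp n q φ) ≤ c₄ * sobolevNorm (-(α : ℝ) + n) φ)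
    (hPQstar : ∃ c₅ > 0, ∃ c₆ > 0, ∀ φ : TestFn,
      c₅ * sobolevNorm (((n : ℝ) + m) / 2) φ ^ 2 ≤
        (∫ x, diffOp m p (adjointOp n q φ) x * star (φ x)).re ∧
      (∫ x, diffOp m p (adjointOp n q φ) x * star (φ x)).re ≤
        c₆ * sobolevNorm (((n : ℝ) + m) / 2) φ ^ 2)
    (L : ℝ) (hL : 0 < L) (f : ℝ → ℂ) (hf : MemH n (Ioo 0 L) f) :
    -- the causal fundamental solution of `P` exists, is unique, and is smooth in `y`
    ∃ G : ℝ → Distr, IsCausalFundamental m p hp G ∧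
      (∀ G' : ℝ → Distr, IsCausalFundamental m p hp G' → G' = G) ∧
      (∀ φ : TestFn, ContDiff ℝ ∞ (fun y => G y φ)) ∧
      -- the equation `R h = f` has exactly one solution in the dual of `H^α(0, L)`
      ∃ h : Distr, (MemDualH α L h ∧ SolvesOn R L f h) ∧
        (∀ h' : Distr, MemDualH α L h' → SolvesOn R L f h' → h' = h) ∧
        -- it is given by the formula, with exactly one choice of the constants
        ∃ a : (Fin (n - α) → ℂ) × (Fin (n - α) → ℂ),
          (∀ φ : TestFn, h φ = representation G L (weakDiffOp n q (Ioo 0 L) f) a φ) ∧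
          (∀ b : (Fin (n - α) → ℂ) × (Fin (n - α) → ℂ),
            (∀ φ : TestFn, h φ = representation G L (weakDiffOp n q (Ioo 0 L) f) b φ) → b = a) ∧
          -- among the constants that arise from extensions of `f`, this is the only choice for
          -- which the right-hand side of the formula vanishes for `x > L`
          IsAdmissible n α q L f a ∧
          (∀ φ : TestFn, tsupport φ ⊆ Ioi L →
            representation G L (weakDiffOp n q (Ioo 0 L) f) a φ = 0) ∧
          ∀ b : (Fin (n - α) → ℂ) × (Fin (n - α) → ℂ), IsAdmissible n α q L f b →
            (∀ φ : TestFn, tsupport φ ⊆ Ioi L →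
              representation G L (weakDiffOp n q (Ioo 0 L) f) b φ = 0) → b = a := by
  have hqn0 : ∀ x, q n x ≠ 0 := fun x h => by
    have := (hqn x).2
    rw [h, Complex.zero_re, abs_zero] at this
    linarith
  have hα0 : 0 < α := by
    obtain ⟨a, rfl⟩ := hn
    obtain ⟨b, rfl⟩ := hm
    omega
  have hN : n - α = m + α := by
    obtain ⟨a, rfl⟩ := hn
    obtain ⟨b, rfl⟩ := hm
    omega
  obtain ⟨G, hG⟩ := exists_causal_family hm hp hpm
  have hG' := causal_isCausalFundamental hm hp hpm hG
  obtain ⟨c₀, hc₀, K, hK, hform⟩ := form_bounds hn hm hmn hα hq hp hQstar hPQstar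
  obtain ⟨-, hker, hcoer⟩ := norm_kernelForm_transpose_le hq hp hqn0 hline hRloc hRself hRL2 hR
    hc₀ hK hform
  obtain ⟨s, hs, C, hC, hsb⟩ := exists_kernel_jet (L := L) hRloc hRself hRL2 hK hker
  have hsT := testJet_transpose hq hp hR hRloc hRself hs
  -- `Rφ` is a weak solution of `Qu = Pφ` with smooth right-hand side.
  have hsmooth : ∀ φ : TestFn, ∃ u : ℝ → ℂ, ContDiff ℝ ∞ u ∧ kernelOp R φ =ᵐ[volume] u := fun φ => by
    obtain ⟨u, hu, hue, -⟩ := exists_smooth_of_weak_solution n hq hqn0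
      (locallyIntegrable_of_memLp (hRL2 φ)) (contDiff_diffOp m hp φ.smooth) fun ζ => hR ζ φ
    exact ⟨u, hu, hue⟩
  obtain ⟨y, hy, hyu, h, hh, hdual, hsol, huniq⟩ := exists_solution (by omega : α ≤ n) hL hRself
    hc₀ hcoer hsmooth hs hC hsb hf
  obtain ⟨a, ha⟩ := exists_boundarySum_of_solution hN hL hq hp hf hsT hy
  have hrep : ∀ φ, h φ = representation G L (weakDiffOp n q (Ioo 0 L) f) a φ := fun φ =>
    (hh φ).trans (eq_representation hp hG hL ha φ)
  have hadm : IsAdmissible n α q L f a := isAdmissible_of_solution hq hp hf hsT hC hsb hy ha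
  -- `h` sees a test function only through its jet on `(0, L)`, so it vanishes on supports beyond
  -- `L`.
  have hright : ∀ φ : TestFn, tsupport φ ⊆ Ioi L →
      representation G L (weakDiffOp n q (Ioo 0 L) f) a φ = 0 := fun φ hφ => by
    rw [← hrep, hh, testJet_congr (ψ := 0) fun x hx =>
      image_eq_zero_of_notMem_tsupport fun hx' => lt_asymm hx.2 (hφ hx'), map_zero,
      inner_zero_right]
  refine ⟨G, hG', fun G' => causal_unique hp hG, fun φ => (hG φ).1, h, ⟨hdual, hsol⟩, huniq, a, hrep,
    fun b hb => ?_, hadm, hright, fun b hb hbr => ?_⟩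
  · rw [← sub_eq_zero]
    refine eq_zero_of_boundarySum hL fun ζ => ?_
    -- At `Pᵗζ` both representations reduce to boundary sums of `ζ` plus the same integral.
    have h1 := (hrep (transposeLin m p hp ζ)).symm.trans (hb _)
    rw [representation_transpose hG', representation_transpose hG'] at h1
    rw [boundarySum_sub_left, sub_eq_zero]
    exact (add_left_cancel h1).symm
  · refine eq_of_isAdmissible hm hα0 hN hL hq hp hqn0 hpm hline hG hsT hC hsb hy hyu hadm hb
      fun φ hφ => ?_
    have h1 := (hbr φ hφ).trans (hright φ hφ).symm
    rw [representation_eq, representation_eq] at h1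
    rw [boundarySum_sub_left, sub_eq_zero]
    exact add_left_cancel h1

end
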